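/- Let $B=\{|w|<1\}\subset\mathbb C$ be the hyperbolic disc, $\bar B$ its closure, and $\partial_\infty B=\{|w|=1\}$. The group $SU(1,1)$ of matrices $\left(\begin{smallmatrix} a&b\\ \bar b&\bar a\end{smallmatrix}\right)$, $|a|^2-|b|^2=1$, acts on $\bar B$ by $w\mapsto\frac{aw+b}{\bar b w+\bar a}$. For $\gamma=\left(\begin{smallmatrix} i\alpha&\beta\\ \bar\beta&-i\alpha\end{smallmatrix}\right)$ in its Lie algebra $\mathfrak g=\mathfrak{su}(1,1)$ ($\alpha\in\mathbb R$, $\beta\in\mathbb C$), let $\bar X_\gamma(w)=-\bar\beta w^2+2i\alpha w+\beta$ be the vector field on $\bar B$ given by the infinitesimal action, and $X_\gamma$ its restriction to $B$. A geodesic germ is a half-infinite hyperbolic geodesic ray in $B$, up to the equivalence relation of differing by a bounded piece; it has a unique point at infinity in $\partial_\infty B$. Let $S$ be a connected Riemann surface with (possibly empty) boundary and complex structure $j$. Let $A\in\Omega^1(S,\mathfrak g)$ be a smooth one-form such that the connection $d-A$ is flat, i.e. $-dA+\frac12[A,A]=0$. Let $(\delta_z)_{z\in\partial S}$ be a smooth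 family of geodesic germs whose points at infinity $\lambda_z=\partial_\infty\delta_z$ form a covariantly constant map $\lambda:\partial S\to\partial_\infty B$, meaning that $d\lambda(\xi)=\bar X_{A(\xi)}(\lambda)$ for $\xi\in T(\partial S)$ (parallel transport along $\partial S$ preserves $\lambda$). Fix, for each $z\in\partial S$, a geodesic ray $R_z$ representing the germ $\delta_z$. Write $X_A$, $\bar X_A$ for the one-forms $\xi\mapsto X_{A(\xi)}$, $\xi\mapsto\bar X_{A(\xi)}$ with values in vector fields. Let $u_k:S\to B$ ($k\in\mathbb N$) be a sequence of maps, continuously differentiable up to the boundary (for instance smooth), satisfying $$(Du_k-X_A)^{0,1}=0 \ \text{ on } S,\qquad u_k(z)\in R_z\ \text{ for } z\in\partial S,$$ where the first equation means that for each $z\in S$, the map $\xi\mapsto Du_k(\xi)-X_{A(\xi)}(u_k(z))$, $T_zS\to\mathbb C$, is complex-linear. Suppose that there are points $z_k$, all contained in a fixed compact subset of $S$, such that $u_k(z_k)\to\partial_\infty B$, i.e. $\mathrm{dist}(u_k(z_k),\partial_\infty B)\to0$ in the Euclidean metric. Then: 1. $u_k\to\partial_\infty B$ uniformly on compact subsets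 of $S$, i.e. $\mathrm{dist}(u_k(\cdot),\partial_\infty B)\to 0$ uniformly on every compact subset of $S$. 2. There is a subsequence of $(u_k)$ which converges, uniformly on compact subsets of $S$ (in the Euclidean metric on $\bar B$), to a smooth map $u_\infty:S\to\partial_\infty B$ satisfying $$Du_\infty=\bar X_A \ \text{ on } S,\qquad u_\infty(z)=\lambda_z=\partial_\infty\delta_z\ \text{ for } z\in\partial S.$$ -/

import Mathlib

open Set Filter Topology Complex
open scoped Manifold ContDiff ComplexConjugate

noncomputable section

/-! ### Riemann surfaces with boundary -/

/-- The closed upper half-plane `{Im z ≥ 0}`, on which Riemann surfaces with boundary are modelled;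
its boundary is the real axis. -/
def ClosedHalfPlane : Type := {z : ℂ // 0 ≤ z.im}

instance : TopologicalSpace ClosedHalfPlane := instTopologicalSpaceSubtype

/-- The inclusion of the closed half-plane in `ℂ`, with the retraction `x + i y ↦ x + i max(y, 0)`
as inverse. -/
def ClosedHalfPlane.inclusion : PartialEquiv ClosedHalfPlane ℂ where
  toFun := Subtype.val
  invFun z := ⟨⟨z.re, max z.im 0⟩, le_max_right _ _⟩
  source := univ
  target := {z | 0 ≤ z.im}
  map_source' z _ := z.2
  map_target' _ _ := mem_univ _
  left_inv' z _ := Subtype.ext (Complex.ext rfl (max_eq_left z.2))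
  right_inv' _ hz := Complex.ext rfl (max_eq_left hz)

theorem ClosedHalfPlane.range_inclusion :
    range ClosedHalfPlane.inclusion = {z : ℂ | 0 ≤ z.im} :=
  Subtype.range_coe

theorem ClosedHalfPlane.nonempty_interior :
    (interior (range ClosedHalfPlane.inclusion)).Nonempty := by
  rw [ClosedHalfPlane.range_inclusion]
  refine ⟨I, mem_interior.2 ⟨{z | 0 < z.im}, fun z (hz : 0 < z.im) => hz.le, ?_, by simp⟩⟩
  exact isOpen_lt continuous_const continuous_im

theorem ClosedHalfPlane.continuous_inclusion_symm :
    Continuous ClosedHalfPlane.inclusion.symm := by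
  refine Continuous.subtype_mk ?_ _
  have : (fun z : ℂ => (⟨z.re, max z.im 0⟩ : ℂ)) =
      fun z : ℂ => ((z.re : ℝ) : ℂ) + ((max z.im 0 : ℝ) : ℂ) * I := by
    funext z; apply Complex.ext <;> simp
  rw [this]
  fun_prop

/-- The closed half-plane as a model with corners over the field `𝕜` (for us, `ℝ` or `ℂ`). -/
def halfPlaneModel (𝕜 : Type*) [RCLike 𝕜] [NormedSpace 𝕜 ℂ] :
    ModelWithCorners 𝕜 ℂ ClosedHalfPlane where
  toPartialEquiv := ClosedHalfPlane.inclusion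
  source_eq := rfl
  convex_range' := by
    have h : IsRCLikeNormedField 𝕜 := inferInstance
    rw [dif_pos h]
    apply Convex.convex_isRCLikeNormedField
    rw [ClosedHalfPlane.range_inclusion]
    exact convex_halfSpace_im_ge 0
  nonempty_interior' := ClosedHalfPlane.nonempty_interior
  continuous_toFun := continuous_subtype_val
  continuous_invFun := ClosedHalfPlane.continuous_inclusion_symm

/-- The closed half-plane as a real model with corners: real differential calculus on `S`. -/
abbrev modelR : ModelWithCorners ℝ ℂ ClosedHalfPlane := halfPlaneModel ℝ

/-- The closed half-plane as a complex model with corners: transition maps which are smooth for this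
model are complex differentiable (to all orders, up to the boundary). -/
abbrev modelC : ModelWithCorners ℂ ℂ ClosedHalfPlane := halfPlaneModel ℂ

/-- A connected Riemann surface with (possibly empty) boundary: a connected, Hausdorff, second
countable space, with an atlas of charts in the closed half-plane whose transition maps are
holomorphic (and smooth up to the boundary). -/
class RiemannSurfaceWithBoundary (S : Type*) [TopologicalSpace S]
    [ChartedSpace ClosedHalfPlane S] : Prop where
  t2 : T2Space S
  secondCountable : SecondCountableTopology S
  connected : ConnectedSpace S
  holomorphic : IsManifold modelC ∞ S

/-! ### The Lie algebra `su(1,1)`, its vector fields, and the group `SU(1,1)` -/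

/-- `𝔤 = su(1,1)`. The pair `(α, β)` stands for the matrix `(iα, β; conj β, -iα)`. -/
abbrev su11 : Type := ℝ × ℂ

/-- The matrix `(iα, β; conj β, -iα)`. -/
def su11.toMatrix (γ : su11) : Matrix (Fin 2) (Fin 2) ℂ :=
  !![I * γ.1, γ.2; conj γ.2, -(I * γ.1)]

/-- The Lie bracket of `su(1,1)` in terms of `(α, β)`. -/
def su11.bracket (γ η : su11) : su11 :=
  (2 * (γ.2 * conj η.2).im, 2 * I * (γ.1 * η.2 - η.1 * γ.2))

/-- `su11.bracket` is the commutator of matrices. -/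
theorem su11.toMatrix_bracket (γ η : su11) :
    (su11.bracket γ η).toMatrix = γ.toMatrix * η.toMatrix - η.toMatrix * γ.toMatrix := by
  ext i j
  fin_cases i <;> fin_cases j <;> apply Complex.ext <;>
    simp [su11.toMatrix, su11.bracket] <;> ring

/-- The holomorphic vector field `X_γ` on the closed disc given by the infinitesimal action of
`γ ∈ su(1,1)`. -/
def vectorField (γ : su11) (w : ℂ) : ℂ :=
  -(conj γ.2) * w ^ 2 + 2 * I * γ.1 * w + γ.2

/-- `SU(1,1)`: the matrices `(a, b; conj b, conj a)` with `|a|² - |b|² = 1`. -/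
structure SU11 where
  a : ℂ
  b : ℂ
  det_eq_one : normSq a - normSq b = 1

/-- The action of `SU(1,1)` on the closed disc. -/
def SU11.act (g : SU11) (w : ℂ) : ℂ := (g.a * w + g.b) / (conj g.b * w + conj g.a)

/-- `vectorField γ` is the derivative of the action: if `g t` is a path in `SU(1,1)` starting at the
identity, with velocity `γ` at `t = 0`, then `g t w` has velocity `X_γ(w)`. -/
theorem hasDerivAt_act (g : ℝ → SU11) (γ : su11) (w : ℂ) (ha : (g 0).a = 1) (hb : (g 0).b = 0)
    (ha' : HasDerivAt (fun t => (g t).a) (I * γ.1) 0) (hb' : HasDerivAt (fun t => (g t).b) γ.2 0) :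
    HasDerivAt (fun t => (g t).act w) (vectorField γ w) 0 := by
  have hca : HasDerivAt (fun t => conj (g t).a) (conj (I * γ.1)) 0 := ha'.star
  have hcb : HasDerivAt (fun t => conj (g t).b) (conj γ.2) 0 := hb'.star
  have h := ((ha'.mul_const w).add hb').div ((hcb.mul_const w).add hca) (by simp [ha, hb])
  refine h.congr_deriv ?_
  simp [ha, hb, vectorField]
  ring

/-! ### Geodesic rays and geodesic germs in the unit disc -/

theorem SU11.normSq_denom_sub (g : SU11) (w : ℂ) :
    normSq (conj g.b * w + conj g.a) - normSq (g.a * w + g.b) = 1 - normSq w := by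
  have h := g.det_eq_one
  simp only [normSq_apply, add_re, mul_re, add_im, mul_im, conj_re, conj_im] at h ⊢
  linear_combination (1 - (w.re * w.re + w.im * w.im)) * h

theorem SU11.denom_ne_zero (g : SU11) {w : ℂ} (hw : ‖w‖ ≤ 1) :
    conj g.b * w + conj g.a ≠ 0 := by
  intro h0
  have h := g.normSq_denom_sub w
  have hw2 : normSq w ≤ 1 := by
    rw [normSq_eq_norm_sq]; exact pow_le_one₀ (norm_nonneg w) hw
  have hn : g.a * w + g.b = 0 := by
    rw [h0, map_zero] at h
    exact normSq_eq_zero.1 (le_antisymm (by linarith) (normSq_nonneg _))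
  have hd := g.det_eq_one
  have h1 : normSq g.b * normSq w = normSq g.a := by
    have := congrArg normSq (eq_neg_of_add_eq_zero_left h0)
    simpa [normSq_mul] using this
  nlinarith [normSq_nonneg g.b, normSq_nonneg w]

theorem SU11.continuousOn_act (g : SU11) : ContinuousOn g.act (Metric.closedBall 0 1) := by
  refine ContinuousOn.div (by fun_prop) (by fun_prop) fun w hw => g.denom_ne_zero ?_
  simpa using hw

theorem SU11.one_sub_normSq_act (g : SU11) {w : ℂ} (hw : ‖w‖ ≤ 1) :
    1 - normSq (g.act w) = (1 - normSq w) / normSq (conj g.b * w + conj g.a) := by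
  have h0 : normSq (conj g.b * w + conj g.a) ≠ 0 := by
    simpa [normSq_eq_zero] using g.denom_ne_zero hw
  rw [SU11.act, map_div₀, eq_div_iff h0, sub_mul, div_mul_cancel₀ _ h0, one_mul,
    g.normSq_denom_sub]

theorem SU11.norm_act_lt_one (g : SU11) {w : ℂ} (hw : ‖w‖ < 1) : ‖g.act w‖ < 1 := by
  have h := g.one_sub_normSq_act hw.le
  have hpos : 0 < normSq (conj g.b * w + conj g.a) := normSq_pos.2 (g.denom_ne_zero hw.le)
  have hw2 : 0 < 1 - normSq w := by
    rw [normSq_eq_norm_sq]; nlinarith [norm_nonneg w]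
  have : 0 < 1 - normSq (g.act w) := h ▸ div_pos hw2 hpos
  rw [normSq_eq_norm_sq] at this
  nlinarith [norm_nonneg (g.act w)]

theorem SU11.norm_act_one (g : SU11) : ‖g.act 1‖ = 1 := by
  have h := g.one_sub_normSq_act (w := 1) (by simp)
  rw [normSq_eq_norm_sq] at h
  simp only [map_one, sub_self, zero_div] at h
  nlinarith [norm_nonneg (g.act 1)]

/-- The geodesic ray `g([0,1))`. -/
def SU11.rayCarrier (g : SU11) : Set ℂ := (fun x : ℝ => g.act x) '' Ico 0 1

/-- A half-infinite geodesic ray in the hyperbolic disc: the image of the radius `[0,1)` under a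
hyperbolic isometry. -/
structure GeodesicRay where
  carrier : Set ℂ
  exists_eq : ∃ g : SU11, carrier = g.rayCarrier

instance : Membership ℂ GeodesicRay := ⟨fun R w => w ∈ R.carrier⟩

/-- The ray `g([0,1))`. -/
def SU11.ray (g : SU11) : GeodesicRay := ⟨g.rayCarrier, g, rfl⟩

/-- `l` lies in the circle at infinity, and in the closure of the ray `R`. -/
def GeodesicRay.IsEndpoint (R : GeodesicRay) (l : ℂ) : Prop := ‖l‖ = 1 ∧ l ∈ closure R.carrier

theorem SU11.isEndpoint_ray_iff (g : SU11) (l : ℂ) : g.ray.IsEndpoint l ↔ l = g.act 1 := by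
  have hc : ContinuousOn (fun x : ℝ => g.act x) (Icc 0 1) := by
    refine g.continuousOn_act.comp continuous_ofReal.continuousOn fun x hx => ?_
    simpa [abs_of_nonneg hx.1] using hx.2
  constructor
  · rintro ⟨hl, hcl⟩
    have hsub : closure g.rayCarrier ⊆ (fun x : ℝ => g.act x) '' Icc 0 1 :=
      closure_minimal (image_mono Ico_subset_Icc_self)
        (isCompact_Icc.image_of_continuousOn hc).isClosed
    obtain ⟨x, hx, rfl⟩ := hsub hcl
    rcases hx.2.lt_or_eq with h1 | rfl
    · have hx1 : ‖(x : ℂ)‖ < 1 := by simpa [abs_of_nonneg hx.1] using h1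
      exact absurd hl (g.norm_act_lt_one hx1).ne
    · simp
  · rintro rfl
    refine ⟨g.norm_act_one, ?_⟩
    have h1 : (1 : ℝ) ∈ closure (Ico (0 : ℝ) 1) := by
      rw [closure_Ico zero_ne_one]; simp
    have h2 : ContinuousWithinAt (fun x : ℝ => g.act x) (Ico 0 1) 1 :=
      (hc 1 (by simp)).mono Ico_subset_Icc_self
    have h3 := h2.mem_closure_image h1
    rw [ofReal_one] at h3
    exact h3

theorem GeodesicRay.existsUnique_isEndpoint (R : GeodesicRay) : ∃! l, R.IsEndpoint l := by
  obtain ⟨c, g, rfl⟩ := R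
  exact ⟨g.act 1, (g.isEndpoint_ray_iff _).2 rfl, fun l hl => (g.isEndpoint_ray_iff l).1 hl⟩

/-- The point at infinity of a geodesic ray. -/
def GeodesicRay.endpoint (R : GeodesicRay) : ℂ := R.existsUnique_isEndpoint.exists.choose

/-- Two rays have the same germ at infinity if they differ only by a bounded piece, meaning one
that is contained in a smaller concentric disc. -/
def GeodesicRay.SameGerm (R R' : GeodesicRay) : Prop :=
  ∃ r < (1 : ℝ), symmDiff R.carrier R'.carrier ⊆ Metric.closedBall 0 r

instance GeodesicRay.setoid : Setoid GeodesicRay where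
  r := GeodesicRay.SameGerm
  iseqv :=
    { refl := fun R => ⟨0, one_pos, by simp⟩
      symm := fun {R R'} ⟨r, hr, h⟩ => ⟨r, hr, by rwa [symmDiff_comm]⟩
      trans := fun {R R' R''} ⟨r, hr, h⟩ ⟨r', hr', h'⟩ =>
        ⟨max r r', max_lt hr hr', (symmDiff_triangle R.carrier R'.carrier R''.carrier).trans
          (union_subset (h.trans (Metric.closedBall_subset_closedBall (le_max_left _ _)))
            (h'.trans (Metric.closedBall_subset_closedBall (le_max_right _ _))))⟩ }

/-- Geodesic germs: geodesic rays up to bounded pieces. -/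
def GeodesicGerm : Type := Quotient GeodesicRay.setoid

/-- The germ at infinity of a geodesic ray. -/
def GeodesicRay.germ (R : GeodesicRay) : GeodesicGerm := Quotient.mk _ R

theorem GeodesicRay.endpoint_eq_of_sameGerm (R R' : GeodesicRay) (h : R.SameGerm R') :
    R.endpoint = R'.endpoint := by
  obtain ⟨r, hr, h⟩ := h
  obtain ⟨hl, hcl⟩ := R.existsUnique_isEndpoint.exists.choose_spec
  refine R'.existsUnique_isEndpoint.unique ⟨hl, ?_⟩
    R'.existsUnique_isEndpoint.exists.choose_spec
  have hsub : R.carrier ⊆ R'.carrier ∪ Metric.closedBall 0 r := fun w hw => by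
    by_cases hw' : w ∈ R'.carrier
    · exact Or.inl hw'
    · exact Or.inr (h (Or.inl ⟨hw, hw'⟩))
  have h2 := closure_mono hsub hcl
  rw [closure_union, Metric.isClosed_closedBall.closure_eq] at h2
  rcases h2 with h2 | h2
  · exact h2
  · rw [mem_closedBall_zero_iff, hl] at h2
    exact absurd h2 (not_le.2 hr)

/-- The point at infinity `∂_∞ δ` of a geodesic germ. -/
def GeodesicGerm.endpoint (δ : GeodesicGerm) : ℂ :=
  Quotient.lift GeodesicRay.endpoint GeodesicRay.endpoint_eq_of_sameGerm δ

/-! ### Connections and families of geodesic germs on a Riemann surface -/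

section Surface

variable {S : Type*} [TopologicalSpace S] [ChartedSpace ClosedHalfPlane S]

/-- The complex structure of `S` on the tangent space at `z`. -/
def surfaceJ (z : S) : TangentSpace modelR z →L[ℝ] TangentSpace modelR z :=
  (ContinuousLinearMap.mul ℝ ℂ I : ℂ →L[ℝ] ℂ)

/-- The derivative `Du` of a map `u : S → ℂ` at `z`. -/
def surfaceDeriv (u : S → ℂ) (z : S) : TangentSpace modelR z →L[ℝ] ℂ :=
  mfderiv modelR 𝓘(ℝ, ℂ) u z

variable (S) in
/-- (Not necessarily continuous) one-forms on `S` with values in `su(1,1)`. -/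
abbrev OneForm : Type _ := (z : S) → TangentSpace modelR z →L[ℝ] su11

/-- The expression of the one-form `A` in the chart `e`: its pullback by the inverse of `e`. -/
def OneForm.inChart (A : OneForm S) (e : OpenPartialHomeomorph S ClosedHalfPlane) (x : ℂ) :
    ℂ →L[ℝ] su11 :=
  (A ((e.extend modelR).symm x)).comp
    (mfderivWithin 𝓘(ℝ, ℂ) modelR (e.extend modelR).symm (range modelR) x)

/-- Smoothness (up to the boundary) of a one-form. -/
def OneForm.IsSmooth (A : OneForm S) : Prop :=
  ∀ e ∈ atlas ClosedHalfPlane S, ContDiffOn ℝ ∞ (A.inChart e) (e.extend modelR).target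

/-- In a chart with coordinate `s + it`, the coefficient of `ds ∧ dt` in the curvature
`F_A = -dA + ½[A,A]`; for `A = a_s ds + a_t dt`, this is `∂_t a_s - ∂_s a_t + [a_s, a_t]`. -/
def OneForm.curvatureInChart (A : OneForm S) (e : OpenPartialHomeomorph S ClosedHalfPlane)
    (x : ℂ) : su11 :=
  fderivWithin ℝ (fun y => A.inChart e y 1) (range modelR) x I
    - fderivWithin ℝ (fun y => A.inChart e y I) (range modelR) x 1
    + su11.bracket (A.inChart e x 1) (A.inChart e x I)

/-- The connection `d - A` is flat. -/
def OneForm.IsFlat (A : OneForm S) : Prop :=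
  ∀ e ∈ atlas ClosedHalfPlane S, ∀ x ∈ (e.extend modelR).target, A.curvatureInChart e x = 0

/-- The map `lam : ∂S → ∂_∞ B` is covariantly constant along `∂S`: in any chart, along the part of
the real axis corresponding to `∂S`, with coordinate `s`, it satisfies the parallel transport
equation `d lam / ds = X_{A(∂_s)}(lam)`. -/
def IsCovariantlyConstant (A : OneForm S) (lam : modelR.boundary S → ℂ) : Prop :=
  ∀ e ∈ atlas ClosedHalfPlane S, ∀ s₀ : ℝ, (s₀ : ℂ) ∈ (e.extend modelR).target →
    ∃ l : ℝ → ℂ,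
      (∀ᶠ s : ℝ in 𝓝 s₀, ∃ h : (e.extend modelR).symm s ∈ modelR.boundary S, l s = lam ⟨_, h⟩) ∧
      HasDerivAt l (vectorField (A.inChart e s₀ 1) (l s₀)) s₀

/-- Smoothness of a family of geodesic germs parametrized by `∂S`: in any chart, it is locally of
the form `s ↦ (germ of g_s([0,1)))`, with `g_s ∈ SU(1,1)` depending smoothly on `s ∈ ∂S`. -/
def IsSmoothGermFamily (δ : modelR.boundary S → GeodesicGerm) : Prop :=
  ∀ e ∈ atlas ClosedHalfPlane S, ∀ s₀ : ℝ, (s₀ : ℂ) ∈ (e.extend modelR).target →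
    ∃ U ∈ 𝓝 s₀, ∃ g : ℝ → SU11,
      ContDiffOn ℝ ∞ (fun s => (g s).a) U ∧ ContDiffOn ℝ ∞ (fun s => (g s).b) U ∧
      ∀ s ∈ U, ∃ h : (e.extend modelR).symm s ∈ modelR.boundary S, δ ⟨_, h⟩ = (g s).ray.germ

/-- Solutions `u : S → B` of the Cauchy-Riemann equation `(Du - X_A)^{0,1} = 0`, with boundary
conditions `u(z) ∈ R_z`, where `R_z`, `z ∈ ∂S`, are geodesic rays. -/
structure IsSolution (A : OneForm S) (R : modelR.boundary S → GeodesicRay) (u : S → ℂ) :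
    Prop where
  contMDiff : ContMDiff modelR 𝓘(ℝ, ℂ) 1 u
  norm_lt_one : ∀ z, ‖u z‖ < 1
  cauchyRiemann : ∀ (z : S) (v : TangentSpace modelR z),
    surfaceDeriv u z (surfaceJ z v) - vectorField (A z (surfaceJ z v)) (u z) =
      I * (surfaceDeriv u z v - vectorField (A z v) (u z))
  boundary : ∀ z : modelR.boundary S, u z ∈ R z

end Surface

/-- The circle at infinity `∂_∞ B`. -/
abbrev circleAtInfinity : Set ℂ := Metric.sphere 0 1

end

open Set Filter Topology Complex
open scoped Manifold ContDiff ComplexConjugate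

noncomputable section

/-! Since d - A is flat, it is trivial near every point: there is a local map g to SU(1,1) with dg =
Ag (`exists_gauge`). As SU(1,1) acts holomorphically, w_k = g⁻¹u_k is a holomorphic map to the disc
(`IsSolution.hasFDerivWithinAt_gauged`), and in this gauge the points at infinity of the boundary
rays become a single constant l (`exists_gauged_endpoint`). What has to be shown locally is that w_k
becomes uniformly almost constant as soon as it approaches the circle along some sequence of nearby
points.

In the interior this is the Schwarz–Pick lemma: the oscillation of w_k around q is at most 2(1 -
|w_k(q)|²).

Near the boundary, a Cayley transformation sends l to infinity and the rays to vertical half-lines.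
This produces holomorphic maps V_k to the upper half-plane with Re V_k = c on the real axis, where c
is smooth and independent of k, and with Im V_k bounded below there, at each point, by a positive
constant independent of k. Subtracting a holomorphic function whose boundary real part is c,
reflecting, and applying Schwarz–Pick makes the V_k equicontinuous wherever they are bounded. If
they stayed bounded along some sequence of points, the approach to the circle would force Im V_k to
tend to 0 at some point. Equicontinuity, together with Harnack's inequality when that point is
interior, would carry this to the real axis and contradict the lower bound. So V_k tends to infinity
uniformly, which means that w_k tends to l (`halfDisc_eventually_close`).

Both cases give the same local statement, `exists_local_convergence`. Approach to the circle, and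
then convergence of a subsequence, spread over the connected surface by open-closed arguments. The
limit is locally g applied to a constant, hence a flat section. On the boundary it lies on the
circle and in the closure of the ray, so it is the endpoint. -/

/-! ### Holomorphic functions on the half-plane with prescribed boundary real part -/

theorem continuousOn_mul_clog : ContinuousOn (fun w : ℂ => w * log w) {w | 0 ≤ w.re} := by
  intro w hw
  rcases eq_or_ne w 0 with rfl | h0
  · refine ContinuousAt.continuousWithinAt ?_
    rw [ContinuousAt, zero_mul, tendsto_zero_iff_norm_tendsto_zero]
    have h1 : Tendsto (fun w : ℂ => |‖w‖ * Real.log ‖w‖| + ‖w‖ * Real.pi) (𝓝 0) (𝓝 0) := by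
      have : Continuous fun w : ℂ => |‖w‖ * Real.log ‖w‖| + ‖w‖ * Real.pi :=
        ((Real.continuous_mul_log.comp continuous_norm).abs).add
          (continuous_norm.mul continuous_const)
      simpa using this.tendsto 0
    refine squeeze_zero (fun _ => norm_nonneg _) (fun z => ?_) h1
    rw [norm_mul, abs_mul, abs_of_nonneg (norm_nonneg z), ← mul_add]
    refine mul_le_mul_of_nonneg_left ?_ (norm_nonneg z)
    calc ‖log z‖ ≤ |(log z).re| + |(log z).im| := norm_le_abs_re_add_abs_im _
      _ ≤ |Real.log ‖z‖| + Real.pi := by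
        rw [log_re, log_im]; gcongr; exact abs_arg_le_pi z
  · refine (continuousAt_id.mul (continuousAt_clog ?_)).continuousWithinAt
    rw [mem_slitPlane_iff]
    by_contra! h
    exact h0 (Complex.ext (le_antisymm h.1 hw) h.2)

/-- The kernel `w log(-i w)`, precomposed with the retraction onto the closed upper half-plane. -/
def halfPlaneKernel (w : ℂ) : ℂ :=
  (w.re + max w.im 0 * I) * log (-I * (w.re + max w.im 0 * I))

theorem continuous_halfPlaneKernel : Continuous halfPlaneKernel := by
  have h : Continuous fun w : ℂ => -I * ((w.re : ℂ) + (max w.im 0 : ℝ) * I) := by fun_prop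
  have h2 := continuousOn_mul_clog.comp_continuous h (fun w => by simp)
  have h3 : halfPlaneKernel = fun w : ℂ => I * ((-I * ((w.re : ℂ) + (max w.im 0 : ℝ) * I)) *
      log (-I * ((w.re : ℂ) + (max w.im 0 : ℝ) * I))) := by
    funext w
    rw [halfPlaneKernel, ← mul_assoc I, ← mul_assoc I]
    simp
  rw [h3]
  exact continuous_const.mul h2

theorem hasDerivAt_halfPlaneKernel {w : ℂ} (hw : 0 < w.im) :
    HasDerivAt halfPlaneKernel (log (-I * w) + 1) w := by
  have h1 : HasDerivAt (fun w => w * log (-I * w)) (log (-I * w) + 1) w := by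
    have hm : -I * w ∈ slitPlane := by
      rw [mem_slitPlane_iff]; left; simpa using hw
    have hw0 : w ≠ 0 := by rintro rfl; simp at hw
    have := (hasDerivAt_id w).mul (((hasDerivAt_id w).const_mul (-I)).clog hm)
    refine this.congr_deriv ?_
    simp only [id]
    field_simp
  refine h1.congr_of_eventuallyEq ?_
  filter_upwards [(isOpen_lt continuous_const continuous_im).mem_nhds hw] with z hz
  have hz : 0 < z.im := hz
  rw [halfPlaneKernel, max_eq_left hz.le, re_add_im]

/-- This is why the kernel is w log(-iw): on the real axis its imaginary part is a multiple of |x|,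
a fundamental solution of the second derivative in one variable. Integrating c'' against it
therefore recovers c up to an affine function. -/
theorem im_halfPlaneKernel_ofReal (x : ℝ) :
    (halfPlaneKernel x).im = -(Real.pi / 2) * |x| := by
  have h : halfPlaneKernel x = x * log (-I * x) := by simp [halfPlaneKernel]
  rw [h, im_ofReal_mul, log_im]
  rcases lt_trichotomy x 0 with hx | rfl | hx
  · have : -I * (x : ℂ) = ((-x : ℝ) : ℂ) * I := by push_cast; ring
    rw [this, arg_real_mul _ (neg_pos.2 hx), arg_I, abs_of_neg hx]; ring
  · simp
  · have : -I * (x : ℂ) = (x : ℂ) * (-I) := by ring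
    rw [this, arg_real_mul _ hx, arg_neg_I, abs_of_pos hx]; ring

/-- Split at t = s; on either side c''(t)(s - t) has the antiderivative c'(t)(s - t) + c(t). The
boundary terms at a and b are affine in s. -/
theorem integral_mul_abs_sub {a b s : ℝ} (hs : s ∈ Icc a b) {c c' c'' : ℝ → ℝ}
    (h1 : ∀ x ∈ Icc a b, HasDerivWithinAt c (c' x) (Icc a b) x)
    (h2 : ∀ x ∈ Icc a b, HasDerivWithinAt c' (c'' x) (Icc a b) x)
    (h3 : ContinuousOn c'' (Icc a b)) :
    ∫ t in a..b, c'' t * |s - t| =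
      2 * c s - (c a + c' a * (s - a) + c b - c' b * (b - s)) := by
  have hi : ∀ {u v : ℝ}, u ∈ Icc a b → v ∈ Icc a b →
      IntervalIntegrable (fun t => c'' t * |s - t|) MeasureTheory.volume u v := by
    intro u v hu hv
    refine ContinuousOn.intervalIntegrable ?_
    exact (h3.mono (ordConnected_Icc.uIcc_subset hu hv)).mul (by fun_prop)
  have ha : a ∈ Icc a b := ⟨le_rfl, hs.1.trans hs.2⟩
  have hb : b ∈ Icc a b := ⟨hs.1.trans hs.2, le_rfl⟩
  have hcont : ContinuousOn (fun t => c' t * (s - t) + c t) (Icc a b) :=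
    fun t ht => ((((h2 t ht).mul ((hasDerivWithinAt_id t _).const_sub s)).add (h1 t ht))).continuousWithinAt
  have hder : ∀ t ∈ Ioo a b, HasDerivAt (fun t => c' t * (s - t) + c t) (c'' t * (s - t)) t := by
    intro t ht
    have hn : Icc a b ∈ 𝓝 t := Icc_mem_nhds ht.1 ht.2
    have := (((h2 t (Ioo_subset_Icc_self ht)).mul ((hasDerivWithinAt_id t _).const_sub s)).add
      (h1 t (Ioo_subset_Icc_self ht))).hasDerivAt hn
    exact this.congr_deriv (by simp)
  rw [← intervalIntegral.integral_add_adjacent_intervals (hi ha hs) (hi hs hb)]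
  have e1 : ∫ t in a..s, c'' t * |s - t| = c s - (c' a * (s - a) + c a) := by
    have hcg : ∫ t in a..s, c'' t * |s - t| = ∫ t in a..s, c'' t * (s - t) := by
      refine intervalIntegral.integral_congr fun t ht => ?_
      rw [uIcc_of_le hs.1] at ht
      simp only [abs_of_nonneg (sub_nonneg.2 ht.2)]
    rw [hcg, intervalIntegral.integral_eq_sub_of_hasDerivAt_of_le hs.1
      (hcont.mono (Icc_subset_Icc_right hs.2))
      (fun t ht => hder t ⟨ht.1, ht.2.trans_le hs.2⟩)]
    · simp
    · exact ContinuousOn.intervalIntegrable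
        ((h3.mono (ordConnected_Icc.uIcc_subset ha hs)).mul (by fun_prop))
  have e2 : ∫ t in s..b, c'' t * |s - t| = c s - (c' b * (s - b) + c b) := by
    have hcg : ∫ t in s..b, c'' t * |s - t| = -∫ t in s..b, c'' t * (s - t) := by
      rw [← intervalIntegral.integral_neg]
      refine intervalIntegral.integral_congr fun t ht => ?_
      rw [uIcc_of_le hs.2] at ht
      simp only [abs_of_nonpos (sub_nonpos.2 ht.1)]; ring
    rw [hcg, intervalIntegral.integral_eq_sub_of_hasDerivAt_of_le hs.2
      (hcont.mono (Icc_subset_Icc_left hs.1))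
      (fun t ht => hder t ⟨hs.1.trans_lt ht.1, ht.2⟩)]
    · simp
    · exact ContinuousOn.intervalIntegrable
        ((h3.mono (ordConnected_Icc.uIcc_subset hs hb)).mul (by fun_prop))
  rw [e1, e2]; ring

/-- A `C²` function on an interval is the boundary value of the real part of a holomorphic function
on the upper half-plane. -/
theorem exists_holomorphic_re_eq {a b : ℝ} (hab : a ≤ b) {c c' c'' : ℝ → ℝ}
    (h1 : ∀ x ∈ Icc a b, HasDerivWithinAt c (c' x) (Icc a b) x)
    (h2 : ∀ x ∈ Icc a b, HasDerivWithinAt c' (c'' x) (Icc a b) x)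
    (h3 : ContinuousOn c'' (Icc a b)) :
    ∃ h : ℂ → ℂ, Continuous h ∧ DifferentiableOn ℂ h {z | 0 < z.im} ∧
      ∀ s ∈ Icc a b, (h s).re = c s := by
  -- Extending c'' by its end values makes the integrand jointly continuous on the whole plane
  -- without changing the integral.
  set f : ℝ → ℝ := IccExtend hab ((Icc a b).domRestrict c'') with hf
  have hfc : Continuous f := (continuousOn_iff_continuous_domRestrict.1 h3).Icc_extend'
  have hfe : ∀ t ∈ Icc a b, f t = c'' t := fun t ht => by
    simp [hf, IccExtend_of_mem _ _ ht, Set.domRestrict]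
  set J : ℂ → ℂ := fun z => ∫ t in a..b, (f t : ℂ) * halfPlaneKernel (z - t) with hJ
  have hJc : Continuous J := by
    refine intervalIntegral.continuous_parametric_intervalIntegral_of_continuous' ?_ a b
    refine Continuous.mul (by fun_prop) (continuous_halfPlaneKernel.comp (by fun_prop))
  have hJd : DifferentiableOn ℂ J {z | 0 < z.im} := by
    intro z hz
    have hz : 0 < z.im := hz
    obtain ⟨M, hM⟩ : ∃ M, ∀ x ∈ Metric.closedBall z (z.im / 2) ×ˢ Icc a b,
        ‖(f x.2 : ℂ) * (log (-I * (x.1 - x.2)) + 1)‖ ≤ M := by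
      refine ((isCompact_closedBall z _).prod isCompact_Icc).exists_bound_of_continuousOn ?_
      refine ContinuousOn.mul (by fun_prop) (ContinuousOn.add ?_ continuousOn_const)
      refine ContinuousOn.clog (by fun_prop) fun x hx => ?_
      have h := abs_im_le_norm (x.1 - z)
      have h' : ‖x.1 - z‖ ≤ z.im / 2 := by simpa [dist_eq_norm] using hx.1
      rw [sub_im] at h
      rw [mem_slitPlane_iff]; left
      have := abs_le.1 (h.trans h')
      simp; linarith
    have hpos : ∀ x ∈ Metric.ball z (z.im / 2), 0 < x.im := fun x hx => by
      have h := abs_im_le_norm (x - z)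
      have h' : ‖x - z‖ < z.im / 2 := by simpa [dist_eq_norm] using hx
      rw [sub_im] at h
      have := abs_lt.1 (h.trans_lt h')
      linarith
    have := intervalIntegral.hasDerivAt_integral_of_dominated_loc_of_deriv_le
      (μ := MeasureTheory.volume) (a := a) (b := b) (bound := fun _ => M)
      (F := fun z t => (f t : ℂ) * halfPlaneKernel (z - t))
      (F' := fun z t => (f t : ℂ) * (log (-I * (z - t)) + 1)) (x₀ := z)
      (Metric.ball_mem_nhds z (half_pos hz)) ?_ ?_ ?_ ?_ ?_ ?_
    · exact this.2.differentiableAt.differentiableWithinAt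
    · refine .of_forall fun x => Continuous.aestronglyMeasurable ?_
      exact Continuous.mul (by fun_prop) (continuous_halfPlaneKernel.comp (by fun_prop))
    · refine Continuous.intervalIntegrable ?_ _ _
      exact Continuous.mul (by fun_prop) (continuous_halfPlaneKernel.comp (by fun_prop))
    · refine Continuous.aestronglyMeasurable ?_
      refine Continuous.mul (by fun_prop) (Continuous.add (Continuous.clog (by fun_prop) ?_)
        continuous_const)
      intro t
      rw [mem_slitPlane_iff]; left; simpa using hz
    · refine .of_forall fun t ht x hx => hM (x, t) ⟨Metric.ball_subset_closedBall hx, ?_⟩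
      rw [uIoc_of_le hab] at ht
      exact Ioc_subset_Icc_self ht
    · exact intervalIntegrable_const
    · refine .of_forall fun t ht x hx => HasDerivAt.const_mul _ ?_
      have := (hasDerivAt_halfPlaneKernel (w := x - t) (by simpa using hpos x hx)).comp x
        ((hasDerivAt_id x).sub_const (t : ℂ))
      simpa [Function.comp_def] using this
  -- The affine term cancels the boundary terms of `integral_mul_abs_sub`; the factor I/π turns the
  -- imaginary part -(π/2)|s - t| of the kernel into the real part |s - t|/2.
  refine ⟨fun z => ((c a + c' a * (z - a) + c b - c' b * (b - z)) / 2 : ℂ) + I / Real.pi * J z,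
    by fun_prop, ?_, fun s hs => ?_⟩
  · exact DifferentiableOn.add (by fun_prop) (hJd.const_mul _)
  · have him : (J s).im = ∫ t in a..b, c'' t * (-(Real.pi / 2) * |s - t|) := by
      have e := imCLM.intervalIntegral_comp_comm (μ := MeasureTheory.volume) (a := a) (b := b)
        (f := fun t => (f t : ℂ) * halfPlaneKernel (s - t))
        (Continuous.intervalIntegrable (Continuous.mul (by fun_prop)
          (continuous_halfPlaneKernel.comp (by fun_prop))) _ _)
      simp only [imCLM_apply] at e
      rw [hJ, ← e]
      refine intervalIntegral.integral_congr fun t ht => ?_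
      rw [uIcc_of_le hab] at ht
      simp only [im_ofReal_mul]
      rw [← ofReal_sub, im_halfPlaneKernel_ofReal, hfe t ht]
    have hre : (I / Real.pi * J s).re = (∫ t in a..b, c'' t * |s - t|) / 2 := by
      have : (I / Real.pi * J s).re = -(J s).im / Real.pi := by
        rw [mul_comm_div, I_mul_re]
        rw [div_ofReal_im]; ring
      rw [this, him, ← intervalIntegral.integral_neg, ← intervalIntegral.integral_div,
        ← intervalIntegral.integral_div]
      refine intervalIntegral.integral_congr fun t _ => ?_
      have := Real.pi_ne_zero
      field_simp
    rw [add_re, hre, integral_mul_abs_sub hs h1 h2 h3]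
    have : ((c a + c' a * (s - a) + c b - c' b * (b - s)) / 2 : ℂ) =
        ((c a + c' a * (s - a) + c b - c' b * (b - s)) / 2 : ℝ) := by push_cast; rfl
    rw [this, ofReal_re]; ring

/-! ### The Schwarz–Pick lemma -/

/-- Move f(c) to 0 by a Möbius transformation and apply the Schwarz lemma. On two thirds of the
radius this gives |f(x) - f(c)| ≤ (2/3)((1 - |f(c)|²) + |f(x) - f(c)|), whence the factor 2. The
point is the right-hand side: a value close to the circle makes f almost constant. -/
theorem norm_sub_le_schwarzPick_disc {f : ℂ → ℂ} {c x : ℂ} {r : ℝ}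
    (hd : DifferentiableOn ℂ f (Metric.ball c r)) (hf : ∀ y ∈ Metric.ball c r, ‖f y‖ < 1)
    (hx : x ∈ Metric.ball c r) (hxr : dist x c ≤ 2 / 3 * r) :
    ‖f x - f c‖ ≤ 2 * (1 - ‖f c‖ ^ 2) := by
  have hr : 0 < r := Metric.nonempty_ball.1 ⟨x, hx⟩
  have hc : ‖f c‖ < 1 := hf c (Metric.mem_ball_self hr)
  have key : ∀ z : ℂ, ‖1 - conj (f c) * z‖ ^ 2 - ‖z - f c‖ ^ 2 =
      (1 - ‖f c‖ ^ 2) * (1 - ‖z‖ ^ 2) := by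
    intro z
    simp only [← normSq_eq_norm_sq, normSq_apply, sub_re, sub_im, mul_re, mul_im, conj_re, conj_im,
      one_re, one_im]
    ring
  have hpos : 0 < 1 - ‖f c‖ ^ 2 := by nlinarith [norm_nonneg (f c)]
  have hlt : ∀ y ∈ Metric.ball c r, ‖f y - f c‖ < ‖1 - conj (f c) * f y‖ := fun y hy => by
    have h1 : 0 < 1 - ‖f y‖ ^ 2 := by nlinarith [norm_nonneg (f y), hf y hy]
    refine lt_of_pow_lt_pow_left₀ 2 (norm_nonneg _) ?_
    nlinarith [key (f y), mul_pos hpos h1]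
  have hne : ∀ y ∈ Metric.ball c r, 1 - conj (f c) * f y ≠ 0 := fun y hy =>
    norm_pos_iff.1 ((norm_nonneg _).trans_lt (hlt y hy))
  set g : ℂ → ℂ := fun y => (f y - f c) / (1 - conj (f c) * f y) with hg
  have hgc : g c = 0 := by simp [hg]
  have h := dist_le_div_mul_dist_of_mapsTo_ball (f := g) (c := c) (z := x) (R₁ := r) (R₂ := 1)
    ((hd.sub_const _).div ((hd.const_mul _).const_sub 1) hne) (fun y hy => by
      rw [hgc, mem_closedBall_zero_iff, norm_div]
      exact div_le_one_of_le₀ (hlt y hy).le (norm_nonneg _)) hx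
  rw [hgc, dist_zero_right, norm_div] at h
  have h2 : 1 / r * dist x c ≤ 2 / 3 := by
    rw [one_div_mul_eq_div, div_le_iff₀ hr]; exact hxr
  have h3 : ‖f x - f c‖ ≤ 2 / 3 * ‖1 - conj (f c) * f x‖ := by
    have := h.trans h2
    rwa [div_le_iff₀ (norm_pos_iff.2 (hne x hx))] at this
  have h4 : ‖1 - conj (f c) * f x‖ ≤ (1 - ‖f c‖ ^ 2) + ‖f x - f c‖ := by
    have e : 1 - conj (f c) * f x = ((1 - ‖f c‖ ^ 2 : ℝ) : ℂ) - conj (f c) * (f x - f c) := by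
      have := conj_mul' (f c)
      push_cast
      rw [mul_sub, this]; ring
    rw [e]
    refine (norm_sub_le _ _).trans ?_
    rw [norm_real, Real.norm_of_nonneg hpos.le, norm_mul, norm_conj]
    gcongr
    exact mul_le_of_le_one_left (norm_nonneg _) hc.le
  linarith

/-- The Schwarz lemma again, now for (f - f(c))/(f - conj f(c)). The bound also contains a Harnack
inequality for Im f. The 6 is 2/(1 - 2/3). -/
theorem norm_sub_le_schwarzPick_halfPlane {f : ℂ → ℂ} {c x : ℂ} {r : ℝ}
    (hd : DifferentiableOn ℂ f (Metric.ball c r)) (hf : ∀ y ∈ Metric.ball c r, 0 < (f y).im)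
    (hx : x ∈ Metric.ball c r) (hxr : dist x c ≤ 2 / 3 * r) :
    ‖f x - f c‖ ≤ 6 * (dist x c / r) * (f c).im := by
  have hr : 0 < r := Metric.nonempty_ball.1 ⟨x, hx⟩
  have hc : 0 < (f c).im := hf c (Metric.mem_ball_self hr)
  have hlt : ∀ y ∈ Metric.ball c r, ‖f y - f c‖ < ‖f y - conj (f c)‖ := fun y hy => by
    have h1 := hf y hy
    refine lt_of_pow_lt_pow_left₀ 2 (norm_nonneg _) ?_
    simp only [← normSq_eq_norm_sq, normSq_apply, sub_re, sub_im, conj_re, conj_im]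
    nlinarith
  have hne : ∀ y ∈ Metric.ball c r, f y - conj (f c) ≠ 0 := fun y hy =>
    norm_pos_iff.1 ((norm_nonneg _).trans_lt (hlt y hy))
  set g : ℂ → ℂ := fun y => (f y - f c) / (f y - conj (f c)) with hg
  have hgc : g c = 0 := by simp [hg]
  have h := dist_le_div_mul_dist_of_mapsTo_ball (f := g) (c := c) (z := x) (R₁ := r) (R₂ := 1)
    ((hd.sub_const _).div (hd.sub_const _) hne) (fun y hy => by
      rw [hgc, mem_closedBall_zero_iff, norm_div]
      exact div_le_one_of_le₀ (hlt y hy).le (norm_nonneg _)) hx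
  rw [hgc, dist_zero_right, norm_div, one_div_mul_eq_div,
    div_le_iff₀ (norm_pos_iff.2 (hne x hx))] at h
  have hρ : dist x c / r ≤ 2 / 3 := by rwa [div_le_iff₀ hr]
  have hρ0 : 0 ≤ dist x c / r := by positivity
  have h4 : ‖f x - conj (f c)‖ ≤ ‖f x - f c‖ + 2 * (f c).im := by
    have e : f x - conj (f c) = (f x - f c) + ((2 * (f c).im : ℝ) : ℂ) * I := by
      apply Complex.ext <;> simp; ring
    rw [e]
    refine (norm_add_le _ _).trans ?_
    rw [norm_mul, norm_I, mul_one, norm_real, Real.norm_of_nonneg (by positivity)]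
  have h5 : ‖f x - f c‖ ≤ 2 / 3 * ‖f x - f c‖ + dist x c / r * (2 * (f c).im) := by
    calc _ ≤ dist x c / r * (‖f x - f c‖ + 2 * (f c).im) := h.trans (by gcongr)
      _ ≤ _ := by rw [mul_add]; gcongr
  linarith

/-! ### The Schwarz reflection principle -/

theorem wedgeIntegral_eq_neg_of_rect {f : ℂ → ℂ} {z w : ℂ}
    (h : (∫ x : ℝ in z.re..w.re, f (x + z.im * I)) - (∫ x : ℝ in z.re..w.re, f (x + w.im * I)) +
      I • (∫ y : ℝ in z.im..w.im, f (re w + y * I)) -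
      I • (∫ y : ℝ in z.im..w.im, f (re z + y * I)) = 0) :
    wedgeIntegral z w f = -wedgeIntegral w z f := by
  rw [← add_eq_zero_iff_eq_neg, wedgeIntegral_add_wedgeIntegral_eq]; exact h

/-- A continuous function on a disc which is holomorphic off the real axis is holomorphic. -/
theorem differentiableOn_of_differentiableOn_off_real {f : ℂ → ℂ} {c : ℂ} {r : ℝ}
    (hf : ContinuousOn f (Metric.ball c r))
    (hd : DifferentiableOn ℂ f (Metric.ball c r ∩ {z | z.im ≠ 0})) :
    DifferentiableOn ℂ f (Metric.ball c r) := by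
  refine (IsConservativeOn.isExactOn_ball hf fun z w hzw => ?_).differentiableOn Metric.isOpen_ball
  refine wedgeIntegral_eq_neg_of_rect ?_
  have hzw' : ∀ x ∈ uIcc z.re w.re, ∀ y ∈ uIcc z.im w.im, (x + y * I : ℂ) ∈ Metric.ball c r := by
    intro x hx y hy
    exact hzw (by simpa [Rectangle, mem_reProdIm] using ⟨hx, hy⟩)
  -- rectangles not crossing the real axis
  have rect : ∀ y₁ ∈ uIcc z.im w.im, ∀ y₂ ∈ uIcc z.im w.im, (0 : ℝ) ∉ Ioo (min y₁ y₂) (max y₁ y₂) →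
      (∫ x : ℝ in z.re..w.re, f (x + y₁ * I)) - (∫ x : ℝ in z.re..w.re, f (x + y₂ * I)) +
      I • (∫ y : ℝ in y₁..y₂, f (re w + y * I)) - I • (∫ y : ℝ in y₁..y₂, f (re z + y * I)) = 0 := by
    intro y₁ h₁ y₂ h₂ h0
    have hsub : uIcc y₁ y₂ ⊆ uIcc z.im w.im := uIcc_subset_uIcc h₁ h₂
    have hmem : ∀ u : ℂ, u.re ∈ uIcc z.re w.re → u.im ∈ uIcc y₁ y₂ → u ∈ Metric.ball c r := by
      intro u hu hu'
      have := hzw' _ hu _ (hsub hu')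
      rwa [re_add_im] at this
    have := integral_boundary_rect_eq_zero_of_continuousOn_of_differentiableOn f
      ⟨z.re, y₁⟩ ⟨w.re, y₂⟩ (hf.mono fun u hu => hmem u hu.1 hu.2)
      (hd.mono fun u hu => ⟨hmem u (Ioo_subset_Icc_self hu.1) (Ioo_subset_Icc_self hu.2),
        fun h => h0 (h ▸ hu.2)⟩)
    simpa using this
  -- A rectangle crossing the real axis is cut along it. Each half meets the axis only in an edge,
  -- so continuity up to the edge is enough for Cauchy's theorem.
  by_cases h0 : (0 : ℝ) ∈ Ioo (min z.im w.im) (max z.im w.im)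
  · have h0' : (0 : ℝ) ∈ uIcc z.im w.im := Ioo_subset_Icc_self h0
    have r1 := rect z.im left_mem_uIcc 0 h0' (by
      rcases le_total z.im 0 with h | h <;> simp [h])
    have r2 := rect 0 h0' w.im right_mem_uIcc (by
      rcases le_total w.im 0 with h | h <;> simp [h])
    have hint : ∀ a ∈ uIcc z.re w.re, ∀ y₁ ∈ uIcc z.im w.im, ∀ y₂ ∈ uIcc z.im w.im,
        IntervalIntegrable (fun y : ℝ => f (a + y * I)) MeasureTheory.volume y₁ y₂ := by
      intro a ha y₁ h₁ y₂ h₂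
      refine ContinuousOn.intervalIntegrable ?_
      exact hf.comp (by fun_prop) fun y hy => hzw' a ha y (uIcc_subset_uIcc h₁ h₂ hy)
    have a1 := intervalIntegral.integral_add_adjacent_intervals
      (hint w.re right_mem_uIcc z.im left_mem_uIcc 0 h0')
      (hint w.re right_mem_uIcc 0 h0' w.im right_mem_uIcc)
    have a2 := intervalIntegral.integral_add_adjacent_intervals
      (hint z.re left_mem_uIcc z.im left_mem_uIcc 0 h0')
      (hint z.re left_mem_uIcc 0 h0' w.im right_mem_uIcc)
    rw [← a1, ← a2]
    simp only [smul_eq_mul] at r1 r2 ⊢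
    linear_combination r1 + r2
  · exact rect z.im left_mem_uIcc w.im right_mem_uIcc h0

/-- As f is imaginary on the real axis, -conj(f(conj z)) continues it. The map w ↦ -conj w preserves
the upper half-plane, so the extension still has positive imaginary part, and Schwarz–Pick applies
to it on the full disc. -/
theorem exists_reflection {f : ℂ → ℂ} {s r : ℝ}
    (hf : ContinuousOn f (Metric.ball (s : ℂ) r ∩ {z | 0 ≤ z.im}))
    (hd : DifferentiableOn ℂ f (Metric.ball (s : ℂ) r ∩ {z | 0 < z.im}))
    (hre : ∀ x : ℝ, (x : ℂ) ∈ Metric.ball (s : ℂ) r → (f x).re = 0)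
    (him : ∀ z ∈ Metric.ball (s : ℂ) r, 0 ≤ z.im → 0 < (f z).im) :
    ∃ F : ℂ → ℂ, DifferentiableOn ℂ F (Metric.ball (s : ℂ) r) ∧
      (∀ z, 0 ≤ z.im → F z = f z) ∧ ∀ z ∈ Metric.ball (s : ℂ) r, 0 < (F z).im := by
  set B := Metric.ball (s : ℂ) r with hB
  have hconj : ∀ z : ℂ, conj z ∈ B ↔ z ∈ B := fun z => by
    have : dist (conj z) (s : ℂ) = dist z s := by
      conv_lhs => rw [← conj_ofReal s]
      exact dist_conj_conj z s
    rw [hB, Metric.mem_ball, Metric.mem_ball, this]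
  set F : ℂ → ℂ := fun z => if 0 ≤ z.im then f z else -conj (f (conj z)) with hF
  refine ⟨F, differentiableOn_of_differentiableOn_off_real ?_ ?_, fun z hz => by simp [hF, hz],
    fun z hz => ?_⟩
  · have hcl : closure {z : ℂ | 0 ≤ z.im} = {z | 0 ≤ z.im} :=
      (isClosed_le continuous_const continuous_im).closure_eq
    have hcl2 : closure {z : ℂ | ¬ 0 ≤ z.im} ⊆ {z | z.im ≤ 0} :=
      closure_minimal (fun z hz => (not_le.1 hz).le) (isClosed_le continuous_im continuous_const)
    refine ContinuousOn.if ?_ ?_ ?_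
    · rintro z ⟨hz, hfr⟩
      have h1 : 0 ≤ z.im := by have := hfr.1; rwa [hcl] at this
      have h2 : z.im ≤ 0 := by
        have := frontier_subset_closure (frontier_compl {z : ℂ | 0 ≤ z.im} ▸ hfr)
        exact hcl2 this
      have h3 : z = (z.re : ℂ) := Complex.ext rfl (by simpa using le_antisymm h2 h1)
      rw [h3, conj_ofReal]
      have h4 := hre z.re (h3 ▸ hz)
      exact Complex.ext (by simp [h4]) (by simp)
    · rw [hcl]; exact hf
    · refine (ContinuousOn.neg (continuous_conj.comp_continuousOn
        (hf.comp continuous_conj.continuousOn ?_)))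
      rintro z ⟨hz, hz2⟩
      refine ⟨(hconj z).2 hz, ?_⟩
      have : z.im ≤ 0 := hcl2 hz2
      simpa using this
  · rintro z ⟨hz, hz0⟩
    rcases lt_or_gt_of_ne hz0 with h | h
    · have h1 : DifferentiableAt ℂ f (conj z) := by
        refine (hd (conj z) ⟨(hconj z).2 hz, by simpa using h⟩).differentiableAt ?_
        exact (Metric.isOpen_ball.inter (isOpen_lt continuous_const continuous_im)).mem_nhds
          ⟨(hconj z).2 hz, by simpa using h⟩
      have h2 : DifferentiableAt ℂ (fun z => -conj (f (conj z))) z := by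
        have := h1.conj_conj
        rw [conj_conj] at this
        exact this.neg
      refine (h2.congr_of_eventuallyEq ?_).differentiableWithinAt
      filter_upwards [(isOpen_lt continuous_im continuous_const).mem_nhds h] with y hy
      have hy : y.im < 0 := hy
      simp [hF, not_le.2 hy]
    · have h1 : DifferentiableAt ℂ f z := by
        refine (hd z ⟨hz, h⟩).differentiableAt ?_
        exact (Metric.isOpen_ball.inter (isOpen_lt continuous_const continuous_im)).mem_nhds
          ⟨hz, h⟩
      refine (h1.congr_of_eventuallyEq ?_).differentiableWithinAt
      filter_upwards [(isOpen_lt continuous_const continuous_im).mem_nhds h] with y hy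
      have hy : 0 < y.im := hy
      simp [hF, hy.le]
  · by_cases h : 0 ≤ z.im
    · simpa [hF, h] using him z hz h
    · simpa [hF, h] using him (conj z) ((hconj z).2 hz) (by simpa using (not_le.1 h).le)

/-! ### Holomorphic functions on a half-disc with prescribed real part on the real axis -/

/-- With h holomorphic of boundary real part c, the function V - h is imaginary on the axis; adding
(H + 1)i, where H bounds |h|, restores positivity. Then reflect and apply Schwarz–Pick. What matters
is that h and C depend on c only, so the estimate is uniform over all V. -/
theorem exists_equicontinuity_halfDisc {s r : ℝ} (hr : 0 < r) {c c' c'' : ℝ → ℝ}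
    (h1 : ∀ x ∈ Icc (s - r) (s + r), HasDerivWithinAt c (c' x) (Icc (s - r) (s + r)) x)
    (h2 : ∀ x ∈ Icc (s - r) (s + r), HasDerivWithinAt c' (c'' x) (Icc (s - r) (s + r)) x)
    (h3 : ContinuousOn c'' (Icc (s - r) (s + r))) :
    ∃ (h : ℂ → ℂ) (C : ℝ), Continuous h ∧ 0 ≤ C ∧ ∀ V : ℂ → ℂ,
      ContinuousOn V (Metric.ball (s : ℂ) r ∩ {z | 0 ≤ z.im}) →
      DifferentiableOn ℂ V (Metric.ball (s : ℂ) r ∩ {z | 0 < z.im}) →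
      (∀ z ∈ Metric.ball (s : ℂ) r, 0 ≤ z.im → 0 < (V z).im) →
      (∀ x : ℝ, (x : ℂ) ∈ Metric.ball (s : ℂ) r → (V x).re = c x) →
      ∀ z ∈ Metric.ball (s : ℂ) (r / 4), 0 ≤ z.im → ∀ q ∈ Metric.ball (s : ℂ) (r / 4), 0 ≤ q.im →
        ‖(V z - h z) - (V q - h q)‖ ≤ 8 / r * dist z q * ((V q).im + C) := by
  obtain ⟨h, hc, hd, hre⟩ := exists_holomorphic_re_eq (by linarith) h1 h2 h3
  obtain ⟨H, hH⟩ := (isCompact_closedBall (s : ℂ) r).exists_bound_of_continuousOn hc.continuousOn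
  have hH0 : 0 ≤ H := (norm_nonneg _).trans (hH s (Metric.mem_closedBall_self hr.le))
  refine ⟨h, 2 * H + 1, hc, by linarith, fun V hVc hVd hVim hVre z hz hz0 q hq hq0 => ?_⟩
  have hHim : ∀ z ∈ Metric.ball (s : ℂ) r, |(h z).im| ≤ H := fun z hz =>
    (abs_im_le_norm _).trans (hH z (Metric.ball_subset_closedBall hz))
  obtain ⟨F, hFd, hFe, hFim⟩ := exists_reflection (f := fun z => V z - h z + (H + 1) * I)
    (s := s) (r := r)
    ((hVc.sub hc.continuousOn).add continuousOn_const)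
    ((hVd.sub (hd.mono fun z hz => hz.2)).add_const _)
    (fun x hx => by
      have hx' : x ∈ Icc (s - r) (s + r) := by
        rw [Metric.mem_ball, dist_eq_norm, ← ofReal_sub, norm_real, Real.norm_eq_abs, abs_lt] at hx
        constructor <;> linarith [hx.1, hx.2]
      simp [hVre x hx, hre x hx'])
    (fun z hz hz0 => by
      have := hVim z hz hz0
      have h' := abs_le.1 (hHim z hz)
      simp; linarith [h'.2])
  -- Two points of the quarter disc are less than r/2 apart, which is two thirds of the radius 3r/4
  -- available around q. The constant 8 is 6/(3/4).
  have hsub : Metric.ball q (3 / 4 * r) ⊆ Metric.ball (s : ℂ) r := by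
    refine Metric.ball_subset_ball' ?_
    have := Metric.mem_ball.1 hq
    linarith
  have hdist : dist z q < r / 2 := by
    have := dist_triangle_right z q s
    have h1 := Metric.mem_ball.1 hq
    have h2 := Metric.mem_ball.1 hz
    linarith
  have key := norm_sub_le_schwarzPick_halfPlane (hFd.mono hsub) (fun y hy => hFim y (hsub hy))
    (x := z) (Metric.mem_ball.2 (by linarith)) (by linarith)
  have hq1 : q ∈ Metric.ball (s : ℂ) r := Metric.ball_subset_ball (by linarith) hq
  rw [hFe z hz0, hFe q hq0] at key
  have e : V z - h z + (H + 1) * I - (V q - h q + (H + 1) * I) = V z - h z - (V q - h q) := by ring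
  rw [e] at key
  refine key.trans ?_
  have e2 : 6 * (dist z q / (3 / 4 * r)) = 8 / r * dist z q := by field_simp; ring
  rw [e2]
  refine mul_le_mul_of_nonneg_left ?_ (by positivity)
  have h' := abs_le.1 (hHim q hq1)
  simp; linarith [h'.1]

/-- Harnack: on a ball of half the radius, Im V_k is at most 1 + 6 · 2/3 = 5 times its value at the
centre. Hence the set of points where Im V_k tends to 0 is open and relatively closed in D. -/
theorem tendsto_im_zero_of_isPreconnected {D : Set ℂ} (hD : IsOpen D) (hD' : IsPreconnected D)
    {V : ℕ → ℂ → ℂ} (hd : ∀ k, DifferentiableOn ℂ (V k) D) (him : ∀ k, ∀ z ∈ D, 0 < (V k z).im)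
    {q : ℂ} (hq : q ∈ D) (hlim : Tendsto (fun k => (V k q).im) atTop (𝓝 0)) {x : ℂ} (hx : x ∈ D) :
    Tendsto (fun k => (V k x).im) atTop (𝓝 0) := by
  set Z := {x | Tendsto (fun k => (V k x).im) atTop (𝓝 0)} with hZ
  have loc : ∀ p : ℂ, ∀ r > 0, Metric.ball p r ⊆ D → ∀ y ∈ Metric.ball p (r / 2), p ∈ Z → y ∈ Z := by
    intro p r hr hsub y hy hp
    have hy' := Metric.mem_ball.1 hy
    have hb : ∀ k, (V k y).im ≤ 5 * (V k p).im := fun k => by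
      have hyr : y ∈ Metric.ball p r := Metric.ball_subset_ball (by linarith) hy
      have h := norm_sub_le_schwarzPick_halfPlane ((hd k).mono hsub)
        (fun y hy => him k y (hsub hy)) hyr (by linarith)
      have h0 := him k p (hsub (Metric.mem_ball_self hr))
      have h2 := (le_abs_self _).trans ((abs_im_le_norm _).trans h)
      rw [sub_im] at h2
      have h3 : dist y p / r ≤ 2 / 3 := by rw [div_le_iff₀ hr]; linarith
      nlinarith
    have hyD : y ∈ D := hsub (Metric.ball_subset_ball (by linarith) hy)
    refine squeeze_zero (fun k => (him k y hyD).le) hb ?_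
    simpa using Tendsto.const_mul (5 : ℝ) hp
  have hsub : D ⊆ interior Z := by
    refine hD'.subset_of_closure_inter_subset isOpen_interior ⟨q, hq, ?_⟩ ?_
    · obtain ⟨r, hr, hsub⟩ := Metric.isOpen_iff.1 hD q hq
      exact mem_interior.2 ⟨Metric.ball q (r / 2), fun y hy => loc q r hr hsub y hy hlim,
        Metric.isOpen_ball, Metric.mem_ball_self (by linarith)⟩
    · rintro y ⟨hy, hyD⟩
      obtain ⟨r, hr, hsub⟩ := Metric.isOpen_iff.1 hD y hyD
      obtain ⟨p, hp, hyp⟩ := Metric.mem_closure_iff.1 hy (r / 4) (by linarith)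
      have hpZ : p ∈ Z := interior_subset hp
      have hpy : dist p y < r / 4 := by rwa [dist_comm]
      have hyZ : y ∈ Z := by
        refine loc p (3 / 4 * r) (by linarith) ((Metric.ball_subset_ball' ?_).trans hsub) y ?_ hpZ
        · linarith
        · rw [Metric.mem_ball]; linarith
      exact mem_interior.2 ⟨Metric.ball y (r / 2), fun z hz => loc y r hr hsub z hz hyZ,
        Metric.isOpen_ball, Metric.mem_ball_self (by linarith)⟩
  exact interior_subset (hsub hx)

/-- Bounded values at the points x_k would bound all V_k on the quarter half-disc and make them
equicontinuous. The hypothesis on q_k then forces Im V_k → 0 at q', which is incompatible with the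
lower bound on the axis. The quotient in that hypothesis is (1 - |w|²)/4 when V is the Cayley
transform of w. -/
theorem halfDisc_not_bounded {s r : ℝ} (hr : 0 < r) {c c' c'' : ℝ → ℝ}
    (h1 : ∀ x ∈ Icc (s - r) (s + r), HasDerivWithinAt c (c' x) (Icc (s - r) (s + r)) x)
    (h2 : ∀ x ∈ Icc (s - r) (s + r), HasDerivWithinAt c' (c'' x) (Icc (s - r) (s + r)) x)
    (h3 : ContinuousOn c'' (Icc (s - r) (s + r))) {V : ℕ → ℂ → ℂ}
    (hVc : ∀ k, ContinuousOn (V k) (Metric.ball (s : ℂ) r ∩ {z | 0 ≤ z.im}))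
    (hVd : ∀ k, DifferentiableOn ℂ (V k) (Metric.ball (s : ℂ) r ∩ {z | 0 < z.im}))
    (hVim : ∀ k, ∀ z ∈ Metric.ball (s : ℂ) r, 0 ≤ z.im → 0 < (V k z).im)
    (hVre : ∀ k, ∀ x : ℝ, (x : ℂ) ∈ Metric.ball (s : ℂ) r → (V k x).re = c x)
    (hlow : ∀ x : ℝ, (x : ℂ) ∈ Metric.ball (s : ℂ) r → ∃ m > 0, ∀ k, m ≤ (V k x).im)
    {q : ℕ → ℂ} {q' : ℂ} (hq : ∀ k, q k ∈ Metric.ball (s : ℂ) (r / 4)) (hq0 : ∀ k, 0 ≤ (q k).im)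
    (hq' : q' ∈ Metric.ball (s : ℂ) (r / 4)) (hq0' : 0 ≤ q'.im) (hqq : Tendsto q atTop (𝓝 q'))
    (hlim : Tendsto (fun k => (V k (q k)).im / ‖V k (q k) + I‖ ^ 2) atTop (𝓝 0))
    {x : ℕ → ℂ} {M : ℝ} (hx : ∀ k, x k ∈ Metric.ball (s : ℂ) (r / 4)) (hx0 : ∀ k, 0 ≤ (x k).im)
    (hxM : ∀ k, ‖V k (x k)‖ ≤ M) : False := by
  obtain ⟨h, C, hc, hC, heq⟩ := exists_equicontinuity_halfDisc hr h1 h2 h3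
  obtain ⟨H, hH⟩ := (isCompact_closedBall (s : ℂ) r).exists_bound_of_continuousOn hc.continuousOn
  have hmem : ∀ z ∈ Metric.ball (s : ℂ) (r / 4), z ∈ Metric.ball (s : ℂ) r := fun z hz =>
    Metric.ball_subset_ball (by linarith) hz
  have hH' : ∀ z ∈ Metric.ball (s : ℂ) (r / 4), ‖h z‖ ≤ H := fun z hz =>
    hH z (Metric.ball_subset_closedBall (hmem z hz))
  have hdist : ∀ z ∈ Metric.ball (s : ℂ) (r / 4), ∀ y ∈ Metric.ball (s : ℂ) (r / 4),
      dist z y ≤ r / 2 := by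
    intro z hz y hy
    have := dist_triangle_right z y s
    have h1 := Metric.mem_ball.1 hy
    have h2 := Metric.mem_ball.1 hz
    linarith
  set M' := 2 * H + M + 4 * (M + C) with hM'
  have hM0 : 0 ≤ M := (norm_nonneg _).trans (hxM 0)
  have hbd : ∀ k, ∀ z ∈ Metric.ball (s : ℂ) (r / 4), 0 ≤ z.im → ‖V k z‖ ≤ M' := by
    intro k z hz hz0
    have h' := heq (V k) (hVc k) (hVd k) (hVim k) (hVre k) z hz hz0 (x k) (hx k) (hx0 k)
    have e : V k z = (V k z - h z - (V k (x k) - h (x k))) + h z - h (x k) + V k (x k) := by ring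
    have hb : 8 / r * dist z (x k) * ((V k (x k)).im + C) ≤ 4 * (M + C) := by
      have hi : (V k (x k)).im ≤ M := (le_abs_self _).trans ((abs_im_le_norm _).trans (hxM k))
      have hi0 := hVim k _ (hmem _ (hx k)) (hx0 k)
      have : 8 / r * dist z (x k) ≤ 4 := by
        calc _ ≤ 8 / r * (r / 2) := by gcongr; exact hdist z hz _ (hx k)
          _ = 4 := by field_simp; norm_num
      gcongr
    rw [e]
    refine (norm_add_le _ _).trans ?_
    refine (add_le_add ((norm_sub_le _ _).trans (add_le_add (norm_add_le _ _) le_rfl))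
      le_rfl).trans ?_
    linarith [hH' z hz, hH' (x k) (hx k), hxM k]
  have hM'0 : 0 ≤ M' := (norm_nonneg _).trans (hbd 0 _ (hx 0) (hx0 0))
  set L := 8 / r * (M' + C) with hL
  have hlip : ∀ k, ∀ z ∈ Metric.ball (s : ℂ) (r / 4), 0 ≤ z.im →
      ∀ y ∈ Metric.ball (s : ℂ) (r / 4), 0 ≤ y.im →
      (V k z).im ≤ (V k y).im + (‖h z - h y‖ + L * dist z y) := by
    intro k z hz hz0 y hy hy0
    have h' := heq (V k) (hVc k) (hVd k) (hVim k) (hVre k) z hz hz0 y hy hy0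
    have hi : (V k y).im ≤ M' := (le_abs_self _).trans ((abs_im_le_norm _).trans (hbd k y hy hy0))
    have hb : 8 / r * dist z y * ((V k y).im + C) ≤ L * dist z y := by
      calc _ ≤ 8 / r * dist z y * (M' + C) := by gcongr
        _ = _ := by rw [hL]; ring
    have e : (V k z - h z - (V k y - h y)) = (V k z - V k y) - (h z - h y) := by ring
    have e2 := norm_sub_norm_le (V k z - V k y) (h z - h y)
    rw [← e] at e2
    have e3 := (le_abs_self _).trans (abs_im_le_norm (V k z - V k y))
    rw [sub_im] at e3
    linarith
  -- The denominators are at most (M' + 1)², so the numerators themselves tend to 0.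
  have hqk : Tendsto (fun k => (V k (q k)).im) atTop (𝓝 0) := by
    have hb : ∀ k, (V k (q k)).im ≤ (V k (q k)).im / ‖V k (q k) + I‖ ^ 2 * (M' + 1) ^ 2 := by
      intro k
      have hi0 := hVim k _ (hmem _ (hq k)) (hq0 k)
      have hn : 0 < ‖V k (q k) + I‖ := by
        have := (le_abs_self _).trans (abs_im_le_norm (V k (q k) + I))
        rw [add_im, I_im] at this; linarith
      have hn2 : ‖V k (q k) + I‖ ≤ M' + 1 := by
        refine (norm_add_le _ _).trans ?_
        rw [norm_I]; linarith [hbd k _ (hq k) (hq0 k)]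
      rw [div_mul_eq_mul_div, le_div_iff₀ (by positivity)]
      gcongr
    refine squeeze_zero (fun k => (hVim k _ (hmem _ (hq k)) (hq0 k)).le) hb ?_
    simpa using hlim.mul_const ((M' + 1) ^ 2)
  have hq'lim : Tendsto (fun k => (V k q').im) atTop (𝓝 0) := by
    refine squeeze_zero (fun k => (hVim k _ (hmem _ hq') hq0').le)
      (fun k => hlip k q' hq' hq0' (q k) (hq k) (hq0 k)) ?_
    have t1 : Tendsto (fun k => ‖h q' - h (q k)‖ + L * dist q' (q k)) atTop (𝓝 0) := by
      have hcont : Continuous fun y => ‖h q' - h y‖ + L * dist q' y := by fun_prop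
      simpa [Function.comp_def] using (hcont.tendsto q').comp hqq
    simpa using hqk.add t1
  -- If q' is real, the lower bound at q' is contradicted at once. Otherwise Im V_k → 0 on the whole
  -- open half-disc, and the centre s is reached from above by equicontinuity.
  rcases hq0'.eq_or_lt with h0 | h0
  · have hr' : q' = (q'.re : ℂ) := Complex.ext rfl (by simp [← h0])
    obtain ⟨m, hm, hmk⟩ := hlow q'.re (hr' ▸ hmem _ hq')
    rw [hr'] at hq'lim
    exact absurd (ge_of_tendsto' hq'lim hmk) (not_le.2 hm)
  · have hDo : IsOpen (Metric.ball (s : ℂ) (r / 4) ∩ {z | 0 < z.im}) :=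
      Metric.isOpen_ball.inter (isOpen_lt continuous_const continuous_im)
    have hDc : IsPreconnected (Metric.ball (s : ℂ) (r / 4) ∩ {z | 0 < z.im}) :=
      ((convex_ball _ _).inter (convex_halfSpace_im_gt 0)).isPreconnected
    have hall := fun y hy => tendsto_im_zero_of_isPreconnected hDo hDc
      (fun k => (hVd k).mono (inter_subset_inter_left _ hmem))
      (fun k z hz => hVim k z (hmem z hz.1) (le_of_lt hz.2)) ⟨hq', h0⟩ hq'lim (x := y) hy
    have hs : (s : ℂ) ∈ Metric.ball (s : ℂ) (r / 4) := Metric.mem_ball_self (by linarith)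
    obtain ⟨m, hm, hmk⟩ := hlow s (hmem _ hs)
    have hcont : Continuous fun t : ℝ => ‖h s - h (s + t * I)‖ + L * dist (s : ℂ) (s + t * I) := by
      fun_prop
    -- Choose t so small that the oscillation between s and s + it, bounded uniformly in k, is below
    -- the lower bound m at s.
    have ht : ∀ᶠ t : ℝ in 𝓝[>] 0, ‖h s - h (s + t * I)‖ + L * dist (s : ℂ) (s + t * I) < m := by
      refine nhdsWithin_le_nhds ((hcont.tendsto 0).eventually_lt_const ?_)
      simpa using hm
    have ht2 : ∀ᶠ t : ℝ in 𝓝[>] 0, t < r / 4 :=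
      nhdsWithin_le_nhds (eventually_lt_nhds (by linarith))
    obtain ⟨t, ⟨ht1, ht2⟩, ht0⟩ := ((ht.and ht2).and self_mem_nhdsWithin).exists
    have ht0 : 0 < t := ht0
    have hty : (s + t * I : ℂ) ∈ Metric.ball (s : ℂ) (r / 4) := by
      rw [Metric.mem_ball, dist_eq_norm]
      simpa [abs_of_pos ht0] using ht2
    have htend := (hall (s + t * I) ⟨hty, by simpa using ht0⟩).add_const
      (‖h s - h (s + t * I)‖ + L * dist (s : ℂ) (s + t * I))
    rw [zero_add] at htend
    refine absurd (ge_of_tendsto' htend fun k => (hmk k).trans ?_) (not_le.2 ht1)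
    exact hlip k s hs (by simp) _ hty (by simpa using ht0.le)

/-- If this fails, `halfDisc_not_bounded` applies to a subsequence along which q_k also converges.
The limit lies in the closed disc of radius r/8, hence in the open one of radius r/4; this is why
the radius shrinks again. -/
theorem halfDisc_eventually_large {s r : ℝ} (hr : 0 < r) {c c' c'' : ℝ → ℝ}
    (h1 : ∀ x ∈ Icc (s - r) (s + r), HasDerivWithinAt c (c' x) (Icc (s - r) (s + r)) x)
    (h2 : ∀ x ∈ Icc (s - r) (s + r), HasDerivWithinAt c' (c'' x) (Icc (s - r) (s + r)) x)
    (h3 : ContinuousOn c'' (Icc (s - r) (s + r))) {V : ℕ → ℂ → ℂ}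
    (hVc : ∀ k, ContinuousOn (V k) (Metric.ball (s : ℂ) r ∩ {z | 0 ≤ z.im}))
    (hVd : ∀ k, DifferentiableOn ℂ (V k) (Metric.ball (s : ℂ) r ∩ {z | 0 < z.im}))
    (hVim : ∀ k, ∀ z ∈ Metric.ball (s : ℂ) r, 0 ≤ z.im → 0 < (V k z).im)
    (hVre : ∀ k, ∀ x : ℝ, (x : ℂ) ∈ Metric.ball (s : ℂ) r → (V k x).re = c x)
    (hlow : ∀ x : ℝ, (x : ℂ) ∈ Metric.ball (s : ℂ) r → ∃ m > 0, ∀ k, m ≤ (V k x).im)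
    {q : ℕ → ℂ} (hq : ∀ k, q k ∈ Metric.ball (s : ℂ) (r / 8)) (hq0 : ∀ k, 0 ≤ (q k).im)
    (hlim : Tendsto (fun k => (V k (q k)).im / ‖V k (q k) + I‖ ^ 2) atTop (𝓝 0)) (M : ℝ) :
    ∀ᶠ k in atTop, ∀ x ∈ Metric.ball (s : ℂ) (r / 8), 0 ≤ x.im → M ≤ ‖V k x‖ := by
  by_contra hcon
  rw [not_eventually] at hcon
  obtain ⟨φ, hφ, hφx⟩ := extraction_of_frequently_atTop hcon
  push Not at hφx
  choose x hx hx0 hxM using hφx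
  have hK : IsCompact (Metric.closedBall (s : ℂ) (r / 8) ∩ {z | 0 ≤ z.im}) :=
    (isCompact_closedBall _ _).inter_right (isClosed_le continuous_const continuous_im)
  obtain ⟨q', ⟨hq', hq0'⟩, ψ, hψ, hqq⟩ := hK.tendsto_subseq (x := q ∘ φ)
    (fun k => ⟨Metric.ball_subset_closedBall (hq _), hq0 _⟩)
  have hsub : Metric.ball (s : ℂ) (r / 8) ⊆ Metric.ball (s : ℂ) (r / 4) :=
    Metric.ball_subset_ball (by linarith)
  exact halfDisc_not_bounded hr h1 h2 h3 (V := fun k => V (φ (ψ k))) (fun k => hVc _)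
    (fun k => hVd _) (fun k => hVim _) (fun k => hVre _)
    (fun x hx => (hlow x hx).imp fun m hm => ⟨hm.1, fun k => hm.2 _⟩)
    (q := fun k => q (φ (ψ k))) (fun k => hsub (hq _)) (fun k => hq0 _)
    (Metric.closedBall_subset_ball (by linarith) hq') hq0' hqq
    (hlim.comp (hφ.comp hψ).tendsto_atTop) (x := fun k => x (ψ k)) (M := M)
    (fun k => hsub (hx _)) (fun k => hx0 _) (fun k => (hxM _).le)

/-! ### Flat sections -/

section FlatSections

variable {E : Type*} [NormedAddCommGroup E] [NormedSpace ℝ E]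

theorem HasDerivWithinAt.Ici_of_unitInterval {f : ℝ → E} {f' : E} {t : ℝ}
    (h : HasDerivWithinAt f f' (Icc 0 1) t) (ht : t ∈ Ico (0 : ℝ) 1) :
    HasDerivWithinAt f f' (Ici t) t := by
  refine h.mono_of_mem_nhdsWithin ?_
  filter_upwards [Icc_mem_nhdsGE ht.2] with x hx
  exact ⟨ht.1.trans hx.1, hx.2⟩

/-- In the ball of radius ‖e‖ about e the speed is at most (1/2) · 2‖e‖, so the solution cannot
leave it before time 1 and Picard–Lindelöf covers the whole interval. The exponential bound is
Grönwall's. -/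
theorem exists_linear_ode_solution [CompleteSpace E] {T : ℝ → E →L[ℝ] E}
    (hT : ContinuousOn T (Icc 0 1))
    (hb : ∀ t ∈ Icc (0 : ℝ) 1, ‖T t‖ ≤ 1 / 2) (e : E) :
    ∃ α : ℝ → E, α 0 = e ∧
      (∀ t ∈ Icc (0 : ℝ) 1, HasDerivWithinAt α (T t (α t)) (Icc 0 1) t) ∧
      ∀ t ∈ Icc (0 : ℝ) 1, ‖α t‖ ≤ ‖e‖ * Real.exp 1 := by
  have hP : IsPicardLindelof (fun t y => T t y) (⟨0, by simp⟩ : Icc (0 : ℝ) 1) e ‖e‖₊ 0 ‖e‖₊ 1 := by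
    refine ⟨fun t ht => ?_, fun x _ => hT.clm_apply continuousOn_const, fun t ht x hx => ?_, ?_⟩
    · refine ((T t).lipschitz.weaken ?_).lipschitzOnWith
      have := hb t ht
      rw [← NNReal.coe_le_coe, coe_nnnorm, NNReal.coe_one]; linarith
    · have h1 : ‖x‖ ≤ 2 * ‖e‖ := by
        have h := norm_le_norm_add_norm_sub' x e
        have h' : ‖x - e‖ ≤ ‖e‖ := by simpa [dist_eq_norm] using hx
        linarith
      calc ‖T t x‖ ≤ ‖T t‖ * ‖x‖ := (T t).le_opNorm x
        _ ≤ 1 / 2 * (2 * ‖e‖) := by gcongr; exact hb t ht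
        _ = _ := by simp
    · simp
  obtain ⟨α, h0, hα⟩ := hP.exists_eq_forall_mem_Icc_hasDerivWithinAt₀
  refine ⟨α, h0, hα, fun t ht => ?_⟩
  have h := norm_le_gronwallBound_of_norm_deriv_right_le (f := α) (δ := ‖e‖) (K := 1) (ε := 0)
    (a := 0) (b := 1) (fun t ht => (hα t ht).continuousWithinAt)
    (fun t ht => (hα t (Ico_subset_Icc_self ht)).Ici_of_unitInterval ht)
    (by rw [show α 0 = e from h0]) (fun t ht => by
      refine ((T t).le_opNorm _).trans ?_
      rw [add_zero]
      gcongr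
      linarith [hb t (Ico_subset_Icc_self ht)]) t ht
  refine h.trans ?_
  rw [gronwallBound_ε0]
  gcongr
  linarith [ht.2]

/-- The infinitesimal core of integrability. Here x and y are vectors transported to time t along
the segments with directions d and d + h. Flatness exchanges the roles of d and h in the derivative
of t · b(h)x; after that the defect y - x - t · b(h)x satisfies a linear equation up to terms
quadratic in h. -/
theorem norm_transport_defect_le {V : Type*} [NormedAddCommGroup V] [NormedSpace ℝ V]
    {R M K K₂ N t : ℝ} (hM0 : 0 ≤ M) (hK0 : 0 ≤ K) (hK₂0 : 0 ≤ K₂) (ht0 : 0 ≤ t) (ht1 : t ≤ 1)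
    {b b' : V →L[ℝ] E →L[ℝ] E} {D : V →L[ℝ] V →L[ℝ] E →L[ℝ] E} {d h : V} {y x : E}
    (hd : ‖d‖ ≤ R) (hb : ‖b‖ ≤ M) (hb' : ‖b'‖ ≤ M) (hK : ‖b' - b‖ ≤ K * ‖h‖)
    (hK₂ : ‖b' - b - t • D h‖ ≤ K₂ * ‖h‖ ^ 2) (hsmall : ‖b' (d + h)‖ ≤ 1) (hx : ‖x‖ ≤ N)
    (hfl : D d h + (b h).comp (b d) = D h d + (b d).comp (b h)) :
    ‖b' (d + h) y - b d x - (t • (D d h x + b h (b d x)) + b h x)‖ ≤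
      1 * ‖y - x - t • b h x‖ + (K₂ * R + K + (K * R + M) * M) * N * ‖h‖ ^ 2 := by
  have hR0 : 0 ≤ R := (norm_nonneg _).trans hd
  have hN0 : 0 ≤ N := (norm_nonneg _).trans hx
  have hfl' : D d h x + b h (b d x) = D h d x + b d (b h x) :=
    congrArg (fun L : E →L[ℝ] E => L x) hfl
  set S : E →L[ℝ] E := (b' - b - t • D h) d + (b' - b) h with hS
  have e1 : b' (d + h) y - b d x - (t • (D d h x + b h (b d x)) + b h x) =
      b' (d + h) (y - x - t • b h x) + S x + t • (((b' - b) d + b' h) (b h x)) := by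
    rw [hfl', hS]
    simp only [map_sub, map_add, map_smul, add_apply, sub_apply, smul_apply]
    module
  have b1 : ‖b' (d + h) (y - x - t • b h x)‖ ≤ 1 * ‖y - x - t • b h x‖ := by
    refine ((b' (d + h)).le_opNorm _).trans ?_
    gcongr
  have b2 : ‖S‖ ≤ (K₂ * R + K) * ‖h‖ ^ 2 := by
    have s1 : ‖(b' - b - t • D h) d‖ ≤ K₂ * ‖h‖ ^ 2 * R := by
      refine (ContinuousLinearMap.le_opNorm _ _).trans ?_
      gcongr
    have s2 : ‖(b' - b) h‖ ≤ K * ‖h‖ * ‖h‖ := by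
      refine (ContinuousLinearMap.le_opNorm _ _).trans ?_
      gcongr
    calc ‖S‖ ≤ K₂ * ‖h‖ ^ 2 * R + K * ‖h‖ * ‖h‖ := (norm_add_le _ _).trans (add_le_add s1 s2)
      _ = _ := by ring
  have b31 : ‖(b' - b) d + b' h‖ ≤ K * ‖h‖ * R + M * ‖h‖ := by
    refine (norm_add_le _ _).trans (add_le_add ?_ ?_)
    · refine (ContinuousLinearMap.le_opNorm _ _).trans ?_
      gcongr
    · refine (ContinuousLinearMap.le_opNorm _ _).trans ?_
      gcongr
  have b32 : ‖b h x‖ ≤ M * ‖h‖ * N := by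
    refine (ContinuousLinearMap.le_opNorm _ _).trans ?_
    gcongr
    exact (ContinuousLinearMap.le_opNorm _ _).trans (by gcongr)
  have b3 : ‖((b' - b) d + b' h) (b h x)‖ ≤ (K * ‖h‖ * R + M * ‖h‖) * (M * ‖h‖ * N) := by
    refine (ContinuousLinearMap.le_opNorm _ _).trans ?_
    gcongr
  have b4 : ‖t • (((b' - b) d + b' h) (b h x))‖ ≤
      (K * ‖h‖ * R + M * ‖h‖) * (M * ‖h‖ * N) := by
    rw [norm_smul, Real.norm_of_nonneg ht0]
    exact (mul_le_of_le_one_left (norm_nonneg _) ht1).trans b3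
  have b5 : ‖S x‖ ≤ (K₂ * R + K) * ‖h‖ ^ 2 * N := by
    refine (ContinuousLinearMap.le_opNorm _ _).trans ?_
    gcongr
  rw [e1]
  refine (norm_add₃_le).trans ?_
  calc _ ≤ 1 * ‖y - x - t • b h x‖ + (K₂ * R + K) * ‖h‖ ^ 2 * N +
      (K * ‖h‖ * R + M * ‖h‖) * (M * ‖h‖ * N) := add_le_add (add_le_add b1 b5) b4
    _ = _ := by ring

/-- Transport e along the segment from p to x and let G(x) be the value at time 1. Flatness makes G
parallel in every direction, not only the radial one. The Taylor bounds with Grönwall's inequality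
replace smooth dependence of the ODE on parameters, so the argument works up to the boundary of Q.
-/
theorem exists_flat_section [CompleteSpace E] {V : Type*} [NormedAddCommGroup V] [NormedSpace ℝ V]
    {Q : Set V} (hQ : Convex ℝ Q) {p : V} (hp : p ∈ Q) {R M K K₂ : ℝ}
    (hM0 : 0 ≤ M) (hK0 : 0 ≤ K) (hK₂0 : 0 ≤ K₂)
    (hR : ∀ x ∈ Q, ‖x - p‖ ≤ R) {B : V → V →L[ℝ] E →L[ℝ] E} {B' : V → V →L[ℝ] V →L[ℝ] E →L[ℝ] E}
    (hB : ∀ x ∈ Q, HasFDerivWithinAt B (B' x) Q x) (hM : ∀ x ∈ Q, ‖B x‖ ≤ M)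
    (hK : ∀ x ∈ Q, ∀ y ∈ Q, ‖B y - B x‖ ≤ K * ‖y - x‖)
    (hK₂ : ∀ x ∈ Q, ∀ y ∈ Q, ‖B y - B x - B' x (y - x)‖ ≤ K₂ * ‖y - x‖ ^ 2)
    (hsmall : M * R ≤ 1 / 2)
    (hflat : ∀ x ∈ Q, ∀ d h : V, B' x d h + (B x h).comp (B x d) = B' x h d + (B x d).comp (B x h))
    (e : E) :
    ∃ G : V → E, G p = e ∧ ∀ x ∈ Q,
      HasFDerivWithinAt G ((ContinuousLinearMap.apply ℝ E (G x)).comp (B x)) Q x := by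
  have hR0 : 0 ≤ R := (norm_nonneg _).trans (hR p hp)
  have hmem : ∀ x ∈ Q, ∀ t ∈ Icc (0 : ℝ) 1, p + t • (x - p) ∈ Q := fun x hx t ht =>
    hQ.add_smul_sub_mem hp hx ht
  have hγ : ∀ x : V, ∀ t : ℝ, HasDerivWithinAt (fun t : ℝ => p + t • (x - p)) (x - p) (Icc 0 1) t := by
    intro x t
    have := ((hasDerivWithinAt_id t (Icc 0 1)).smul_const (x - p)).const_add p
    simpa using this
  have hBγ : ∀ x ∈ Q, ∀ t ∈ Icc (0 : ℝ) 1, HasDerivWithinAt (fun t : ℝ => B (p + t • (x - p)))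
      (B' (p + t • (x - p)) (x - p)) (Icc 0 1) t := fun x hx t ht =>
    HasFDerivWithinAt.comp_hasDerivWithinAt (E := V →L[ℝ] E →L[ℝ] E) (F := V) (l := B)
      (f := fun t : ℝ => p + t • (x - p)) t
      (hB _ (hmem x hx t ht)) (hγ x t) (fun s hs => hmem x hx s hs)
  have hT : ∀ x ∈ Q, ∀ t ∈ Icc (0 : ℝ) 1, ‖B (p + t • (x - p)) (x - p)‖ ≤ 1 / 2 := by
    intro x hx t ht
    refine ((B _).le_opNorm _).trans (le_trans ?_ hsmall)
    gcongr
    exacts [hM _ (hmem x hx t ht), hR x hx]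
  have hex : ∀ x, ∃ α : ℝ → E, x ∈ Q → α 0 = e ∧
      (∀ t ∈ Icc (0 : ℝ) 1, HasDerivWithinAt α (B (p + t • (x - p)) (x - p) (α t)) (Icc 0 1) t) ∧
      ∀ t ∈ Icc (0 : ℝ) 1, ‖α t‖ ≤ ‖e‖ * Real.exp 1 := by
    intro x
    by_cases hx : x ∈ Q
    · obtain ⟨α, h⟩ := exists_linear_ode_solution (T := fun t => B (p + t • (x - p)) (x - p))
        (fun t ht => (HasDerivWithinAt.continuousWithinAt (F := V →L[ℝ] E →L[ℝ] E)
          (hBγ x hx t ht)).clm_apply continuousWithinAt_const)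
        (hT x hx) e
      exact ⟨α, fun _ => h⟩
    · exact ⟨0, fun h => absurd h hx⟩
  choose Φ hΦ using hex
  refine ⟨fun x => Φ x 1, ?_, fun x hx => ?_⟩
  · obtain ⟨h0, h1, -⟩ := hΦ p hp
    have hd : ∀ t ∈ Ico (0 : ℝ) 1, HasDerivWithinAt (Φ p) 0 (Ici t) t := fun t ht => by
      have := (h1 t (Ico_subset_Icc_self ht)).Ici_of_unitInterval ht
      simpa using this
    rw [← h0]
    exact constant_of_has_deriv_right_zero (fun t ht => (h1 t ht).continuousWithinAt) hd 1 (by simp)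
  obtain ⟨x0, x1, x2⟩ := hΦ x hx
  set N := ‖e‖ * Real.exp 1 with hN
  have hN0 : 0 ≤ N := by positivity
  set C := (K₂ * R + K + (K * R + M) * M) * N with hC
  have main : ∀ y ∈ Q, ‖Φ y 1 - Φ x 1 - B x (y - x) (Φ x 1)‖ ≤
      gronwallBound 0 1 1 1 * C * ‖y - x‖ ^ 2 := by
    intro y hy
    obtain ⟨y0, y1, y2⟩ := hΦ y hy
    set h := y - x with hh
    have hyp : y - p = (x - p) + h := by rw [hh]; abel
    -- The term t · B(·)h applied to Φ x t is the expected variation of the transported vector when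
    -- the endpoint moves by h; at t = 1 it is the desired derivative of G.
    set ψ : ℝ → E := fun t => Φ y t - Φ x t - t • B (p + t • (x - p)) h (Φ x t) with hψ
    set ψ' : ℝ → E := fun t => B (p + t • (y - p)) (y - p) (Φ y t) -
      B (p + t • (x - p)) (x - p) (Φ x t) -
      (t • (B' (p + t • (x - p)) (x - p) h (Φ x t) +
        B (p + t • (x - p)) h (B (p + t • (x - p)) (x - p) (Φ x t))) +
        B (p + t • (x - p)) h (Φ x t)) with hψ'
    have hd : ∀ t ∈ Icc (0 : ℝ) 1, HasDerivWithinAt ψ (ψ' t) (Icc 0 1) t := by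
      intro t ht
      have a1 := ((hBγ x hx t ht).clm_apply (hasDerivWithinAt_const t _ h)).clm_apply (x1 t ht)
      have a2 := ((y1 t ht).sub (x1 t ht)).sub ((hasDerivWithinAt_id t _).smul a1)
      refine a2.congr_deriv ?_
      simp [hψ']
    have hbound : ∀ t ∈ Icc (0 : ℝ) 1, ‖ψ' t‖ ≤ 1 * ‖ψ t‖ + C * ‖h‖ ^ 2 := by
      intro t ht
      have hg : p + t • (x - p) ∈ Q := hmem x hx t ht
      have hg' : p + t • (y - p) ∈ Q := hmem y hy t ht
      have hgg : p + t • (y - p) - (p + t • (x - p)) = t • h := by rw [hyp]; module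
      have hgn : ‖p + t • (y - p) - (p + t • (x - p))‖ ≤ ‖h‖ := by
        rw [hgg, norm_smul, Real.norm_of_nonneg ht.1]
        exact mul_le_of_le_one_left (norm_nonneg _) ht.2
      have h1 := hT y hy t ht
      have h2 := (hK₂ _ hg _ hg').trans (mul_le_mul_of_nonneg_left
        (pow_le_pow_left₀ (norm_nonneg _) hgn 2) hK₂0)
      rw [hgg, map_smul] at h2
      simp only [hψ, hψ']
      rw [hyp] at h1 hg' ⊢
      refine norm_transport_defect_le hM0 hK0 hK₂0 ht.1 ht.2 (hR x hx) (hM _ hg) (hM _ hg') ?_ ?_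
        (h1.trans (by norm_num)) (x2 t ht) (hflat _ hg _ _)
      · rw [← hyp]
        exact (hK _ hg _ (hmem y hy t ht)).trans (mul_le_mul_of_nonneg_left hgn hK0)
      · rw [← hyp]; exact h2
    have hfin := norm_le_gronwallBound_of_norm_deriv_right_le (f := ψ) (δ := 0) (K := 1)
      (ε := C * ‖h‖ ^ 2) (a := 0) (b := 1) (fun t ht => (hd t ht).continuousWithinAt)
      (fun t ht => (hd t (Ico_subset_Icc_self ht)).Ici_of_unitInterval ht)
      (by simp [hψ, x0, y0]) (fun t ht => hbound t (Ico_subset_Icc_self ht)) 1 (by simp)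
    have e1 : ψ 1 = Φ y 1 - Φ x 1 - B x (y - x) (Φ x 1) := by simp [hψ, hh]
    rw [e1] at hfin
    refine hfin.trans (le_of_eq ?_)
    simp [gronwallBound]; ring
  -- A quadratic error bound is stronger than differentiability requires.
  rw [hasFDerivWithinAt_iff_isLittleO]
  refine Asymptotics.IsBigO.trans_isLittleO (g := fun y => ‖y - x‖ ^ 2) ?_
    ((Asymptotics.isLittleO_pow_sub_sub x one_lt_two).mono nhdsWithin_le_nhds)
  refine Asymptotics.IsBigO.of_bound (gronwallBound 0 1 1 1 * C) ?_
  filter_upwards [self_mem_nhdsWithin] with y hy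
  rw [Real.norm_of_nonneg (by positivity)]
  exact main y hy

end FlatSections

/-! ### The gauge transformation trivializing a flat `su(1,1)`-connection -/

section

variable {E F : Type*} [NormedAddCommGroup E] [NormedSpace ℝ E] [NormedAddCommGroup F]
  [NormedSpace ℝ F]

/-- Compactness bounds the first two derivatives; convexity allows the mean value inequality along
segments. -/
theorem exists_taylor_bounds {f : F → E} {Q : Set F} (hf : ContDiffOn ℝ 2 f Q) (hQ : Convex ℝ Q)
    (hQc : IsCompact Q) (hQu : UniqueDiffOn ℝ Q) :
    ∃ K K₂ : ℝ, 0 ≤ K ∧ 0 ≤ K₂ ∧ (∀ x ∈ Q, ∀ y ∈ Q, ‖f y - f x‖ ≤ K * ‖y - x‖) ∧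
      ∀ x ∈ Q, ∀ y ∈ Q, ‖f y - f x - fderivWithin ℝ f Q x (y - x)‖ ≤ K₂ * ‖y - x‖ ^ 2 := by
  have hd : ∀ x ∈ Q, HasFDerivWithinAt f (fderivWithin ℝ f Q x) Q x := fun x hx =>
    (hf.differentiableOn (by norm_num) x hx).hasFDerivWithinAt
  have h1 : ContDiffOn ℝ 1 (fderivWithin ℝ f Q) Q := hf.fderivWithin hQu (by norm_num)
  obtain ⟨K, hK⟩ := hQc.exists_bound_of_continuousOn h1.continuousOn
  have h2 : ContinuousOn (fderivWithin ℝ (fderivWithin ℝ f Q) Q) Q :=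
    h1.continuousOn_fderivWithin hQu le_rfl
  obtain ⟨K₂, hK₂⟩ := hQc.exists_bound_of_continuousOn (E := F →L[ℝ] F →L[ℝ] E) h2
  have hL : ∀ x ∈ Q, ∀ y ∈ Q, ‖fderivWithin ℝ f Q y - fderivWithin ℝ f Q x‖ ≤
      |K₂| * ‖y - x‖ := fun x hx y hy =>
    hQ.norm_image_sub_le_of_norm_hasFDerivWithin_le
      (fun z hz => (h1.differentiableOn (by norm_num) z hz).hasFDerivWithinAt)
      (fun z hz => (hK₂ z hz).trans (le_abs_self _)) hx hy
  refine ⟨|K|, |K₂|, abs_nonneg _, abs_nonneg _, fun x hx y hy =>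
    hQ.norm_image_sub_le_of_norm_hasFDerivWithin_le hd
      (fun z hz => (hK z hz).trans (le_abs_self _)) hx hy, fun x hx y hy => ?_⟩
  have hseg : segment ℝ x y ⊆ Q := hQ.segment_subset hx hy
  have h := (convex_segment x y).norm_image_sub_le_of_norm_hasFDerivWithin_le
    (f := fun z => f z - fderivWithin ℝ f Q x z)
    (f' := fun z => fderivWithin ℝ f Q z - fderivWithin ℝ f Q x) (C := |K₂| * ‖y - x‖)
    (fun z hz => ((hd z (hseg hz)).mono hseg).sub (ContinuousLinearMap.hasFDerivWithinAt _))
    (fun z hz => (hL x hx z (hseg hz)).trans (by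
      gcongr
      obtain ⟨t, ht, rfl⟩ := (segment_eq_image' ℝ x y ▸ hz)
      simp only [add_sub_cancel_left, norm_smul, Real.norm_of_nonneg ht.1]
      exact mul_le_of_le_one_left (norm_nonneg _) ht.2))
    (left_mem_segment ℝ x y) (right_mem_segment ℝ x y)
  calc ‖f y - f x - fderivWithin ℝ f Q x (y - x)‖ = _ := by rw [map_sub]; congr 1; abel
    _ ≤ _ := h
    _ = _ := by ring

/-- Bootstrapping: the equation expresses dG through G and B, so each order of smoothness of G
yields the next. -/
theorem contDiffOn_flat_section {Q : Set F} (hQu : UniqueDiffOn ℝ Q)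
    {B : F → F →L[ℝ] E →L[ℝ] E} (hB : ContDiffOn ℝ ∞ B Q) {G : F → E}
    (hG : ∀ x ∈ Q, HasFDerivWithinAt G ((ContinuousLinearMap.apply ℝ E (G x)).comp (B x)) Q x) :
    ContDiffOn ℝ ∞ G Q := by
  rw [contDiffOn_infty]
  intro n
  induction n with
  | zero => exact contDiffOn_zero.2 fun x hx => (hG x hx).continuousWithinAt
  | succ n ih =>
    push_cast
    rw [contDiffOn_succ_iff_fderivWithin hQu]
    refine ⟨fun x hx => (hG x hx).differentiableWithinAt, by simp, ?_⟩
    have h : ContDiffOn ℝ n (fun x => (ContinuousLinearMap.apply ℝ E (G x)).comp (B x)) Q :=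
      ContDiffOn.clm_comp ((ContinuousLinearMap.contDiff _).comp_contDiffOn ih)
        (hB.of_le (by exact_mod_cast le_top))
    exact h.congr fun x hx => (hG x hx).fderivWithin (hQu x hx)

end

/-- The action of `su(1,1)` on the pairs `(a, b)` parametrizing the matrices
`(a, b; conj b, conj a)`, by left multiplication. -/
def su11.rep : su11 →L[ℝ] ℂ × ℂ →L[ℝ] ℂ × ℂ :=
  LinearMap.toContinuousLinearMap
    ((LinearMap.toContinuousLinearMap (𝕜 := ℝ) (E := ℂ × ℂ) (F' := ℂ × ℂ)).toLinearMap ∘ₗ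
      LinearMap.mk₂ ℝ (fun (γ : su11) (v : ℂ × ℂ) =>
        ((I * γ.1 * v.1 + γ.2 * conj v.2, I * γ.1 * v.2 + γ.2 * conj v.1) : ℂ × ℂ))
        (fun γ η v => by ext <;> simp <;> ring) (fun c γ v => by ext <;> simp <;> ring)
        (fun γ v w => by ext <;> simp <;> ring) (fun c γ v => by ext <;> simp <;> ring))

theorem su11.rep_apply (γ : su11) (v : ℂ × ℂ) :
    su11.rep γ v = (I * γ.1 * v.1 + γ.2 * conj v.2, I * γ.1 * v.2 + γ.2 * conj v.1) := rfl

theorem su11.rep_bracket (γ η : su11) :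
    su11.rep (su11.bracket γ η) =
      (su11.rep γ).comp (su11.rep η) - (su11.rep η).comp (su11.rep γ) := by
  ext v <;> apply Complex.ext <;> simp [su11.rep_apply, su11.bracket] <;> ring

theorem convex_closedBall_inter_halfPlane (p : ℂ) (r : ℝ) :
    Convex ℝ (Metric.closedBall p r ∩ {z | 0 ≤ z.im}) :=
  (convex_closedBall p r).inter (convex_halfSpace_im_ge 0)

theorem uniqueDiffOn_closedBall_inter_halfPlane {p : ℂ} (hp : 0 ≤ p.im) {r : ℝ} (hr : 0 < r) :
    UniqueDiffOn ℝ (Metric.closedBall p r ∩ {z | 0 ≤ z.im}) := by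
  refine uniqueDiffOn_convex (convex_closedBall_inter_halfPlane p r) ⟨p + (r / 2 : ℝ) * I, ?_⟩
  refine mem_interior.2 ⟨Metric.ball p r ∩ {z | 0 < z.im}, fun z hz =>
    ⟨Metric.ball_subset_closedBall hz.1, le_of_lt (show 0 < z.im from hz.2)⟩,
    Metric.isOpen_ball.inter (isOpen_lt continuous_const continuous_im), ?_, ?_⟩
  · rw [Metric.mem_ball, dist_eq_norm, add_sub_cancel_left, norm_mul, norm_I, norm_real, mul_one,
      Real.norm_of_nonneg (by positivity)]
    linarith
  · simp; linarith

/-- Solve dG = AG for pairs (a, b) with G(p) = (1, 0), the identity matrix. The form |a|² - |b|² is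
infinitesimally invariant under su(1,1), so it stays equal to 1 and the solution lies in SU(1,1). -/
theorem exists_gauge {A : ℂ → ℂ →L[ℝ] su11} {T : Set ℂ} (hA : ContDiffOn ℝ ∞ A T)
    (hT : ∀ x ∈ T, T ∈ 𝓝[{z | 0 ≤ z.im}] x) {p : ℂ} (hpT : p ∈ T) (hp : 0 ≤ p.im)
    (hflat : ∀ x ∈ T, fderivWithin ℝ (fun y => A y 1) {z | 0 ≤ z.im} x I
      - fderivWithin ℝ (fun y => A y I) {z | 0 ≤ z.im} x 1
      + su11.bracket (A x 1) (A x I) = 0) :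
    ∃ r > 0, Metric.closedBall p r ∩ {z | 0 ≤ z.im} ⊆ T ∧ ∃ g : ℂ → SU11,
      ContDiffOn ℝ ∞ (fun x => ((g x).a, (g x).b)) (Metric.closedBall p r ∩ {z | 0 ≤ z.im}) ∧
      ∀ x ∈ Metric.closedBall p r ∩ {z | 0 ≤ z.im},
        HasFDerivWithinAt (fun x => ((g x).a, (g x).b))
          ((ContinuousLinearMap.apply ℝ (ℂ × ℂ) ((g x).a, (g x).b)).comp (su11.rep.comp (A x)))
          (Metric.closedBall p r ∩ {z | 0 ≤ z.im}) x := by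
  obtain ⟨r₁, hr₁, hsub₁⟩ : ∃ r > 0, Metric.closedBall p r ∩ {z | 0 ≤ z.im} ⊆ T := by
    obtain ⟨r, hr, h⟩ := Metric.mem_nhdsWithin_iff.1 (hT p hpT)
    exact ⟨r / 2, by positivity, (inter_subset_inter_left _
      (Metric.closedBall_subset_ball (by linarith))).trans h⟩
  have hcomp : ∀ r, IsCompact (Metric.closedBall p r ∩ {z | 0 ≤ z.im}) := fun r =>
    (isCompact_closedBall _ _).inter_right (isClosed_le continuous_const continuous_im)
  set B : ℂ → ℂ →L[ℝ] (ℂ × ℂ) →L[ℝ] (ℂ × ℂ) := fun x => su11.rep.comp (A x) with hBdef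
  have hBT : ContDiffOn ℝ ∞ B T := contDiffOn_const.clm_comp hA
  obtain ⟨M, hM⟩ := (hcomp r₁).exists_bound_of_continuousOn
    (E := ℂ →L[ℝ] (ℂ × ℂ) →L[ℝ] (ℂ × ℂ)) (hBT.continuousOn.mono hsub₁)
  -- The second bound gives |M| · r ≤ 1/2, the smallness needed to transport over the whole unit
  -- interval.
  set r := min r₁ (1 / (2 * (|M| + 1))) with hr
  have hrpos : 0 < r := lt_min hr₁ (by positivity)
  set Q := Metric.closedBall p r ∩ {z : ℂ | 0 ≤ z.im} with hQ
  have hQr₁ : Q ⊆ Metric.closedBall p r₁ ∩ {z | 0 ≤ z.im} :=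
    inter_subset_inter_left _ (Metric.closedBall_subset_closedBall (min_le_left _ _))
  have hQT : Q ⊆ T := hQr₁.trans hsub₁
  have hQc : Convex ℝ Q := convex_closedBall_inter_halfPlane p r
  have hQu : UniqueDiffOn ℝ Q := uniqueDiffOn_closedBall_inter_halfPlane hp hrpos
  have hpQ : p ∈ Q := ⟨Metric.mem_closedBall_self hrpos.le, hp⟩
  have hBQ : ContDiffOn ℝ ∞ B Q := hBT.mono hQT
  have hAQ : ContDiffOn ℝ ∞ A Q := hA.mono hQT
  obtain ⟨K, K₂, hK0, hK₂0, hK, hK₂⟩ := exists_taylor_bounds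
    (E := ℂ →L[ℝ] (ℂ × ℂ) →L[ℝ] (ℂ × ℂ)) (hBQ.of_le
      (show ((2 : ℕ∞) : WithTop ℕ∞) ≤ ∞ by exact_mod_cast le_top)) hQc
    (hcomp r) hQu
  have hAd : ∀ x ∈ Q, HasFDerivWithinAt A (fderivWithin ℝ A Q x) Q x := fun x hx =>
    (hAQ.differentiableOn (by simp) x hx).hasFDerivWithinAt
  have hBd : ∀ x ∈ Q, HasFDerivWithinAt B (fderivWithin ℝ B Q x) Q x := fun x hx =>
    (hBQ.differentiableOn (by simp) x hx).hasFDerivWithinAt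
  -- the derivative of `B` in terms of that of `A`
  have hB' : ∀ x ∈ Q, ∀ d h : ℂ, fderivWithin ℝ B Q x d h =
      su11.rep (fderivWithin ℝ A Q x d h) := by
    intro x hx d h
    have h1 : HasFDerivWithinAt B
        ((ContinuousLinearMap.compL ℝ ℂ su11 ((ℂ × ℂ) →L[ℝ] (ℂ × ℂ)) su11.rep).comp
          (fderivWithin ℝ A Q x)) Q x :=
      HasFDerivAt.comp_hasFDerivWithinAt (F := ℂ →L[ℝ] su11)
        (G := ℂ →L[ℝ] (ℂ × ℂ) →L[ℝ] (ℂ × ℂ)) x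
        ((ContinuousLinearMap.compL ℝ ℂ su11 ((ℂ × ℂ) →L[ℝ] (ℂ × ℂ))
        su11.rep).hasFDerivAt) (hAd x hx)
    rw [h1.fderivWithin (hQu x hx)]
    rfl
  -- flatness in terms of the derivative of `A` along `Q`
  have hcurv : ∀ x ∈ Q, fderivWithin ℝ A Q x I 1 - fderivWithin ℝ A Q x 1 I +
      su11.bracket (A x 1) (A x I) = 0 := by
    intro x hx
    rw [← hflat x (hQT hx)]
    -- Derivatives within Q and within the half-plane agree, because Q is a set of unique
    -- differentiability.
    have hev : ∀ v : ℂ, fderivWithin ℝ (fun y => A y v) {z | 0 ≤ z.im} x =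
        (ContinuousLinearMap.apply ℝ su11 v).comp (fderivWithin ℝ A Q x) := by
      intro v
      have hAT : DifferentiableWithinAt ℝ A {z | 0 ≤ z.im} x :=
        (hA.differentiableOn (by simp) x (hQT hx)).mono_of_mem_nhdsWithin (hT x (hQT hx))
      have h1 : HasFDerivWithinAt (fun y => A y v) ((ContinuousLinearMap.apply ℝ su11 v).comp
          (fderivWithin ℝ A {z | 0 ≤ z.im} x)) {z | 0 ≤ z.im} x :=
        (ContinuousLinearMap.apply ℝ su11 v).hasFDerivAt.comp_hasFDerivWithinAt x
          hAT.hasFDerivWithinAt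
      have h2 : fderivWithin ℝ A Q x = fderivWithin ℝ A {z | 0 ≤ z.im} x :=
        (hAT.hasFDerivWithinAt.mono inter_subset_right).fderivWithin (hQu x hx)
      have hu : UniqueDiffWithinAt ℝ {z : ℂ | 0 ≤ z.im} x := (hQu x hx).mono inter_subset_right
      rw [h2, h1.fderivWithin hu]
    rw [hev 1, hev I]
    rfl
  have hflatB : ∀ x ∈ Q, ∀ d h : ℂ, fderivWithin ℝ B Q x d h + (B x h).comp (B x d) =
      fderivWithin ℝ B Q x h d + (B x d).comp (B x h) := by
    intro x hx d h
    have hlin : ∀ (L : ℂ →L[ℝ] su11) (v : ℂ), L v = v.re • L 1 + v.im • L I := by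
      intro L v
      rw [← map_smul, ← map_smul, ← map_add]
      congr 1
      apply Complex.ext <;> simp
    have hlin2 : ∀ (L : ℂ →L[ℝ] ℂ →L[ℝ] su11) (v : ℂ), L v = v.re • L 1 + v.im • L I := by
      intro L v
      rw [← map_smul, ← map_smul, ← map_add]
      congr 1
      apply Complex.ext <;> simp
    -- The curvature is alternating in (d, h), so in real dimension two its value on (1, I)
    -- determines it.
    have hAdh : fderivWithin ℝ A Q x d h - fderivWithin ℝ A Q x h d +
        su11.bracket (A x h) (A x d) = 0 := by
      have hbr : su11.bracket (A x h) (A x d) =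
          (h.re * d.im - h.im * d.re) • su11.bracket (A x 1) (A x I) := by
        rw [hlin (A x) h, hlin (A x) d]
        ext <;> simp [su11.bracket] <;> ring
      have hc := hcurv x hx
      rw [hbr]
      rw [hlin2 (fderivWithin ℝ A Q x) d, hlin2 (fderivWithin ℝ A Q x) h]
      simp only [add_apply, smul_apply]
      rw [hlin (fderivWithin ℝ A Q x 1) h, hlin (fderivWithin ℝ A Q x I) h,
        hlin (fderivWithin ℝ A Q x 1) d, hlin (fderivWithin ℝ A Q x I) d]
      have hc' : su11.bracket (A x 1) (A x I) =
          fderivWithin ℝ A Q x 1 I - fderivWithin ℝ A Q x I 1 := by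
        rw [← sub_eq_zero, ← hc]; abel
      rw [hc']
      module
    rw [hB' x hx, hB' x hx]
    have := congrArg su11.rep hAdh
    rw [map_add, map_sub, map_zero, su11.rep_bracket] at this
    have e : ∀ v, B x v = su11.rep (A x v) := fun v => rfl
    rw [e, e, ← sub_eq_zero, ← this]
    abel
  obtain ⟨G, hGp, hG⟩ := exists_flat_section hQc hpQ (R := r) (abs_nonneg M) hK0 hK₂0
    (fun x hx => by simpa [dist_eq_norm] using hx.1) hBd
    (fun x hx => (hM x (hQr₁ hx)).trans (le_abs_self _)) hK hK₂ (by
      calc |M| * r ≤ (|M| + 1) * (1 / (2 * (|M| + 1))) := by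
            gcongr
            · linarith
            · exact min_le_right _ _
        _ = 1 / 2 := by field_simp) hflatB ((1, 0) : ℂ × ℂ)
  have hdet : ∀ x ∈ Q, normSq (G x).1 - normSq (G x).2 = 1 := by
    intro x hx
    have hder : ∀ x ∈ Q, HasFDerivWithinAt (fun x => ‖(G x).1‖ ^ 2 - ‖(G x).2‖ ^ 2)
        (0 : ℂ →L[ℝ] ℝ) Q x := by
      intro x hx
      have h1 := (hG x hx).fst.norm_sq.sub (hG x hx).snd.norm_sq
      refine h1.congr_fderiv ?_
      ext
      all_goals
        simp [su11.rep_apply, hBdef, inner]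
        ring
    have := hQc.is_const_of_fderivWithin_eq_zero (fun x hx => (hder x hx).differentiableWithinAt)
      (fun x hx => (hder x hx).fderivWithin (hQu x hx)) hx hpQ
    simp only [hGp] at this
    rw [normSq_eq_norm_sq, normSq_eq_norm_sq, this]
    simp
  -- Off Q the identity serves as a default value.
  set g : ℂ → SU11 := fun x => if h : normSq (G x).1 - normSq (G x).2 = 1 then
    ⟨(G x).1, (G x).2, h⟩ else ⟨1, 0, by simp⟩ with hg
  have hgG : ∀ x ∈ Q, ((g x).a, (g x).b) = G x := fun x hx => by
    simp only [hg, dif_pos (hdet x hx)]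
  refine ⟨r, hrpos, hQT, g, (contDiffOn_flat_section hQu hBQ hG).congr hgG, fun x hx => ?_⟩
  rw [hgG x hx]
  exact (hG x hx).congr hgG (hgG x hx)

/-! ### Möbius transformations of the disc -/

/-- The inverse of an element of `SU(1,1)`. -/
def SU11.inv (g : SU11) : SU11 := ⟨conj g.a, -g.b, by simpa using g.det_eq_one⟩

/-- The product in `SU(1,1)`. -/
def SU11.mul (g h : SU11) : SU11 :=
  ⟨g.a * h.a + g.b * conj h.b, g.a * h.b + g.b * conj h.a, by
    have h1 := g.det_eq_one
    have h2 := h.det_eq_one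
    simp only [normSq_apply, add_re, mul_re, add_im, mul_im, conj_re, conj_im] at h1 h2 ⊢
    linear_combination (h.a.re * h.a.re + h.a.im * h.a.im - (h.b.re * h.b.re + h.b.im * h.b.im))
      * h1 + h2⟩

theorem SU11.conj_mul_sub (g : SU11) : g.a * conj g.a - g.b * conj g.b = 1 := by
  rw [mul_conj, mul_conj, ← ofReal_sub, g.det_eq_one, ofReal_one]

theorem SU11.inv_denom_ne_zero (g : SU11) {w : ℂ} (hw : ‖w‖ ≤ 1) : g.a - conj g.b * w ≠ 0 := by
  have := g.inv.denom_ne_zero hw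
  simp only [SU11.inv, map_neg, conj_conj] at this
  intro h
  apply this
  rw [← h]; ring

theorem SU11.inv_act (g : SU11) (w : ℂ) :
    g.inv.act w = (conj g.a * w - g.b) / (g.a - conj g.b * w) := by
  simp only [SU11.act, SU11.inv, map_neg, conj_conj]
  congr 1; ring

theorem SU11.norm_act_le_one (g : SU11) {w : ℂ} (hw : ‖w‖ ≤ 1) : ‖g.act w‖ ≤ 1 := by
  have h := g.one_sub_normSq_act hw
  have hw2 : 0 ≤ 1 - normSq w := by
    rw [normSq_eq_norm_sq]; nlinarith [norm_nonneg w]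
  have : 0 ≤ 1 - normSq (g.act w) := h ▸ div_nonneg hw2 (normSq_nonneg _)
  rw [normSq_eq_norm_sq] at this
  nlinarith [norm_nonneg (g.act w)]

theorem SU11.norm_act_eq_one (g : SU11) {w : ℂ} (hw : ‖w‖ = 1) : ‖g.act w‖ = 1 := by
  have h := g.one_sub_normSq_act hw.le
  simp only [normSq_eq_norm_sq, hw, one_pow, sub_self, zero_div] at h
  nlinarith [norm_nonneg (g.act w)]

theorem SU11.act_inv_act (g : SU11) {w : ℂ} (hw : ‖w‖ ≤ 1) : g.act (g.inv.act w) = w := by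
  have h1 := g.inv_denom_ne_zero hw
  have h2 := g.denom_ne_zero (g.inv.norm_act_le_one hw)
  have e1 : g.inv.act w * (g.a - conj g.b * w) = conj g.a * w - g.b := by
    rw [g.inv_act]; exact div_mul_cancel₀ _ h1
  rw [SU11.act, div_eq_iff h2]
  linear_combination e1

theorem SU11.mul_act (g h : SU11) {w : ℂ} (hw : ‖w‖ ≤ 1) : (g.mul h).act w = g.act (h.act w) := by
  have h1 := h.denom_ne_zero hw
  have h2 := g.denom_ne_zero (h.norm_act_le_one hw)
  have h3 := (g.mul h).denom_ne_zero hw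
  have e1 : h.act w * (conj h.b * w + conj h.a) = h.a * w + h.b := div_mul_cancel₀ _ h1
  have e : (conj g.b * h.act w + conj g.a) * (conj h.b * w + conj h.a) =
      conj (g.mul h).b * w + conj (g.mul h).a := by
    simp only [SU11.mul, map_add, map_mul, conj_conj]
    linear_combination conj g.b * e1
  have e2 : (g.a * h.act w + g.b) * (conj h.b * w + conj h.a) =
      (g.mul h).a * w + (g.mul h).b := by
    simp only [SU11.mul]
    linear_combination g.a * e1
  rw [SU11.act, SU11.act.eq_1 g, ← e, ← e2, mul_div_mul_right _ _ h1]

/-- A bound for the distortion of an element of `SU(1,1)`. -/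
def SU11.distortion (g : SU11) : ℝ := (‖g.a‖ + ‖g.b‖) ^ 2

theorem SU11.distortion_inv (g : SU11) : g.inv.distortion = g.distortion := by
  simp [SU11.distortion, SU11.inv]

/-- The denominator is at least |a| - |b| in absolute value, and this equals 1/(|a| + |b|) by the
determinant condition. -/
theorem SU11.one_le_normDenom (g : SU11) {w : ℂ} (hw : ‖w‖ ≤ 1) :
    1 ≤ (‖g.a‖ + ‖g.b‖) * ‖conj g.b * w + conj g.a‖ := by
  have h := g.det_eq_one
  rw [normSq_eq_norm_sq, normSq_eq_norm_sq] at h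
  have h1 : ‖g.a‖ - ‖g.b‖ ≤ ‖conj g.b * w + conj g.a‖ := by
    have := norm_sub_norm_le (conj g.a) (-(conj g.b * w))
    rw [norm_neg, norm_mul, norm_conj, norm_conj, sub_neg_eq_add, add_comm (conj g.a)] at this
    have h2 : ‖g.b‖ * ‖w‖ ≤ ‖g.b‖ := mul_le_of_le_one_right (norm_nonneg _) hw
    linarith
  have h0 : 0 ≤ ‖g.a‖ + ‖g.b‖ := by positivity
  nlinarith

/-- The difference g(w) - g(l) is w - l divided by the two denominators, each bounded below by
`SU11.one_le_normDenom`. -/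
theorem SU11.norm_act_sub_act_le (g : SU11) {w l : ℂ} (hw : ‖w‖ ≤ 1) (hl : ‖l‖ ≤ 1) :
    ‖g.act w - g.act l‖ ≤ g.distortion * ‖w - l‖ := by
  have h1 := g.denom_ne_zero hw
  have h2 := g.denom_ne_zero hl
  have e : (g.act w - g.act l) * ((conj g.b * w + conj g.a) * (conj g.b * l + conj g.a)) = w - l := by
    have hd := g.conj_mul_sub
    have e1 : g.act w * (conj g.b * w + conj g.a) = g.a * w + g.b := div_mul_cancel₀ _ h1
    have e2 : g.act l * (conj g.b * l + conj g.a) = g.a * l + g.b := div_mul_cancel₀ _ h2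
    linear_combination (conj g.b * l + conj g.a) * e1 - (conj g.b * w + conj g.a) * e2 +
      (w - l) * hd
  have hn := congrArg norm e
  rw [norm_mul, norm_mul] at hn
  have b1 := g.one_le_normDenom hw
  have b2 := g.one_le_normDenom hl
  have b3 := mul_le_mul b1 b2 zero_le_one (by positivity)
  rw [SU11.distortion, ← hn]
  calc _ = ‖g.act w - g.act l‖ * (1 * 1) := by ring
    _ ≤ ‖g.act w - g.act l‖ * _ := mul_le_mul_of_nonneg_left b3 (norm_nonneg _)
    _ = _ := by ring

theorem SU11.one_sub_normSq_act_le (g : SU11) {w : ℂ} (hw : ‖w‖ ≤ 1) :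
    1 - ‖g.act w‖ ^ 2 ≤ g.distortion * (1 - ‖w‖ ^ 2) := by
  have h := g.one_sub_normSq_act hw
  simp only [normSq_eq_norm_sq] at h
  have hpos : 0 < ‖conj g.b * w + conj g.a‖ := norm_pos_iff.2 (g.denom_ne_zero hw)
  have b := g.one_le_normDenom hw
  have b2 : 1 ≤ (‖g.a‖ + ‖g.b‖) ^ 2 * ‖conj g.b * w + conj g.a‖ ^ 2 := by
    rw [← mul_pow]; exact one_le_pow₀ b
  have hw2 : 0 ≤ 1 - ‖w‖ ^ 2 := by nlinarith [norm_nonneg w]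
  rw [h, div_le_iff₀ (by positivity), SU11.distortion]
  nlinarith

/-! ### Geodesic rays with a given point at infinity -/

/-- The Cayley transformation from the disc to the upper half-plane, mapping `l` to infinity. -/
def cayley (l w : ℂ) : ℂ := I * (l + w) / (l - w)

/-- The real part of the geodesic `g((-1,1))` in the upper half-plane, when its endpoint `g(1)` is
placed at infinity. -/
def SU11.rayRe (g : SU11) : ℝ := -2 * (g.b * conj g.a).im

/-- With its endpoint at infinity the ray is a vertical half-line, starting at height |a + b|². This
supplies both boundary conditions for V: a fixed real part and a positive lower bound for the
imaginary part. -/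
theorem SU11.cayley_act (g : SU11) {l : ℂ} (hl : g.act 1 = l) {x : ℝ} (hx0 : 0 ≤ x) (hx1 : x < 1) :
    cayley l (g.act x) = g.rayRe + (normSq (g.a + g.b) * ((1 + x) / (1 - x)) : ℝ) * I := by
  have hxn : ‖(x : ℂ)‖ ≤ 1 := by rw [norm_real, Real.norm_of_nonneg hx0]; exact hx1.le
  have h1 := g.denom_ne_zero hxn
  have h2 := g.denom_ne_zero (w := 1) (by simp)
  have hd := g.conj_mul_sub
  have hx : (1 - x : ℂ) ≠ 0 := by
    rw [← ofReal_one, ← ofReal_sub, ofReal_ne_zero]; linarith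
  have e1 : g.act x * (conj g.b * x + conj g.a) = g.a * x + g.b := div_mul_cancel₀ _ h1
  have e2 : l * (conj g.b * 1 + conj g.a) = g.a * 1 + g.b := hl ▸ div_mul_cancel₀ _ h2
  have e3 : (l - g.act x) * ((conj g.b * x + conj g.a) * (conj g.b * 1 + conj g.a)) = 1 - x := by
    linear_combination (conj g.b * x + conj g.a) * e2 - (conj g.b * 1 + conj g.a) * e1 +
      (1 - x) * hd
  have hne : l - g.act x ≠ 0 := by
    intro h
    rw [h, zero_mul] at e3
    exact hx e3.symm
  have e4 : (normSq (g.a + g.b) : ℂ) = (g.a + g.b) * (conj g.a + conj g.b) := by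
    rw [← map_add, mul_conj]
  have e5 : (g.rayRe : ℂ) = I * (g.b * conj g.a - conj g.b * g.a) := by
    apply Complex.ext <;> simp [SU11.rayRe]; ring
  rw [cayley, div_eq_iff hne, e5]
  push_cast
  rw [e4]
  have hprod : (conj g.b * x + conj g.a) * (conj g.b * 1 + conj g.a) ≠ 0 :=
    mul_ne_zero h1 (by simpa using h2)
  apply mul_right_cancel₀ hprod
  have e6 : (l + g.act x) * ((conj g.b * x + conj g.a) * (conj g.b * 1 + conj g.a)) =
      (g.a * 1 + g.b) * (conj g.b * x + conj g.a) +
      (g.a * x + g.b) * (conj g.b * 1 + conj g.a) := by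
    linear_combination (conj g.b * x + conj g.a) * e2 + (conj g.b * 1 + conj g.a) * e1
  calc I * (l + g.act x) * ((conj g.b * x + conj g.a) * (conj g.b * 1 + conj g.a))
      = I * ((l + g.act x) * ((conj g.b * x + conj g.a) * (conj g.b * 1 + conj g.a))) := by ring
    _ = (I * (g.b * conj g.a - conj g.b * g.a) +
        (g.a + g.b) * (conj g.a + conj g.b) * ((1 + x) / (1 - x)) * I) * (1 - x) := by
      rw [e6]
      field_simp
      ring
    _ = _ := by rw [← e3]; ring

theorem im_cayley {l w : ℂ} (hl : ‖l‖ = 1) : (cayley l w).im = (1 - ‖w‖ ^ 2) / ‖l - w‖ ^ 2 := by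
  have h : normSq l = 1 := by rw [normSq_eq_norm_sq, hl, one_pow]
  rw [← normSq_eq_norm_sq, ← normSq_eq_norm_sq, cayley, div_im, ← h]
  rw [← sub_div]
  congr 1
  simp [normSq_apply]; ring

/-- Quantifies that w is close to l exactly when its Cayley transform is large. -/
theorem norm_cayley_add_I {l w : ℂ} (hl : ‖l‖ = 1) (h : l ≠ w) :
    ‖cayley l w + I‖ * ‖l - w‖ = 2 := by
  have h0 : l - w ≠ 0 := sub_ne_zero.2 h
  have e : (cayley l w + I) * (l - w) = 2 * I * l := by
    rw [cayley, add_mul, div_mul_cancel₀ _ h0]; ring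
  rw [← norm_mul, e]; simp [hl]

theorem differentiableAt_cayley {l w : ℂ} (h : l ≠ w) : DifferentiableAt ℂ (cayley l) w := by
  unfold cayley
  refine DifferentiableAt.div (by fun_prop) (by fun_prop) (sub_ne_zero.2 h)

/-! ### Derivatives along a horizontal path of Möbius transformations -/

section

variable {F : Type*} [NormedAddCommGroup F] [NormedSpace ℝ F]

theorem HasFDerivWithinAt.cdiv {n d : F → ℂ} {n' d' : F →L[ℝ] ℂ} {s : Set F} {x : F}
    (hn : HasFDerivWithinAt n n' s x) (hd : HasFDerivWithinAt d d' s x) (h0 : d x ≠ 0) :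
    HasFDerivWithinAt (fun y => n y / d y) ((d x)⁻¹ • n' - (n x / d x ^ 2) • d') s x := by
  have h1 := ((hasDerivAt_inv h0).hasFDerivAt.restrictScalars ℝ).comp_hasFDerivWithinAt x hd
  have h2 := hn.mul h1
  simp only [div_eq_mul_inv]
  refine h2.congr_fderiv ?_
  ext v
  simp
  ring

theorem SU11.hasFDerivWithinAt_act {g : F → SU11} {A : F →L[ℝ] su11} {s : Set F} {x : F} {l : ℂ}
    (hl : ‖l‖ ≤ 1)
    (hg : HasFDerivWithinAt (fun y => ((g y).a, (g y).b))
      ((ContinuousLinearMap.apply ℝ (ℂ × ℂ) ((g x).a, (g x).b)).comp (su11.rep.comp A)) s x) :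
    ∃ D : F →L[ℝ] ℂ, (∀ v, D v = vectorField (A v) ((g x).act l)) ∧
      HasFDerivWithinAt (fun y => (g y).act l) D s x := by
  have ha := hg.fst
  have hb := hg.snd
  have h0 := (g x).denom_ne_zero hl
  have h := ((ha.mul_const l).add hb).cdiv ((hb.star.mul_const l).add ha.star) h0
  refine ⟨_, fun v => ?_, h⟩
  simp [su11.rep_apply, vectorField, SU11.act]
  field_simp
  ring

/-- Since dg = Ag, differentiating g⁻¹ removes the inhomogeneous term. What remains of Du - X_A is
multiplied by a complex number, so complex linearity is preserved and a vanishing Du - X_A gives a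
constant. -/
theorem SU11.hasFDerivWithinAt_inv_act {g : F → SU11} {A : F →L[ℝ] su11} {s : Set F} {x : F}
    {u : F → ℂ} {u' : F →L[ℝ] ℂ} (hux : ‖u x‖ ≤ 1) (hu : HasFDerivWithinAt u u' s x)
    (hg : HasFDerivWithinAt (fun y => ((g y).a, (g y).b))
      ((ContinuousLinearMap.apply ℝ (ℂ × ℂ) ((g x).a, (g x).b)).comp (su11.rep.comp A)) s x) :
    ∃ D : F →L[ℝ] ℂ,
      (∀ v, D v = (u' v - vectorField (A v) (u x)) / ((g x).a - conj (g x).b * u x) ^ 2) ∧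
      HasFDerivWithinAt (fun y => (g y).inv.act (u y)) D s x := by
  have ha := hg.fst
  have hb := hg.snd
  have h0 := (g x).inv_denom_ne_zero hux
  have hd := (g x).conj_mul_sub
  obtain ⟨D, hD, h⟩ : ∃ D, D = _ ∧ HasFDerivWithinAt _ D s x :=
    ⟨_, rfl, ((ha.star.mul hu).sub hb).cdiv (ha.sub (hb.star.mul hu)) h0⟩
  refine ⟨D, fun v => ?_, ?_⟩
  · rw [hD, eq_div_iff (pow_ne_zero 2 h0)]
    simp [su11.rep_apply, vectorField]
    field_simp
    linear_combination
      (u' v - (-(conj (A v).2) * u x ^ 2 + 2 * I * (A v).1 * u x + (A v).2)) * hd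
  · simp only [SU11.inv_act]
    exact h

end

/-! ### Differential calculus in the charts of a Riemann surface with boundary -/

section Charts

variable {S : Type*} [TopologicalSpace S] {e : OpenPartialHomeomorph S ClosedHalfPlane} {x : ℂ}

theorem range_modelR : range modelR = {z : ℂ | 0 ≤ z.im} := ClosedHalfPlane.range_inclusion

theorem target_subset_halfPlane (e : OpenPartialHomeomorph S ClosedHalfPlane) :
    (e.extend modelR).target ⊆ {z | 0 ≤ z.im} := by
  rw [← range_modelR]; exact e.extend_target_subset_range

theorem target_mem_nhdsWithin (hx : x ∈ (e.extend modelR).target) :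
    (e.extend modelR).target ∈ 𝓝[{z | 0 ≤ z.im}] x := by
  have hs : (e.extend modelR).symm x ∈ e.source := by
    rw [← e.extend_source (I := modelR)]; exact (e.extend modelR).map_target hx
  have := e.extend_target_mem_nhdsWithin (I := modelR) hs
  rwa [(e.extend modelR).right_inv hx, range_modelR] at this

variable [ChartedSpace ClosedHalfPlane S]

theorem isManifold_modelR [RiemannSurfaceWithBoundary S] : IsManifold modelR ∞ S := by
  have hC : IsManifold modelC ∞ S := RiemannSurfaceWithBoundary.holomorphic
  refine isManifold_of_contDiffOn modelR ∞ S fun e e' he he' => ?_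
  have h := (contDiffGroupoid ∞ modelC).compatible he he'
  exact (mem_groupoid_of_pregroupoid.1 h).1.restrict_scalars ℝ

/-- Transition maps have a complex derivative, and by uniqueness the real one is its restriction of
scalars. -/
theorem fderivWithin_coordChange_mul_I [RiemannSurfaceWithBoundary S]
    (he : e ∈ atlas ClosedHalfPlane S) {e' : OpenPartialHomeomorph S ClosedHalfPlane}
    (he' : e' ∈ atlas ClosedHalfPlane S) (hx : x ∈ (e.extend modelR).target)
    (hx' : (e.extend modelR).symm x ∈ e'.source) (v : ℂ) :
    fderivWithin ℝ (e'.extend modelR ∘ (e.extend modelR).symm) (range modelR) x (I * v) =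
      I * fderivWithin ℝ (e'.extend modelR ∘ (e.extend modelR).symm) (range modelR) x v := by
  have hC : IsManifold modelC ∞ S := RiemannSurfaceWithBoundary.holomorphic
  have h := ModelWithCorners.contDiffWithinAt_extendCoordChange (n := ∞) (I := modelC)
    (IsManifold.subset_maximalAtlas he) (IsManifold.subset_maximalAtlas he') (x := x) (by
      rw [ModelWithCorners.extendCoordChange, PartialEquiv.trans_source]
      exact ⟨hx, by rw [mem_preimage, e'.extend_source]; exact hx'⟩)
  have hd : DifferentiableWithinAt ℂ (e'.extend modelR ∘ (e.extend modelR).symm) (range modelR) x :=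
    h.differentiableWithinAt (by simp)
  have hu : UniqueDiffWithinAt ℝ (range modelR) x :=
    modelR.uniqueDiffOn x (e.extend_target_subset_range hx)
  rw [(hd.hasFDerivWithinAt.restrictScalars ℝ).fderivWithin hu]
  simp [← smul_eq_mul]

theorem mdifferentiableWithinAt_extend_symm [RiemannSurfaceWithBoundary S]
    (he : e ∈ atlas ClosedHalfPlane S) (hx : x ∈ (e.extend modelR).target) :
    MDifferentiableWithinAt 𝓘(ℝ, ℂ) modelR (e.extend modelR).symm (range modelR) x := by
  have := isManifold_modelR (S := S)
  have h := contMDiffOn_extend_symm (I := modelR) (n := ∞) (IsManifold.subset_maximalAtlas he)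
  rw [← e.extend_target'] at h
  refine ((h x hx).mdifferentiableWithinAt (by simp)).mono_of_mem_nhdsWithin ?_
  rw [range_modelR]
  exact target_mem_nhdsWithin hx

/-- The tangent space at a point is identified with ℂ through the preferred chart there, so the
derivative of an inverse chart is that of a transition map. Holomorphy of inverse charts with
respect to `surfaceJ` follows. -/
theorem mfderivWithin_extend_symm_eq [RiemannSurfaceWithBoundary S]
    (he : e ∈ atlas ClosedHalfPlane S) (hx : x ∈ (e.extend modelR).target) (v : ℂ) :
    mfderivWithin 𝓘(ℝ, ℂ) modelR (e.extend modelR).symm (range modelR) x v =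
      fderivWithin ℝ ((chartAt ClosedHalfPlane ((e.extend modelR).symm x)).extend modelR ∘
        (e.extend modelR).symm) (range modelR) x v := by
  have hs : (extChartAt 𝓘(ℝ, ℂ) x).symm ⁻¹' range modelR ∩ range 𝓘(ℝ, ℂ) = range modelR := by
    rw [extChartAt_model_space_eq_id]; simp
  have h := congrArg (fun L : ℂ →L[ℝ] ℂ => L v) (mdifferentiableWithinAt_extend_symm he hx).mfderivWithin
  refine h.trans ?_
  rw [hs]
  rfl

theorem mfderivWithin_extend_symm_mul_I [RiemannSurfaceWithBoundary S]
    (he : e ∈ atlas ClosedHalfPlane S) (hx : x ∈ (e.extend modelR).target) (v : ℂ) :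
    mfderivWithin 𝓘(ℝ, ℂ) modelR (e.extend modelR).symm (range modelR) x (I * v : ℂ) =
      surfaceJ _ (mfderivWithin 𝓘(ℝ, ℂ) modelR (e.extend modelR).symm (range modelR) x v) := by
  refine (mfderivWithin_extend_symm_eq he hx (I * v)).trans ?_
  rw [fderivWithin_coordChange_mul_I he (chart_mem_atlas _ _) hx (mem_chart_source _ _),
    ← mfderivWithin_extend_symm_eq he hx]
  rfl

/-- The derivative of a map in a chart. -/
theorem hasFDerivWithinAt_comp_extend_symm [RiemannSurfaceWithBoundary S]
    (he : e ∈ atlas ClosedHalfPlane S) (hx : x ∈ (e.extend modelR).target) {u : S → ℂ}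
    (hu : MDifferentiableAt modelR 𝓘(ℝ, ℂ) u ((e.extend modelR).symm x)) :
    HasFDerivWithinAt (u ∘ (e.extend modelR).symm)
      ((surfaceDeriv u ((e.extend modelR).symm x)).comp
        (mfderivWithin 𝓘(ℝ, ℂ) modelR (e.extend modelR).symm (range modelR) x))
      {z | 0 ≤ z.im} x := by
  have hm := mdifferentiableWithinAt_extend_symm he hx
  have hu' : UniqueMDiffWithinAt 𝓘(ℝ, ℂ) (range modelR) x :=
    (modelR.uniqueDiffOn x (e.extend_target_subset_range hx)).uniqueMDiffWithinAt
  have h := mfderiv_comp_mfderivWithin x hu hm hu'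
  rw [mfderivWithin_eq_fderivWithin] at h
  have hd : DifferentiableWithinAt ℝ (u ∘ (e.extend modelR).symm) (range modelR) x :=
    (hu.comp_mdifferentiableWithinAt x hm).differentiableWithinAt
  have := hd.hasFDerivWithinAt
  rw [h] at this
  exact this.mono range_modelR.symm.subset

theorem IsSolution.hasFDerivWithinAt_inChart [RiemannSurfaceWithBoundary S] {A : OneForm S}
    {R : modelR.boundary S → GeodesicRay} {u : S → ℂ} (hu : IsSolution A R u)
    (he : e ∈ atlas ClosedHalfPlane S) (hx : x ∈ (e.extend modelR).target) :
    ∃ D : ℂ →L[ℝ] ℂ, HasFDerivWithinAt (u ∘ (e.extend modelR).symm) D {z | 0 ≤ z.im} x ∧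
      ∀ v, D (I * v) - vectorField (A.inChart e x (I * v)) (u ((e.extend modelR).symm x)) =
        I * (D v - vectorField (A.inChart e x v) (u ((e.extend modelR).symm x))) := by
  refine ⟨_, hasFDerivWithinAt_comp_extend_symm he hx
    ((hu.contMDiff _).mdifferentiableAt (by simp)), fun v => ?_⟩
  have h := hu.cauchyRiemann ((e.extend modelR).symm x)
    (mfderivWithin 𝓘(ℝ, ℂ) modelR (e.extend modelR).symm (range modelR) x v)
  rw [← mfderivWithin_extend_symm_mul_I he hx] at h
  exact h

theorem mfderivWithin_extend_symm_self [RiemannSurfaceWithBoundary S] (p : S) (v : ℂ) :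
    mfderivWithin 𝓘(ℝ, ℂ) modelR ((chartAt ClosedHalfPlane p).extend modelR).symm (range modelR)
      ((chartAt ClosedHalfPlane p).extend modelR p) v = v := by
  have hp : ((chartAt ClosedHalfPlane p).extend modelR p) ∈
      ((chartAt ClosedHalfPlane p).extend modelR).target :=
    ((chartAt ClosedHalfPlane p).extend modelR).map_source
      (by rw [OpenPartialHomeomorph.extend_source]; exact mem_chart_source _ p)
  have hsymm : ((chartAt ClosedHalfPlane p).extend modelR).symm
      ((chartAt ClosedHalfPlane p).extend modelR p) = p :=
    OpenPartialHomeomorph.extend_left_inv _ (mem_chart_source _ p)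
  refine (mfderivWithin_extend_symm_eq (chart_mem_atlas _ p) hp v).trans ?_
  rw [hsymm]
  have hu : UniqueDiffWithinAt ℝ (range modelR) ((chartAt ClosedHalfPlane p).extend modelR p) :=
    modelR.uniqueDiffOn _ (OpenPartialHomeomorph.extend_target_subset_range _ hp)
  have hid : ((chartAt ClosedHalfPlane p).extend modelR ∘
      ((chartAt ClosedHalfPlane p).extend modelR).symm) =ᶠ[𝓝[range modelR]
        ((chartAt ClosedHalfPlane p).extend modelR p)] id := by
    filter_upwards [OpenPartialHomeomorph.extend_target_mem_nhdsWithin (I := modelR)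
      (chartAt ClosedHalfPlane p) (mem_chart_source _ p)] with y hy
    exact ((chartAt ClosedHalfPlane p).extend modelR).right_inv hy
  rw [hid.fderivWithin_eq_of_mem (OpenPartialHomeomorph.extend_target_subset_range _ hp),
    fderivWithin_id hu]
  rfl

end Charts

/-! ### Convergence to the circle at infinity in a disc or half-disc -/

/-- Schwarz–Pick on the disc of radius 3r/4 about q_k: points of the quarter disc are within r/2,
two thirds of that radius. -/
theorem disc_eventually_close {p : ℂ} {r : ℝ} {w : ℕ → ℂ → ℂ}
    (hwd : ∀ k, DifferentiableOn ℂ (w k) (Metric.ball p r)) (hw1 : ∀ k z, ‖w k z‖ < 1)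
    {q : ℕ → ℂ} (hq : ∀ k, q k ∈ Metric.ball p (r / 4))
    (hlim : Tendsto (fun k => 1 - ‖w k (q k)‖ ^ 2) atTop (𝓝 0)) {ε : ℝ} (hε : 0 < ε) :
    ∀ᶠ k in atTop, ∀ x ∈ Metric.ball p (r / 4), ‖w k x - w k (q k)‖ < ε := by
  have h2 : ∀ᶠ k in atTop, 2 * (1 - ‖w k (q k)‖ ^ 2) < ε := by
    have := hlim.const_mul 2
    rw [mul_zero] at this
    exact this.eventually_lt_const hε
  filter_upwards [h2] with k hk x hx
  have hq' := Metric.mem_ball.1 (hq k)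
  have hx' := Metric.mem_ball.1 hx
  have ht := dist_triangle_right x (q k) p
  have hr : 0 < r := by linarith [dist_nonneg (x := x) (y := p)]
  have hsub : Metric.ball (q k) (3 / 4 * r) ⊆ Metric.ball p r := Metric.ball_subset_ball' (by linarith)
  exact (norm_sub_le_schwarzPick_disc ((hwd k).mono hsub) (fun y _ => hw1 k y)
    (Metric.mem_ball.2 (by linarith)) (by linarith)).trans_lt hk

/-- Apply `halfDisc_eventually_large` to the Cayley transforms, with threshold 2/ε + 2: then |V + i|
≥ 2/ε + 1, so |w - l| = 2/|V + i| < ε. -/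
theorem halfDisc_eventually_close {s r : ℝ} (hr : 0 < r) {c c' c'' : ℝ → ℝ}
    (h1 : ∀ x ∈ Icc (s - r) (s + r), HasDerivWithinAt c (c' x) (Icc (s - r) (s + r)) x)
    (h2 : ∀ x ∈ Icc (s - r) (s + r), HasDerivWithinAt c' (c'' x) (Icc (s - r) (s + r)) x)
    (h3 : ContinuousOn c'' (Icc (s - r) (s + r))) {w : ℕ → ℂ → ℂ}
    (hwc : ∀ k, ContinuousOn (w k) (Metric.ball (s : ℂ) r ∩ {z | 0 ≤ z.im}))
    (hwd : ∀ k, DifferentiableOn ℂ (w k) (Metric.ball (s : ℂ) r ∩ {z | 0 < z.im}))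
    (hw1 : ∀ k z, ‖w k z‖ < 1) {l : ℂ} (hl : ‖l‖ = 1)
    (hray : ∀ x : ℝ, (x : ℂ) ∈ Metric.ball (s : ℂ) r → ∃ η : SU11, η.act 1 = l ∧ η.rayRe = c x ∧
      ∀ k, w k x ∈ η.rayCarrier)
    {q : ℕ → ℂ} (hq : ∀ k, q k ∈ Metric.ball (s : ℂ) (r / 8)) (hq0 : ∀ k, 0 ≤ (q k).im)
    (hlim : Tendsto (fun k => 1 - ‖w k (q k)‖ ^ 2) atTop (𝓝 0)) {ε : ℝ} (hε : 0 < ε) :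
    ∀ᶠ k in atTop, ∀ x ∈ Metric.ball (s : ℂ) (r / 8), 0 ≤ x.im → ‖w k x - l‖ < ε := by
  have hne : ∀ k z, l ≠ w k z := fun k z h => by
    have := hw1 k z
    rw [← h, hl] at this
    exact lt_irrefl _ this
  have him : ∀ k z, 0 < (cayley l (w k z)).im := fun k z => by
    rw [im_cayley hl]
    have h1 : 0 < ‖l - w k z‖ := norm_pos_iff.2 (sub_ne_zero.2 (hne k z))
    have h2 : 0 < 1 - ‖w k z‖ ^ 2 := by nlinarith [norm_nonneg (w k z), hw1 k z]
    positivity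
  have hlarge := halfDisc_eventually_large hr h1 h2 h3 (V := fun k z => cayley l (w k z))
    (fun k z hz => ContinuousAt.comp_continuousWithinAt (g := cayley l)
      (differentiableAt_cayley (hne k z)).continuousAt (hwc k z hz))
    (fun k z hz => DifferentiableAt.comp_differentiableWithinAt (g := cayley l) z
      (differentiableAt_cayley (hne k z)) (hwd k z hz))
    (fun k z _ _ => him k z)
    (fun k x hx => by
      obtain ⟨η, hη, hc, hk⟩ := hray x hx
      obtain ⟨t, ht, hwt⟩ := hk k
      rw [← hwt, η.cayley_act hη ht.1 ht.2, hc, add_re, ofReal_re, mul_re, I_re, I_im, ofReal_im]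
      ring)
    (fun x hx => by
      obtain ⟨η, hη, hc, hk⟩ := hray x hx
      have hpos : 0 < normSq (η.a + η.b) := by
        refine normSq_pos.2 fun h => ?_
        rw [← hη, SU11.act, mul_one, h, zero_div, norm_zero] at hl
        exact zero_ne_one hl
      refine ⟨normSq (η.a + η.b), hpos, fun k => ?_⟩
      obtain ⟨t, ht, hwt⟩ := hk k
      rw [← hwt, η.cayley_act hη ht.1 ht.2, add_im, mul_im, I_re, I_im, ofReal_re, ofReal_im]
      have : 1 ≤ (1 + t) / (1 - t) := by
        rw [one_le_div (by linarith [ht.2])]; linarith [ht.1]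
      linarith [le_mul_of_one_le_right hpos.le this])
    hq hq0 (by
      -- The factor |l - w|² cancels, so approach to any point of the circle, not only to l, makes
      -- this quotient tend to 0.
      have : ∀ k, (cayley l (w k (q k))).im / ‖cayley l (w k (q k)) + I‖ ^ 2 =
          (1 - ‖w k (q k)‖ ^ 2) / 4 := fun k => by
        have h := norm_cayley_add_I hl (hne k (q k))
        have h0 : ‖l - w k (q k)‖ ≠ 0 := norm_ne_zero_iff.2 (sub_ne_zero.2 (hne k (q k)))
        rw [im_cayley hl, div_div, ← mul_pow, mul_comm, h]
        norm_num
      simp only [this]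
      simpa using hlim.div_const 4) (2 / ε + 2)
  filter_upwards [hlarge] with k hk x hx hx0
  have h := norm_cayley_add_I hl (hne k x)
  have h4 : 2 / ε + 1 ≤ ‖cayley l (w k x) + I‖ := by
    have := norm_sub_le (cayley l (w k x) + I) I
    rw [add_sub_cancel_right, norm_I] at this
    linarith [hk x hx hx0]
  have h5 : 0 < ‖l - w k x‖ := norm_pos_iff.2 (sub_ne_zero.2 (hne k x))
  rw [norm_sub_rev]
  by_contra! hcon
  have : (2 / ε + 1) * ε ≤ 2 := by
    calc _ ≤ ‖cayley l (w k x) + I‖ * ‖l - w k x‖ := by gcongr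
      _ = 2 := h
  rw [add_mul, div_mul_cancel₀ _ hε.ne'] at this
  linarith

/-! ### Gauged solutions in a chart -/

/-- `γ` trivializes the connection `d - B` on `Q`. -/
structure IsGauge (B : ℂ → ℂ →L[ℝ] su11) (γ : ℂ → SU11) (Q : Set ℂ) : Prop where
  contDiffOn : ContDiffOn ℝ ∞ (fun x => ((γ x).a, (γ x).b)) Q
  hasFDerivWithinAt : ∀ x ∈ Q, HasFDerivWithinAt (fun x => ((γ x).a, (γ x).b))
    ((ContinuousLinearMap.apply ℝ (ℂ × ℂ) ((γ x).a, (γ x).b)).comp (su11.rep.comp (B x))) Q x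

theorem IsGauge.mono {B : ℂ → ℂ →L[ℝ] su11} {γ : ℂ → SU11} {Q Q' : Set ℂ} (h : IsGauge B γ Q)
    (hQ : Q' ⊆ Q) : IsGauge B γ Q' :=
  ⟨h.contDiffOn.mono hQ, fun x hx => (h.hasFDerivWithinAt x (hQ hx)).mono hQ⟩

theorem differentiableAt_of_map_mul_I {f : ℂ → ℂ} {D : ℂ →L[ℝ] ℂ} {x : ℂ} (h : HasFDerivAt f D x)
    (hD : ∀ v, D (I * v) = I * D v) : DifferentiableAt ℂ f x := by
  refine (hasFDerivAt_of_restrictScalars ℝ (f' := ContinuousLinearMap.toSpanSingleton ℂ (D 1)) h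
    ?_).differentiableAt
  ext v
  have h1 := hD 1
  have : v = v.re • (1 : ℂ) + v.im • (I * 1) := by
    apply Complex.ext <;> simp
  have h2 : D v = v.re • D 1 + v.im • (I * D 1) := by
    conv_lhs => rw [this]
    rw [map_add, map_smul, map_smul, h1]
  rw [h2]
  apply Complex.ext
  all_goals (simp <;> ring)

/-! ### Endpoints and germs of geodesic rays -/

theorem GeodesicRay.isEndpoint_endpoint (R : GeodesicRay) : R.IsEndpoint R.endpoint :=
  R.existsUnique_isEndpoint.exists.choose_spec

theorem SU11.endpoint_ray (g : SU11) : g.ray.endpoint = g.act 1 :=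
  (g.isEndpoint_ray_iff _).1 g.ray.isEndpoint_endpoint

theorem GeodesicRay.endpoint_germ (R : GeodesicRay) : R.germ.endpoint = R.endpoint := rfl

theorem GeodesicGerm.norm_endpoint (δ : GeodesicGerm) : ‖δ.endpoint‖ = 1 := by
  obtain ⟨R, rfl⟩ := Quotient.exists_rep δ
  exact R.isEndpoint_endpoint.1

/-- With the common endpoint at infinity both rays are vertical, and they share a point, so they
have the same real part. -/
theorem SU11.rayRe_eq {g h : SU11} (h1 : g.act 1 = h.act 1) {s t : ℝ} (hs : s ∈ Ico (0 : ℝ) 1)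
    (ht : t ∈ Ico (0 : ℝ) 1) (hst : g.act s = h.act t) : g.rayRe = h.rayRe := by
  have e1 := congrArg re (g.cayley_act rfl hs.1 hs.2)
  have e2 := congrArg re (h.cayley_act rfl ht.1 ht.2)
  rw [h1, hst, e2] at e1
  simp only [add_re, ofReal_re, mul_re, I_re, I_im, ofReal_im] at e1
  linarith

theorem norm_ofReal_le_one {t : ℝ} (ht : t ∈ Ico (0 : ℝ) 1) : ‖(t : ℂ)‖ ≤ 1 := by
  rw [norm_real, Real.norm_of_nonneg ht.1]; exact ht.2.le

theorem SU11.exists_lt_norm_act (g : SU11) {r : ℝ} (hr : r < 1) :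
    ∃ t ∈ Ico (0 : ℝ) 1, r < ‖g.act t‖ := by
  by_contra! h
  have hsub : g.rayCarrier ⊆ Metric.closedBall 0 r := by
    rintro _ ⟨t, ht, rfl⟩
    simpa using h t ht
  have := closure_minimal hsub Metric.isClosed_closedBall
    ((g.isEndpoint_ray_iff _).2 rfl).2
  rw [mem_closedBall_zero_iff, g.norm_act_one] at this
  linarith

/-- Rays of equal germ share their endpoint and all points outside a smaller disc. So the chosen
rays R_z, which need not vary smoothly, may be replaced by smooth representatives when computing the
real part. -/
theorem SU11.rayRe_mul_eq_of_sameGerm {g h : SU11} (hgh : g.ray.SameGerm h.ray) (k : SU11) :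
    (k.mul g).rayRe = (k.mul h).rayRe := by
  have h1 : g.act 1 = h.act 1 := by
    rw [← endpoint_ray, ← endpoint_ray, GeodesicRay.endpoint_eq_of_sameGerm _ _ hgh]
  obtain ⟨r, hr, hsub⟩ := hgh
  obtain ⟨s, hs, hlt⟩ := g.exists_lt_norm_act hr
  have hmem : g.act s ∈ h.rayCarrier := by
    by_contra hn
    have := hsub (Or.inl ⟨⟨s, hs, rfl⟩, hn⟩)
    rw [mem_closedBall_zero_iff] at this
    linarith
  obtain ⟨t, ht, hst⟩ := hmem
  refine rayRe_eq ?_ hs ht ?_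
  · rw [mul_act _ _ (by simp), mul_act _ _ (by simp), h1]
  · rw [mul_act _ _ (norm_ofReal_le_one hs), mul_act _ _ (norm_ofReal_le_one ht)]
    exact congrArg _ hst.symm

/-! ### Gauges in charts, and the estimate near an interior point -/

section

variable {S : Type*} [TopologicalSpace S] [ChartedSpace ClosedHalfPlane S]
  {A : OneForm S} {e : OpenPartialHomeomorph S ClosedHalfPlane}

theorem exists_isGauge (hA : A.IsSmooth) (hflat : A.IsFlat) (he : e ∈ atlas ClosedHalfPlane S)
    {p : ℂ} (hp : p ∈ (e.extend modelR).target) :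
    ∃ r > 0, Metric.closedBall p r ∩ {z | 0 ≤ z.im} ⊆ (e.extend modelR).target ∧
      ∃ γ : ℂ → SU11, IsGauge (A.inChart e) γ (Metric.closedBall p r ∩ {z | 0 ≤ z.im}) := by
  obtain ⟨r, hr, hsub, γ, h1, h2⟩ := exists_gauge (hA e he) (fun x hx => target_mem_nhdsWithin hx)
    hp (target_subset_halfPlane e hp) (fun x hx => by
      have := hflat e he x hx
      rwa [OneForm.curvatureInChart, range_modelR] at this)
  exact ⟨r, hr, hsub, γ, h1, h2⟩

variable [RiemannSurfaceWithBoundary S]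

/-- In a gauge, solutions of the inhomogeneous Cauchy-Riemann equation become holomorphic. -/
theorem IsSolution.hasFDerivWithinAt_gauged {R : modelR.boundary S → GeodesicRay} {u : S → ℂ}
    (hu : IsSolution A R u) (he : e ∈ atlas ClosedHalfPlane S) {Q : Set ℂ} {γ : ℂ → SU11}
    (hQ : Q ⊆ (e.extend modelR).target) (hγ : IsGauge (A.inChart e) γ Q) {x : ℂ} (hx : x ∈ Q) :
    ∃ D : ℂ →L[ℝ] ℂ, (∀ v, D (I * v) = I * D v) ∧
      HasFDerivWithinAt (fun y => (γ y).inv.act (u ((e.extend modelR).symm y))) D Q x := by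
  obtain ⟨D, hD, hDI⟩ := hu.hasFDerivWithinAt_inChart he (hQ hx)
  obtain ⟨D', hD', h⟩ := SU11.hasFDerivWithinAt_inv_act
    (u := u ∘ (e.extend modelR).symm) (hu.norm_lt_one _).le
    (hD.mono (hQ.trans (target_subset_halfPlane e))) (hγ.hasFDerivWithinAt x hx)
  refine ⟨D', fun v => ?_, h⟩
  have h2 := hDI v
  simp only [Function.comp_apply] at hD'
  rw [hD', hD', h2, mul_div_assoc]

theorem IsSolution.continuousOn_gauged {R : modelR.boundary S → GeodesicRay} {u : S → ℂ}
    (hu : IsSolution A R u) (he : e ∈ atlas ClosedHalfPlane S) {Q : Set ℂ} {γ : ℂ → SU11}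
    (hQ : Q ⊆ (e.extend modelR).target) (hγ : IsGauge (A.inChart e) γ Q) :
    ContinuousOn (fun y => (γ y).inv.act (u ((e.extend modelR).symm y))) Q := fun x hx => by
  obtain ⟨D, -, h⟩ := hu.hasFDerivWithinAt_gauged he hQ hγ hx
  exact h.continuousWithinAt

theorem IsSolution.differentiableOn_gauged {R : modelR.boundary S → GeodesicRay} {u : S → ℂ}
    (hu : IsSolution A R u) (he : e ∈ atlas ClosedHalfPlane S) {Q : Set ℂ} {γ : ℂ → SU11}
    (hQ : Q ⊆ (e.extend modelR).target) (hγ : IsGauge (A.inChart e) γ Q) {O : Set ℂ}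
    (hO : IsOpen O) (hOQ : O ⊆ Q) :
    DifferentiableOn ℂ (fun y => (γ y).inv.act (u ((e.extend modelR).symm y))) O := fun x hx => by
  obtain ⟨D, hD, h⟩ := hu.hasFDerivWithinAt_gauged he hQ hγ (hOQ hx)
  exact (differentiableAt_of_map_mul_I
    (h.hasFDerivAt (mem_of_superset (hO.mem_nhds hx) hOQ)) hD).differentiableWithinAt

/-- A ball of radius at most Im p about p avoids the boundary, so the Schwarz–Pick estimate on discs
suffices. The form matches `exists_boundary_estimate`, so that later arguments need no case
distinction. -/
theorem exists_interior_estimate (he : e ∈ atlas ClosedHalfPlane S) {p : ℂ} (hp : 0 < p.im)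
    {r₀ : ℝ} (hr₀ : 0 < r₀) {γ : ℂ → SU11}
    (hQ : Metric.closedBall p r₀ ∩ {z | 0 ≤ z.im} ⊆ (e.extend modelR).target)
    (hγ : IsGauge (A.inChart e) γ (Metric.closedBall p r₀ ∩ {z | 0 ≤ z.im}))
    (R : modelR.boundary S → GeodesicRay) :
    ∃ r > 0, r ≤ r₀ ∧ ∀ u : ℕ → S → ℂ, (∀ k, IsSolution A R (u k)) →
      ∀ q : ℕ → ℂ, (∀ k, q k ∈ Metric.ball p r ∩ {z | 0 ≤ z.im}) →
      Tendsto (fun k => 1 - ‖(γ (q k)).inv.act (u k ((e.extend modelR).symm (q k)))‖ ^ 2) atTop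
        (𝓝 0) →
      ∀ ε > 0, ∀ᶠ k in atTop, ∀ x ∈ Metric.ball p r ∩ {z | 0 ≤ z.im},
        ‖(γ x).inv.act (u k ((e.extend modelR).symm x)) -
          (γ (q k)).inv.act (u k ((e.extend modelR).symm (q k)))‖ < ε := by
  have hr : 0 < min r₀ p.im := lt_min hr₀ hp
  refine ⟨min r₀ p.im / 4, by positivity, by linarith [min_le_left r₀ p.im],
    fun u hu q hq hlim ε hε => ?_⟩
  have hsub : Metric.ball p (min r₀ p.im) ⊆ Metric.closedBall p r₀ ∩ {z | 0 ≤ z.im} := by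
    intro z hz
    have hz' := Metric.mem_ball.1 hz
    refine ⟨Metric.mem_closedBall.2 (hz'.le.trans (min_le_left _ _)), ?_⟩
    have h1 := (abs_le.1 (abs_im_le_norm (z - p))).1
    rw [dist_eq_norm] at hz'
    rw [sub_im] at h1
    have h2 := min_le_right r₀ p.im
    show 0 ≤ z.im
    linarith
  filter_upwards [disc_eventually_close (fun k => (hu k).differentiableOn_gauged he hQ hγ
    Metric.isOpen_ball hsub) (fun k z => SU11.norm_act_lt_one _ ((hu k).norm_lt_one _))
    (fun k => (hq k).1) hlim hε] with k hk x hx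
  exact hk x hx.1

end

/-! ### The estimate near a boundary point -/

section

variable {S : Type*} [TopologicalSpace S] [ChartedSpace ClosedHalfPlane S]
  {A : OneForm S} {e : OpenPartialHomeomorph S ClosedHalfPlane}

theorem ofReal_mem_closedBall_inter {s r x : ℝ} (hx : x ∈ Icc (s - r) (s + r)) :
    (x : ℂ) ∈ Metric.closedBall (s : ℂ) r ∩ {z | 0 ≤ z.im} := by
  refine ⟨?_, by simp⟩
  rw [Metric.mem_closedBall, dist_eq_norm, ← ofReal_sub, norm_real, Real.norm_eq_abs, abs_le]
  constructor <;> linarith [hx.1, hx.2]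

theorem hasDerivAt_endpoint {δ : modelR.boundary S → GeodesicGerm}
    (hcov : IsCovariantlyConstant A fun z => (δ z).endpoint) (he : e ∈ atlas ClosedHalfPlane S)
    {Λ : ℝ → ℂ} (hΛ : ∀ x : ℝ, ∀ h : (e.extend modelR).symm x ∈ modelR.boundary S,
      Λ x = (δ ⟨_, h⟩).endpoint) {x : ℝ} (hx : (x : ℂ) ∈ (e.extend modelR).target) :
    HasDerivAt Λ (vectorField (A.inChart e x 1) (Λ x)) x := by
  obtain ⟨l, hl, hd⟩ := hcov e he x hx
  have heq : Λ =ᶠ[𝓝 x] l := by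
    filter_upwards [hl] with y ⟨h, hy⟩
    rw [hΛ y h, hy]
  rw [heq.self_of_nhds]
  exact hd.congr_of_eventuallyEq heq

/-- In a gauge, the points at infinity of a covariantly constant family of germs are constant. -/
theorem exists_gauged_endpoint {δ : modelR.boundary S → GeodesicGerm}
    (hcov : IsCovariantlyConstant A fun z => (δ z).endpoint) (he : e ∈ atlas ClosedHalfPlane S)
    {s r : ℝ} (hr : 0 < r) {γ : ℂ → SU11}
    (hQ : Metric.closedBall (s : ℂ) r ∩ {z | 0 ≤ z.im} ⊆ (e.extend modelR).target)
    (hγ : IsGauge (A.inChart e) γ (Metric.closedBall (s : ℂ) r ∩ {z | 0 ≤ z.im})) :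
    ∃ l : ℂ, ‖l‖ = 1 ∧ ∀ x ∈ Icc (s - r) (s + r),
      ∀ h : (e.extend modelR).symm (x : ℝ) ∈ modelR.boundary S,
        (γ x).inv.act (δ ⟨_, h⟩).endpoint = l := by
  classical
  obtain ⟨Λ, hΛ1, hΛ⟩ : ∃ Λ : ℝ → ℂ, (∀ x, ‖Λ x‖ = 1) ∧
      ∀ x : ℝ, ∀ h : (e.extend modelR).symm x ∈ modelR.boundary S,
        Λ x = (δ ⟨_, h⟩).endpoint := by
    -- The default 1 keeps Λ on the unit circle everywhere.
    refine ⟨fun x => if h : (e.extend modelR).symm x ∈ modelR.boundary S then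
      (δ ⟨_, h⟩).endpoint else 1, fun x => ?_, fun x h => dif_pos h⟩
    dsimp only
    split_ifs
    · exact GeodesicGerm.norm_endpoint _
    · simp
  have hder : ∀ x ∈ Icc (s - r) (s + r),
      HasFDerivWithinAt (fun y : ℝ => (γ y).inv.act (Λ y)) (0 : ℝ →L[ℝ] ℂ)
        (Icc (s - r) (s + r)) x := by
    intro x hx
    have hxQ := ofReal_mem_closedBall_inter hx
    have h1 := hasDerivAt_endpoint hcov he hΛ (hQ hxQ)
    have h2 : HasFDerivWithinAt (fun y : ℝ => ((γ y).a, (γ y).b))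
        ((ContinuousLinearMap.apply ℝ (ℂ × ℂ) ((γ x).a, (γ x).b)).comp
          (su11.rep.comp ((A.inChart e x).comp ofRealCLM))) (Icc (s - r) (s + r)) x :=
      (hγ.hasFDerivWithinAt x hxQ).comp x (ofRealCLM.hasFDerivAt.hasFDerivWithinAt)
        (fun y hy => ofReal_mem_closedBall_inter hy)
    obtain ⟨D, hD, h⟩ := SU11.hasFDerivWithinAt_inv_act (g := fun y : ℝ => γ y) (hΛ1 x).le
      h1.hasFDerivAt.hasFDerivWithinAt h2
    -- Covariant constancy says that Λ' is exactly the vector field, so the numerator in the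
    -- derivative formula vanishes.
    have : D = 0 := by
      ext
      rw [hD]
      simp
    exact this ▸ h
  refine ⟨(γ s).inv.act (Λ s), SU11.norm_act_eq_one _ (hΛ1 s), fun x hx h => ?_⟩
  have := (convex_Icc (s - r) (s + r)).norm_image_sub_le_of_norm_hasFDerivWithin_le (C := 0) hder
    (fun x _ => by simp) (show s ∈ Icc (s - r) (s + r) by constructor <;> linarith) hx
  rw [zero_mul] at this
  rw [← hΛ x h]
  exact sub_eq_zero.1 (norm_le_zero_iff.1 this)

theorem contDiffOn_rayRe_inv_mul {F : Type*} [NormedAddCommGroup F] [NormedSpace ℝ F]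
    {g h : F → SU11} {s : Set F} (hga : ContDiffOn ℝ ∞ (fun x => (g x).a) s)
    (hgb : ContDiffOn ℝ ∞ (fun x => (g x).b) s) (hha : ContDiffOn ℝ ∞ (fun x => (h x).a) s)
    (hhb : ContDiffOn ℝ ∞ (fun x => (h x).b) s) :
    ContDiffOn ℝ ∞ (fun x => ((g x).inv.mul (h x)).rayRe) s := by
  have hconj : ∀ {f : F → ℂ}, ContDiffOn ℝ ∞ f s → ContDiffOn ℝ ∞ (fun x => conj (f x)) s :=
    fun hf => conjCLE.contDiff.comp_contDiffOn hf
  have hga' := hconj hga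
  have hb := (hga'.mul hhb).add (hgb.neg.mul (hconj hha))
  have ha := (hga'.mul hha).add (hgb.neg.mul (hconj hhb))
  exact contDiffOn_const.mul (imCLM.contDiff.comp_contDiffOn (hb.mul (hconj ha)))

variable [RiemannSurfaceWithBoundary S]

/-- In the gauge all boundary rays end at the same l, and in the half-plane picture their real parts
form a smooth function c. So `halfDisc_eventually_close` applies, and both values are compared with
l. -/
theorem exists_boundary_estimate {δ : modelR.boundary S → GeodesicGerm} (hδ : IsSmoothGermFamily δ)
    (hcov : IsCovariantlyConstant A fun z => (δ z).endpoint)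
    {R : modelR.boundary S → GeodesicRay} (hR : ∀ z, (R z).germ = δ z)
    (he : e ∈ atlas ClosedHalfPlane S) {s r₀ : ℝ} (hr₀ : 0 < r₀) {γ : ℂ → SU11}
    (hQ : Metric.closedBall (s : ℂ) r₀ ∩ {z | 0 ≤ z.im} ⊆ (e.extend modelR).target)
    (hγ : IsGauge (A.inChart e) γ (Metric.closedBall (s : ℂ) r₀ ∩ {z | 0 ≤ z.im})) :
    ∃ r > 0, r ≤ r₀ ∧ ∀ u : ℕ → S → ℂ, (∀ k, IsSolution A R (u k)) →
      ∀ q : ℕ → ℂ, (∀ k, q k ∈ Metric.ball (s : ℂ) r ∩ {z | 0 ≤ z.im}) →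
      Tendsto (fun k => 1 - ‖(γ (q k)).inv.act (u k ((e.extend modelR).symm (q k)))‖ ^ 2) atTop
        (𝓝 0) →
      ∀ ε > 0, ∀ᶠ k in atTop, ∀ x ∈ Metric.ball (s : ℂ) r ∩ {z | 0 ≤ z.im},
        ‖(γ x).inv.act (u k ((e.extend modelR).symm x)) -
          (γ (q k)).inv.act (u k ((e.extend modelR).symm (q k)))‖ < ε := by
  have hs : (s : ℂ) ∈ (e.extend modelR).target := hQ ⟨Metric.mem_closedBall_self hr₀.le, by simp⟩
  obtain ⟨U, hU, g, hga, hgb, hgδ⟩ := hδ e he s hs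
  obtain ⟨r₁, hr₁, hU₁⟩ := Metric.nhds_basis_closedBall.mem_iff.1 hU
  set r := min r₀ r₁ with hrdef
  have hr : 0 < r := lt_min hr₀ hr₁
  have hJU : Icc (s - r) (s + r) ⊆ U := by
    rw [← Real.closedBall_eq_Icc]
    exact (Metric.closedBall_subset_closedBall (min_le_right _ _)).trans hU₁
  have hQr : Metric.closedBall (s : ℂ) r ∩ {z | 0 ≤ z.im} ⊆
      Metric.closedBall (s : ℂ) r₀ ∩ {z | 0 ≤ z.im} :=
    inter_subset_inter_left _ (Metric.closedBall_subset_closedBall (min_le_left _ _))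
  replace hQ := hQr.trans hQ
  replace hγ := hγ.mono hQr
  obtain ⟨l, hl, hlJ⟩ := exists_gauged_endpoint hcov he hr hQ hγ
  have hγJ : ContDiffOn ℝ ∞ (fun x : ℝ => ((γ x).a, (γ x).b)) (Icc (s - r) (s + r)) :=
    hγ.contDiffOn.comp ofRealCLM.contDiff.contDiffOn fun y hy => ofReal_mem_closedBall_inter hy
  -- This is the function c: the real parts of the smooth representatives g, moved by γ⁻¹.
  have hc := contDiffOn_rayRe_inv_mul hγJ.fst hγJ.snd (hga.mono hJU) (hgb.mono hJU)
  have huniq : UniqueDiffOn ℝ (Icc (s - r) (s + r)) := uniqueDiffOn_Icc (by linarith)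
  have hc' := hc.derivWithin huniq (m := ∞) (by simp)
  have hc'' := hc'.derivWithin huniq (m := ∞) (by simp)
  refine ⟨r / 8, by positivity, by linarith [min_le_left r₀ r₁], fun u hu q hq hlim ε hε => ?_⟩
  have hclose := halfDisc_eventually_close hr
    (fun x hx => (hc.differentiableOn (by simp) x hx).hasDerivWithinAt)
    (fun x hx => (hc'.differentiableOn (by simp) x hx).hasDerivWithinAt) hc''.continuousOn
    (fun k => ((hu k).continuousOn_gauged he hQ hγ).mono
      (inter_subset_inter_left _ Metric.ball_subset_closedBall))
    (fun k => (hu k).differentiableOn_gauged he hQ hγ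
      (Metric.isOpen_ball.inter (isOpen_lt continuous_const continuous_im))
      (inter_subset_inter Metric.ball_subset_closedBall fun z (hz : 0 < z.im) => hz.le))
    (fun k z => SU11.norm_act_lt_one _ ((hu k).norm_lt_one _)) hl
    (fun x hx => by
      have hxJ : x ∈ Icc (s - r) (s + r) := by
        rw [Metric.mem_ball, dist_eq_norm, ← ofReal_sub, norm_real, Real.norm_eq_abs, abs_lt] at hx
        constructor <;> linarith [hx.1, hx.2]
      obtain ⟨hb, hgx⟩ := hgδ x (hJU hxJ)
      obtain ⟨η, hη⟩ := (R ⟨_, hb⟩).exists_eq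
      have hRη : R ⟨_, hb⟩ = η.ray := by
        cases hRx : R ⟨_, hb⟩
        rw [hRx] at hη
        simp only at hη
        subst hη
        rfl
      have hsame : η.ray.SameGerm (g x).ray := by
        have := hR ⟨_, hb⟩
        rw [hgx, hRη] at this
        exact Quotient.exact this
      refine ⟨(γ x).inv.mul η, ?_, SU11.rayRe_mul_eq_of_sameGerm hsame _, fun k => ?_⟩
      · rw [SU11.mul_act _ _ (by simp), ← SU11.endpoint_ray, ← hRη, ← GeodesicRay.endpoint_germ, hR]
        exact hlJ x hxJ hb
      · have := (hu k).boundary ⟨_, hb⟩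
        rw [hRη] at this
        obtain ⟨t, ht, htu⟩ := this
        refine ⟨t, ht, ?_⟩
        simp only at htu ⊢
        rw [SU11.mul_act _ _ (norm_ofReal_le_one ht), htu])
    (fun k => (hq k).1) (fun k => (hq k).2) hlim (half_pos hε)
  filter_upwards [hclose] with k hk x hx
  have h1 := hk x hx.1 hx.2
  have h2 := hk (q k) (hq k).1 (hq k).2
  rw [norm_sub_rev] at h2
  calc _ ≤ _ := norm_sub_le_norm_sub_add_norm_sub _ l _
    _ < ε := by linarith

end

/-! ### Local trivializations adapted to sequences of solutions -/

section

variable {S : Type*} [TopologicalSpace S] [ChartedSpace ClosedHalfPlane S]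
  [RiemannSurfaceWithBoundary S] {A : OneForm S}

theorem inChart_chartAt_self (p : S) (v : ℂ) :
    A.inChart (chartAt ClosedHalfPlane p) ((chartAt ClosedHalfPlane p).extend modelR p) v =
      A p v := by
  have h : ∀ q : S, q = p → ∀ w : ℂ, A q w = A p w := by
    rintro q rfl w; rfl
  refine Eq.trans ?_ (h _ ((chartAt ClosedHalfPlane p).extend_left_inv (I := modelR)
    (mem_chart_source _ p)) v)
  exact congrArg (A _) (mfderivWithin_extend_symm_self p v)

/-- These maps are the local candidates for the limit. The derivative is computed at p, where the
tangent space is read in the very chart that carries the gauge. -/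
theorem contMDiffAt_gauge_act {p : S} {r : ℝ} (hr : 0 < r) {γ : ℂ → SU11}
    (hγ : IsGauge (A.inChart (chartAt ClosedHalfPlane p)) γ
      (Metric.closedBall ((chartAt ClosedHalfPlane p).extend modelR p) r ∩ {z | 0 ≤ z.im}))
    {l : ℂ} (hl : ‖l‖ ≤ 1) :
    ContMDiffAt modelR 𝓘(ℝ, ℂ) ∞
        (fun x => (γ ((chartAt ClosedHalfPlane p).extend modelR x)).act l) p ∧
      ∀ v, surfaceDeriv (fun x => (γ ((chartAt ClosedHalfPlane p).extend modelR x)).act l) p v =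
        vectorField (A p v) ((γ ((chartAt ClosedHalfPlane p).extend modelR p)).act l) := by
  set e := chartAt ClosedHalfPlane p with hedef
  set y := e.extend modelR p with hy
  have hps : p ∈ e.source := mem_chart_source _ p
  have hyt : y ∈ (e.extend modelR).target :=
    (e.extend modelR).map_source (by rwa [OpenPartialHomeomorph.extend_source])
  have hyr : y ∈ range modelR := e.extend_target_subset_range hyt
  have hyQ : y ∈ Metric.closedBall y r ∩ {z | 0 ≤ z.im} :=
    ⟨Metric.mem_closedBall_self hr.le, target_subset_halfPlane e hyt⟩
  have hQn : Metric.closedBall y r ∩ {z | 0 ≤ z.im} ∈ 𝓝[range modelR] y := by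
    rw [range_modelR]
    exact inter_mem (mem_nhdsWithin_of_mem_nhds (Metric.closedBall_mem_nhds _ hr))
      self_mem_nhdsWithin
  have hconj : ∀ {f : ℂ → ℂ} {s : Set ℂ}, ContDiffOn ℝ ∞ f s →
      ContDiffOn ℝ ∞ (fun x => conj (f x)) s := fun hf => conjCLE.contDiff.comp_contDiffOn hf
  have hsmooth : ContDiffOn ℝ ∞ (fun x => (γ x).act l)
      (Metric.closedBall y r ∩ {z | 0 ≤ z.im}) := by
    have ha := hγ.contDiffOn.fst
    have hb := hγ.contDiffOn.snd
    simp only [SU11.act, div_eq_mul_inv]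
    exact ((ha.mul contDiffOn_const).add hb).mul
      ((((hconj hb).mul contDiffOn_const).add (hconj ha)).inv
        fun x _ => (γ x).denom_ne_zero hl)
  have heq : ((fun x => (γ (e.extend modelR x)).act l) ∘ (e.extend modelR).symm) =ᶠ[𝓝[range modelR] y]
      fun x => (γ x).act l := by
    filter_upwards [e.extend_target_mem_nhdsWithin (I := modelR) hps] with x hx
    simp only [Function.comp_apply]
    rw [(e.extend modelR).right_inv hx]
  have hcd : ContMDiffAt modelR 𝓘(ℝ, ℂ) ∞ (fun x => (γ (e.extend modelR x)).act l) p := by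
    refine contMDiffAt_iff.2 ⟨?_, ?_⟩
    · have h1 := (hsmooth y hyQ).continuousWithinAt.mono_of_mem_nhdsWithin hQn
      refine h1.tendsto.comp (tendsto_nhdsWithin_iff.2 ⟨e.continuousAt_extend hps, ?_⟩)
      exact Eventually.of_forall fun x => mem_range_self _
    · exact ((hsmooth y hyQ).mono_of_mem_nhdsWithin hQn).congr_of_eventuallyEq_of_mem heq hyr
  refine ⟨hcd, fun v => ?_⟩
  obtain ⟨D, hD, hder⟩ := SU11.hasFDerivWithinAt_act hl (hγ.hasFDerivWithinAt y hyQ)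
  have h1 := (hder.mono_of_mem_nhdsWithin hQn).congr_of_eventuallyEq heq
    (heq.eq_of_nhdsWithin hyr)
  have h2 : surfaceDeriv (fun x => (γ (e.extend modelR x)).act l) p = D := by
    refine (hcd.mdifferentiableAt (by simp)).mfderiv.trans ?_
    exact h1.fderivWithin (modelR.uniqueDiffOn y hyr)
  rw [h2]
  refine (hD v).trans ?_
  rw [← inChart_chartAt_self p v]

/-- Combines the interior and boundary estimates into one statement about points of S. Compactness
bounds the distortion of the gauge, so that estimates pass between u and g⁻¹u. -/
theorem exists_local_trivialization (hA : A.IsSmooth) (hflat : A.IsFlat)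
    {δ : modelR.boundary S → GeodesicGerm} (hδ : IsSmoothGermFamily δ)
    (hcov : IsCovariantlyConstant A fun z => (δ z).endpoint)
    {R : modelR.boundary S → GeodesicRay} (hR : ∀ z, (R z).germ = δ z) (p : S) :
    ∃ N ∈ 𝓝 p, ∃ g : S → SU11, ∃ M : ℝ, (∀ x ∈ N, (g x).distortion ≤ M) ∧
      (∀ l, ‖l‖ ≤ 1 → ContMDiffAt modelR 𝓘(ℝ, ℂ) ∞ (fun x => (g x).act l) p ∧
        ∀ v, surfaceDeriv (fun x => (g x).act l) p v = vectorField (A p v) ((g p).act l)) ∧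
      ∀ u : ℕ → S → ℂ, (∀ k, IsSolution A R (u k)) → ∀ q : ℕ → S, (∀ k, q k ∈ N) →
        Tendsto (fun k => 1 - ‖u k (q k)‖ ^ 2) atTop (𝓝 0) →
        ∀ ε > 0, ∀ᶠ k in atTop, ∀ x ∈ N,
          ‖(g x).inv.act (u k x) - (g (q k)).inv.act (u k (q k))‖ < ε := by
  set e := chartAt ClosedHalfPlane p with hedef
  have he : e ∈ atlas ClosedHalfPlane S := chart_mem_atlas _ p
  have hps : p ∈ e.source := mem_chart_source _ p
  set y := e.extend modelR p with hy
  have hyt : y ∈ (e.extend modelR).target :=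
    (e.extend modelR).map_source (by rwa [OpenPartialHomeomorph.extend_source])
  obtain ⟨r₀, hr₀, hQ, γ, hγ⟩ := exists_isGauge hA hflat he hyt
  obtain ⟨r, hr, hrr, hest⟩ : ∃ r > 0, r ≤ r₀ ∧ ∀ u : ℕ → S → ℂ, (∀ k, IsSolution A R (u k)) →
      ∀ q : ℕ → ℂ, (∀ k, q k ∈ Metric.ball y r ∩ {z | 0 ≤ z.im}) →
      Tendsto (fun k => 1 - ‖(γ (q k)).inv.act (u k ((e.extend modelR).symm (q k)))‖ ^ 2) atTop
        (𝓝 0) →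
      ∀ ε > 0, ∀ᶠ k in atTop, ∀ x ∈ Metric.ball y r ∩ {z | 0 ≤ z.im},
        ‖(γ x).inv.act (u k ((e.extend modelR).symm x)) -
          (γ (q k)).inv.act (u k ((e.extend modelR).symm (q k)))‖ < ε := by
    rcases (show 0 ≤ y.im from target_subset_halfPlane e hyt).eq_or_lt with h0 | h0
    · have hyre : y = (y.re : ℂ) := Complex.ext rfl (by simp [h0])
      rw [hyre] at hQ hγ ⊢
      exact exists_boundary_estimate hδ hcov hR he hr₀ hQ hγ
    · exact exists_interior_estimate he h0 hr₀ hQ hγ R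
  obtain ⟨M, hM⟩ : ∃ M : ℝ, ∀ x ∈ Metric.closedBall y r₀ ∩ {z | 0 ≤ z.im},
      (γ x).distortion ≤ M := by
    have hc : ContinuousOn (fun x => (γ x).distortion)
        (Metric.closedBall y r₀ ∩ {z | 0 ≤ z.im}) :=
      ((hγ.contDiffOn.continuousOn.fst.norm).add hγ.contDiffOn.continuousOn.snd.norm).pow 2
    obtain ⟨M, hM⟩ := ((isCompact_closedBall y r₀).inter_right
      (isClosed_le continuous_const continuous_im)).bddAbove_image hc
    exact ⟨M, fun x hx => hM ⟨x, hx, rfl⟩⟩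
  have hNQ : ∀ x ∈ e.source ∩ e.extend modelR ⁻¹' Metric.ball y r,
      e.extend modelR x ∈ Metric.ball y r ∩ {z | 0 ≤ z.im} := fun x hx =>
    ⟨hx.2, target_subset_halfPlane e
      ((e.extend modelR).map_source (by rw [OpenPartialHomeomorph.extend_source]; exact hx.1))⟩
  have hNM : ∀ x ∈ e.source ∩ e.extend modelR ⁻¹' Metric.ball y r,
      (γ (e.extend modelR x)).distortion ≤ M := fun x hx =>
    hM _ ⟨Metric.ball_subset_closedBall (Metric.ball_subset_ball hrr (hNQ x hx).1), (hNQ x hx).2⟩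
  refine ⟨e.source ∩ e.extend modelR ⁻¹' Metric.ball y r,
    inter_mem (e.open_source.mem_nhds hps)
      ((e.continuousAt_extend hps).preimage_mem_nhds (Metric.ball_mem_nhds _ hr)),
    fun x => γ (e.extend modelR x), M, hNM, fun l hl => contMDiffAt_gauge_act hr₀ hγ hl,
    fun u hu q hq hlim ε hε => ?_⟩
  have hinv : ∀ x ∈ e.source, (e.extend modelR).symm (e.extend modelR x) = x := fun x hx =>
    e.extend_left_inv hx
  have hlim' : Tendsto (fun k => 1 - ‖(γ (e.extend modelR (q k))).inv.act
      (u k ((e.extend modelR).symm (e.extend modelR (q k))))‖ ^ 2) atTop (𝓝 0) := by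
    have h0 := hlim.const_mul M
    rw [mul_zero] at h0
    -- Applying the gauge multiplies 1 - |u|² by at most its distortion.
    refine squeeze_zero (fun k => ?_) (fun k => ?_) h0
    · have := (γ (e.extend modelR (q k))).inv.norm_act_le_one ((hu k).norm_lt_one
        ((e.extend modelR).symm (e.extend modelR (q k)))).le
      have := pow_le_one₀ (norm_nonneg _) this (n := 2)
      linarith
    · rw [hinv _ (hq k).1]
      have h1 := (hu k).norm_lt_one (q k)
      refine (SU11.one_sub_normSq_act_le _ h1.le).trans ?_
      rw [SU11.distortion_inv]
      have := pow_le_one₀ (norm_nonneg _) h1.le (n := 2)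
      exact mul_le_mul_of_nonneg_right (hNM _ (hq k)) (by linarith)
  filter_upwards [hest u hu _ (fun k => hNQ _ (hq k)) hlim' ε hε] with k hk x hx
  have := hk _ (hNQ x hx)
  rwa [hinv _ hx.1, hinv _ (hq k).1] at this

end

/-! ### Local and global convergence -/

theorem SU11.distortion_nonneg (g : SU11) : 0 ≤ g.distortion := sq_nonneg _

theorem one_sub_norm_sq_nonneg {w : ℂ} (hw : ‖w‖ ≤ 1) : 0 ≤ 1 - ‖w‖ ^ 2 := by
  nlinarith [norm_nonneg w]

theorem infDist_circleAtInfinity {w : ℂ} (hw : ‖w‖ ≤ 1) :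
    Metric.infDist w circleAtInfinity = 1 - ‖w‖ := by
  have hne : circleAtInfinity.Nonempty := ⟨1, by simp⟩
  apply le_antisymm
  · rcases eq_or_ne w 0 with rfl | h
    · exact (Metric.infDist_le_dist_of_mem (show (1 : ℂ) ∈ circleAtInfinity by simp)).trans
        (by simp)
    · have hpos : 0 < ‖w‖ := norm_pos_iff.2 h
      refine (Metric.infDist_le_dist_of_mem (show w / ‖w‖ ∈ circleAtInfinity by
        simp [hpos.ne'])).trans ?_
      have : w - w / ‖w‖ = w * ((1 - ‖w‖⁻¹ : ℝ) : ℂ) := by push_cast; ring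
      rw [dist_eq_norm, this, norm_mul, norm_real, Real.norm_eq_abs, abs_of_nonpos, mul_neg,
        mul_sub, mul_inv_cancel₀ hpos.ne', mul_one, neg_sub]
      rw [sub_nonpos]
      exact (one_le_inv₀ hpos).2 hw
  · refine (Metric.le_infDist hne).2 fun y hy => ?_
    have h1 : ‖y‖ = 1 := by simpa using hy
    have := norm_sub_norm_le y w
    rw [dist_eq_norm, norm_sub_rev]
    linarith

/-! ### Spreading convergence over the connected surface -/

section

variable {S : Type*} [TopologicalSpace S] [ChartedSpace ClosedHalfPlane S]
  [RiemannSurfaceWithBoundary S] {A : OneForm S}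

/-- Since g⁻¹u_k becomes constant on N in the limit, one sequence of points approaching the circle
takes all of N with it, and convergence to l at one point y gives uniform convergence to
g(x)g(y)⁻¹l. -/
theorem exists_local_convergence (hA : A.IsSmooth) (hflat : A.IsFlat)
    {δ : modelR.boundary S → GeodesicGerm} (hδ : IsSmoothGermFamily δ)
    (hcov : IsCovariantlyConstant A fun z => (δ z).endpoint)
    {R : modelR.boundary S → GeodesicRay} (hR : ∀ z, (R z).germ = δ z) (p : S) :
    ∃ N ∈ 𝓝 p,
      (∀ u : ℕ → S → ℂ, (∀ k, IsSolution A R (u k)) → ∀ q : ℕ → S, (∀ᶠ k in atTop, q k ∈ N) →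
        Tendsto (fun k => 1 - ‖u k (q k)‖ ^ 2) atTop (𝓝 0) →
        TendstoUniformlyOn (fun k x => 1 - ‖u k x‖ ^ 2) (fun _ => 0) atTop N) ∧
      ∀ u : ℕ → S → ℂ, (∀ k, IsSolution A R (u k)) → ∀ y ∈ N, ∀ l : ℂ, ‖l‖ = 1 →
        Tendsto (fun k => u k y) atTop (𝓝 l) →
        ∃ f : S → ℂ, TendstoUniformlyOn u f atTop N ∧ ContMDiffAt modelR 𝓘(ℝ, ℂ) ∞ f p ∧
          ∀ v, surfaceDeriv f p v = vectorField (A p v) (f p) := by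
  obtain ⟨N, hN, g, M, hM, hg, hconv⟩ := exists_local_trivialization hA hflat hδ hcov hR p
  have hM0 : 0 ≤ M := (g p).distortion_nonneg.trans (hM p (mem_of_mem_nhds hN))
  refine ⟨N, hN, fun u hu q hq hlim => ?_, fun u hu y hy l hl hlim => ?_⟩
  · classical
    -- The finitely many points outside N are replaced by p, which does not affect limits.
    set q' : ℕ → S := fun k => if q k ∈ N then q k else p with hq'
    have hq'N : ∀ k, q' k ∈ N := fun k => by
      simp only [hq']; split_ifs with h
      exacts [h, mem_of_mem_nhds hN]
    have hlim' : Tendsto (fun k => 1 - ‖u k (q' k)‖ ^ 2) atTop (𝓝 0) := by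
      refine hlim.congr' ?_
      filter_upwards [hq] with k hk
      simp only [hq', if_pos hk]
    rw [Metric.tendstoUniformlyOn_iff]
    intro ε hε
    have h0 := hlim'.const_mul (M * M)
    rw [mul_zero] at h0
    -- For a and b in [0, 1], b² - a² is at most 2 max(b - a, 0); undoing the gauge costs a further
    -- factor M, so this part contributes at most ε/2.
    have hε' : 0 < ε / (4 * (M + 1)) := by positivity
    filter_upwards [hconv u hu q' hq'N hlim' _ hε', h0.eventually_lt_const (half_pos hε)]
      with k hk hk0 x hx
    have hux := (hu k).norm_lt_one x
    have huq := (hu k).norm_lt_one (q' k)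
    set a := ‖(g x).inv.act (u k x)‖
    set b := ‖(g (q' k)).inv.act (u k (q' k))‖
    have ha1 : a ≤ 1 := (g x).inv.norm_act_le_one hux.le
    have hb1 : b ≤ 1 := (g (q' k)).inv.norm_act_le_one huq.le
    have ha0 : 0 ≤ a := norm_nonneg _
    have hb0 : 0 ≤ b := norm_nonneg _
    have hba : b - a ≤ ε / (4 * (M + 1)) := by
      have := norm_sub_norm_le ((g (q' k)).inv.act (u k (q' k))) ((g x).inv.act (u k x))
      rw [norm_sub_rev] at this
      exact this.trans (hk x hx).le
    have h1 : 1 - ‖u k x‖ ^ 2 ≤ M * (1 - a ^ 2) := by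
      have := (g x).one_sub_normSq_act_le ((g x).inv.norm_act_le_one hux.le)
      rw [(g x).act_inv_act hux.le] at this
      exact this.trans (mul_le_mul_of_nonneg_right (hM x hx) (one_sub_norm_sq_nonneg ha1))
    have h2 : 1 - b ^ 2 ≤ M * (1 - ‖u k (q' k)‖ ^ 2) := by
      have := (g (q' k)).inv.one_sub_normSq_act_le huq.le
      rw [SU11.distortion_inv] at this
      exact this.trans (mul_le_mul_of_nonneg_right (hM _ (hq'N k)) (one_sub_norm_sq_nonneg huq.le))
    have h3 : 1 - a ^ 2 ≤ M * (1 - ‖u k (q' k)‖ ^ 2) + 2 * (ε / (4 * (M + 1))) := by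
      nlinarith
    have h4 : M * (2 * (ε / (4 * (M + 1)))) ≤ ε / 2 := by
      have : M * (2 * (ε / (4 * (M + 1)))) = ε / 2 * (M / (M + 1)) := by field_simp; ring
      rw [this]
      exact mul_le_of_le_one_right (by positivity) (by rw [div_le_one (by positivity)]; linarith)
    rw [dist_zero_left, Real.norm_of_nonneg (one_sub_norm_sq_nonneg hux.le)]
    calc 1 - ‖u k x‖ ^ 2 ≤ M * (1 - a ^ 2) := h1
      _ ≤ M * (M * (1 - ‖u k (q' k)‖ ^ 2) + 2 * (ε / (4 * (M + 1)))) :=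
        mul_le_mul_of_nonneg_left h3 hM0
      _ = M * M * (1 - ‖u k (q' k)‖ ^ 2) + M * (2 * (ε / (4 * (M + 1)))) := by ring
      _ < ε := by linarith
  · set c := (g y).inv.act l with hc
    have hc1 : ‖c‖ = 1 := (g y).inv.norm_act_eq_one hl
    refine ⟨fun x => (g x).act c, ?_, hg c hc1.le⟩
    have hlim0 : Tendsto (fun k => 1 - ‖u k y‖ ^ 2) atTop (𝓝 0) := by
      have := (hlim.norm.pow 2).const_sub 1
      rwa [hl, one_pow, sub_self] at this
    rw [Metric.tendstoUniformlyOn_iff]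
    intro ε hε
    have hε' : 0 < ε / (2 * (M + 1)) := by positivity
    have hy0 := (tendsto_iff_norm_sub_tendsto_zero.1 hlim).const_mul M
    rw [mul_zero] at hy0
    filter_upwards [hconv u hu (fun _ => y) (fun _ => hy) hlim0 _ hε',
      hy0.eventually_lt_const hε'] with k hk hk0 x hx
    have hux := (hu k).norm_lt_one x
    have h1 : ‖(g y).inv.act (u k y) - c‖ < ε / (2 * (M + 1)) := by
      have := (g y).inv.norm_act_sub_act_le ((hu k).norm_lt_one y).le hl.le
      rw [SU11.distortion_inv] at this
      exact (this.trans (mul_le_mul_of_nonneg_right (hM y hy) (norm_nonneg _))).trans_lt hk0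
    have h2 : ‖(g x).inv.act (u k x) - c‖ < ε / (M + 1) := by
      calc _ ≤ _ := norm_sub_le_norm_sub_add_norm_sub _ ((g y).inv.act (u k y)) _
        _ < ε / (2 * (M + 1)) + ε / (2 * (M + 1)) := add_lt_add (hk x hx) h1
        _ = ε / (M + 1) := by field_simp; ring
    have h3 := (g x).norm_act_sub_act_le ((g x).inv.norm_act_le_one hux.le) hc1.le
    rw [(g x).act_inv_act hux.le] at h3
    rw [dist_eq_norm, norm_sub_rev]
    calc _ ≤ _ := h3
      _ ≤ M * ‖(g x).inv.act (u k x) - c‖ :=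
        mul_le_mul_of_nonneg_right (hM x hx) (norm_nonneg _)
      _ ≤ (M + 1) * ‖(g x).inv.act (u k x) - c‖ := by gcongr; linarith
      _ < (M + 1) * (ε / (M + 1)) := by gcongr
      _ = ε := by field_simp

/-- The set of points where u_k approaches the circle is open and closed by the local statement, and
it contains the limit p of the q_k. -/
theorem tendsto_one_sub_norm_sq (hA : A.IsSmooth) (hflat : A.IsFlat)
    {δ : modelR.boundary S → GeodesicGerm} (hδ : IsSmoothGermFamily δ)
    (hcov : IsCovariantlyConstant A fun z => (δ z).endpoint)
    {R : modelR.boundary S → GeodesicRay} (hR : ∀ z, (R z).germ = δ z)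
    {u : ℕ → S → ℂ} (hu : ∀ k, IsSolution A R (u k)) {q : ℕ → S} {p : S}
    (hq : Tendsto q atTop (𝓝 p)) (hlim : Tendsto (fun k => 1 - ‖u k (q k)‖ ^ 2) atTop (𝓝 0))
    (x : S) : Tendsto (fun k => 1 - ‖u k x‖ ^ 2) atTop (𝓝 0) := by
  have hconn : ConnectedSpace S := RiemannSurfaceWithBoundary.connected
  choose N hN hN1 _ using exists_local_convergence hA hflat hδ hcov hR
  have hZ : IsClopen {x : S | Tendsto (fun k => 1 - ‖u k x‖ ^ 2) atTop (𝓝 0)} := by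
    have key : ∀ x : S, ∀ y ∈ N x, Tendsto (fun k => 1 - ‖u k y‖ ^ 2) atTop (𝓝 0) →
        ∀ y' ∈ N x, Tendsto (fun k => 1 - ‖u k y'‖ ^ 2) atTop (𝓝 0) := fun x y hy hlim y' hy' =>
      (hN1 x u hu (fun _ => y) (Eventually.of_forall fun _ => hy) hlim).tendsto_at hy'
    constructor
    · refine isClosed_of_closure_subset fun x hx => ?_
      obtain ⟨y, hyN, hy⟩ := mem_closure_iff_nhds.1 hx _ (hN x)
      exact key x y hyN hy x (mem_of_mem_nhds (hN x))
    · exact isOpen_iff_mem_nhds.2 fun x hx =>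
        mem_of_superset (hN x) (key x x (mem_of_mem_nhds (hN x)) hx)
  have hp := (hN1 p u hu q (hq.eventually (hN p)) hlim).tendsto_at (mem_of_mem_nhds (hN p))
  exact (hZ.eq_univ ⟨p, hp⟩).symm.subset (mem_univ x)

/-- The set of points where u_k converges is open and closed, so convergence at one point spreads to
S. The pointwise limit agrees locally with the flat sections from `exists_local_convergence` and
inherits their properties. -/
theorem exists_limit (hA : A.IsSmooth) (hflat : A.IsFlat)
    {δ : modelR.boundary S → GeodesicGerm} (hδ : IsSmoothGermFamily δ)
    (hcov : IsCovariantlyConstant A fun z => (δ z).endpoint)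
    {R : modelR.boundary S → GeodesicRay} (hR : ∀ z, (R z).germ = δ z)
    {u : ℕ → S → ℂ} (hu : ∀ k, IsSolution A R (u k))
    (hinf : ∀ x, Tendsto (fun k => 1 - ‖u k x‖ ^ 2) atTop (𝓝 0)) {p : S} {l : ℂ}
    (hlim : Tendsto (fun k => u k p) atTop (𝓝 l)) :
    ∃ f : S → ℂ, (∀ x, ‖f x‖ = 1) ∧ TendstoLocallyUniformly u f atTop ∧
      ContMDiff modelR 𝓘(ℝ, ℂ) ∞ f ∧
      (∀ (x : S) (v : TangentSpace modelR x), surfaceDeriv f x v = vectorField (A x v) (f x)) ∧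
      ∀ x : modelR.boundary S, f x = (δ x).endpoint := by
  have hconn : ConnectedSpace S := RiemannSurfaceWithBoundary.connected
  choose N hN _ hN2 using exists_local_convergence hA hflat hδ hcov hR
  have hnorm : ∀ x l, Tendsto (fun k => u k x) atTop (𝓝 l) → ‖l‖ = 1 := fun x l h => by
    have h1 := tendsto_nhds_unique (hinf x) ((h.norm.pow 2).const_sub 1)
    have h2 := norm_nonneg l
    nlinarith
  have hZ : IsClopen {x : S | ∃ l, Tendsto (fun k => u k x) atTop (𝓝 l)} := by
    have key : ∀ x : S, ∀ y ∈ N x, (∃ l, Tendsto (fun k => u k y) atTop (𝓝 l)) →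
        ∀ y' ∈ N x, ∃ l, Tendsto (fun k => u k y') atTop (𝓝 l) := fun x y hy ⟨l, hl⟩ y' hy' => by
      obtain ⟨f, hf, -⟩ := hN2 x u hu y hy l (hnorm y l hl) hl
      exact ⟨_, hf.tendsto_at hy'⟩
    constructor
    · refine isClosed_of_closure_subset fun x hx => ?_
      obtain ⟨y, hyN, hy⟩ := mem_closure_iff_nhds.1 hx _ (hN x)
      exact key x y hyN hy x (mem_of_mem_nhds (hN x))
    · exact isOpen_iff_mem_nhds.2 fun x hx =>
        mem_of_superset (hN x) (key x x (mem_of_mem_nhds (hN x)) hx)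
  have hall : ∀ x, ∃ l, Tendsto (fun k => u k x) atTop (𝓝 l) := fun x =>
    (hZ.eq_univ ⟨p, l, hlim⟩).symm.subset (mem_univ x)
  choose f hf using hall
  have hloc : ∀ x, TendstoUniformlyOn u f atTop (N x) ∧ ContMDiffAt modelR 𝓘(ℝ, ℂ) ∞ f x ∧
      ∀ v, surfaceDeriv f x v = vectorField (A x v) (f x) := fun x => by
    obtain ⟨f', h1, h2, h3⟩ := hN2 x u hu x (mem_of_mem_nhds (hN x)) _ (hnorm x _ (hf x)) (hf x)
    have heq : EqOn f' f (N x) := fun y hy => tendsto_nhds_unique (h1.tendsto_at hy) (hf y)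
    have heq' : f =ᶠ[𝓝 x] f' := by
      filter_upwards [hN x] with y hy
      exact (heq hy).symm
    refine ⟨h1.congr_right heq, h2.congr_of_eventuallyEq heq', fun v => ?_⟩
    have h4 : surfaceDeriv f x v = surfaceDeriv f' x v :=
      congrArg (fun L : ℂ →L[ℝ] ℂ => L v) heq'.mfderiv_eq
    rw [h4, h3, heq (mem_of_mem_nhds (hN x))]
  refine ⟨f, fun x => hnorm x _ (hf x), ?_, fun x => (hloc x).2.1, fun x => (hloc x).2.2,
    fun x => ?_⟩
  · exact fun s hs x => ⟨N x, hN x, (hloc x).1 s hs⟩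
  · rw [← hR x, GeodesicRay.endpoint_germ]
    -- The limit has norm one and lies in the closure of the ray R x, which meets the circle only in
    -- its endpoint.
    refine (R x).existsUnique_isEndpoint.unique ⟨hnorm _ _ (hf x), ?_⟩ (R x).isEndpoint_endpoint
    exact mem_closure_of_tendsto (hf x) (Eventually.of_forall fun k => (hu k).boundary x)

end

end

/-! ### Proof of the theorem -/

theorem mainTheorem8 {S : Type*} [TopologicalSpace S] [ChartedSpace ClosedHalfPlane S]
    [RiemannSurfaceWithBoundary S]
    (A : OneForm S) (hA : A.IsSmooth) (hflat : A.IsFlat)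
    (δ : modelR.boundary S → GeodesicGerm) (hδ : IsSmoothGermFamily δ)
    (hcov : IsCovariantlyConstant A fun z => (δ z).endpoint)
    (R : modelR.boundary S → GeodesicRay) (hR : ∀ z, (R z).germ = δ z)
    (u : ℕ → S → ℂ) (hu : ∀ k, IsSolution A R (u k))
    (K₀ : Set S) (hK₀ : IsCompact K₀) (z : ℕ → S) (hz : ∀ k, z k ∈ K₀)
    (hlim : Tendsto (fun k => Metric.infDist (u k (z k)) circleAtInfinity) atTop (𝓝 0)) :
    (∀ K : Set S, IsCompact K →
      TendstoUniformlyOn (fun k x => Metric.infDist (u k x) circleAtInfinity) (fun _ => 0)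
        atTop K) ∧
    ∃ (φ : ℕ → ℕ) (uInf : S → ℂ), StrictMono φ ∧
      (∀ x, uInf x ∈ circleAtInfinity) ∧
      (∀ K : Set S, IsCompact K → TendstoUniformlyOn (fun k => u (φ k)) uInf atTop K) ∧
      ContMDiff modelR 𝓘(ℝ, ℂ) ∞ uInf ∧
      (∀ (x : S) (v : TangentSpace modelR x),
        surfaceDeriv uInf x v = vectorField (A x v) (uInf x)) ∧
      ∀ x : modelR.boundary S, uInf x = (δ x).endpoint := by
  have hfst : SecondCountableTopology S := RiemannSurfaceWithBoundary.secondCountable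
  have hconn : ConnectedSpace S := RiemannSurfaceWithBoundary.connected
  have hlim' : Tendsto (fun k => 1 - ‖u k (z k)‖ ^ 2) atTop (𝓝 0) := by
    have h2 := hlim.const_mul 2
    rw [mul_zero] at h2
    refine squeeze_zero (fun k => one_sub_norm_sq_nonneg ((hu k).norm_lt_one _).le)
      (fun k => ?_) h2
    have h1 := ((hu k).norm_lt_one (z k)).le
    rw [infDist_circleAtInfinity h1]
    nlinarith [norm_nonneg (u k (z k))]
  have hinf : ∀ x, Tendsto (fun k => 1 - ‖u k x‖ ^ 2) atTop (𝓝 0) := fun x => by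
    -- The points z_k need not converge, but by compactness every subsequence of them has a
    -- convergent one, and that suffices for the limit of the full sequence.
    refine tendsto_of_subseq_tendsto fun ns hns => ?_
    obtain ⟨p, -, ms, hms, hp⟩ := hK₀.isSeqCompact (x := z ∘ ns) fun k => hz _
    exact ⟨ms, tendsto_one_sub_norm_sq hA hflat hδ hcov hR (u := fun k => u (ns (ms k)))
      (fun k => hu _) hp (hlim'.comp (hns.comp hms.tendsto_atTop)) x⟩
  refine ⟨fun K hK => ?_, ?_⟩
  · have hloc : TendstoLocallyUniformlyOn (fun k x => Metric.infDist (u k x) circleAtInfinity)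
        (fun _ => 0) atTop K := fun s hs x _ => by
      obtain ⟨N, hN, hN1, -⟩ := exists_local_convergence hA hflat hδ hcov hR x
      refine ⟨N, mem_nhdsWithin_of_mem_nhds hN, ?_⟩
      have h1 := hN1 u hu (fun _ => x) (Eventually.of_forall fun _ => mem_of_mem_nhds hN) (hinf x)
      have h2 : TendstoUniformlyOn (fun k x => Metric.infDist (u k x) circleAtInfinity)
          (fun _ => 0) atTop N := by
        rw [Metric.tendstoUniformlyOn_iff] at h1 ⊢
        intro ε hε
        filter_upwards [h1 ε hε] with k hk y hy
        have h3 := hk y hy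
        have h4 := ((hu k).norm_lt_one y).le
        rw [dist_zero_left, Real.norm_of_nonneg (one_sub_norm_sq_nonneg h4)] at h3
        rw [dist_zero_left, Real.norm_of_nonneg Metric.infDist_nonneg, infDist_circleAtInfinity h4]
        nlinarith [norm_nonneg (u k y)]
      exact h2 s hs
    exact (tendstoLocallyUniformlyOn_iff_tendstoUniformlyOn_of_compact hK).1 hloc
  · obtain ⟨p⟩ : Nonempty S := inferInstance
    -- A subsequence converging at a single point is enough; `exists_limit` does the rest, and no
    -- diagonal argument is needed.
    obtain ⟨l, -, φ, hφ, hl⟩ := (isCompact_closedBall (0 : ℂ) 1).isSeqCompact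
      (x := fun k => u k p) fun k => by simpa using ((hu k).norm_lt_one p).le
    obtain ⟨f, hf1, hf2, hf3, hf4, hf5⟩ := exists_limit hA hflat hδ hcov hR
      (u := fun k => u (φ k)) (fun k => hu _) (fun x => (hinf x).comp hφ.tendsto_atTop) hl
    exact ⟨φ, f, hφ, fun x => by simpa using hf1 x, fun K hK =>
      (tendstoLocallyUniformlyOn_iff_tendstoUniformlyOn_of_compact hK).1
        hf2.tendstoLocallyUniformlyOn, hf3, hf4, hf5⟩
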